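/- **Setting.** Let $(Z_t)_{t\in\mathbb Z}$ be i.i.d. real random variables on a probability space with $\mathbb E Z_0=0$, $\mathbb E Z_0^2=1$, and let $\mathcal F_t=\sigma(Z_k;\,k\le t)$. Let $\{g_\theta:\theta\in\Theta\}$, $\Theta\subset\mathbb R^d$, be a family of nonnegative functions $g_\theta(x,u)$ on $\mathbb R^p\times[0,\infty)^q$, measurable in $x$. Suppose that for some $\theta_0\in\Theta$ the model $$X_t=\sigma_tZ_t,\qquad \sigma_t^2=g_{\theta_0}(X_{t-1},\dots,X_{t-p};\sigma_{t-1}^2,\dots,\sigma_{t-q}^2),\qquad t\in\mathbb Z,$$ with $\sigma_t\ge 0$ being $\mathcal F_{t-1}$-measurable, has a unique stationary ergodic solution $((X_t,\sigma_t))$, and put $\mathbf X_t=(X_t,\dots,X_{t-p+1})$. Let $K\subset\mathbb R^d$ be compact and $\|v\|_K=\sup_{\theta\in K}|v(\theta)|$. For a map $\phi$ of a metric space into itself let $\Lambda(\phi)=\sup_{x\ne y}d(\phi(x),\phi(y))/d(x,y)$. A function on a set $S\subset\mathbb R^n$ which is the closure of its interior is called continuously differentiable on $S$ if it is continuous on $S$,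 differentiable in the interior of $S$, and its derivative extends continuously to $S$; derivatives on $S$ denote this extension. Put $$\psi_t(\theta,u)=(g_\theta(\mathbf X_t,u),u_1,\dots,u_{q-1}),\qquad[\Phi_t(s)](\theta)=\psi_t(\theta,s(\theta)),\quad s\in\mathbb C(K,[0,\infty)^q),$$ and $\Phi_t^{(r)}=\Phi_t\circ\Phi_{t-1}\circ\dots\circ\Phi_{t-r+1}$. Fix $\varsigma\in[0,\infty)^q$ and put $\hat h_0\equiv\varsigma$, $\hat h_{t+1}=\Phi_t(\hat h_t)$, $t\in\mathbb N$. Let $\partial_j^k\psi_t$ be the partial derivative of the $j$-th component of $\psi_t$ with respect to the $k$-th of the $d+q$ coordinates of $(\theta,u)$. **Condition D.1.** $K$ is contained in the interior of $\Theta$ and is the closure of its interior; for every $x\in\mathbb R^p$ the function $(\theta,u)\mapsto g_\theta(x,u)$ is continuously differentiable on $K\times[0,\infty)^q$; $\mathbb E[\log^+\|\Phi_0(\varsigma)\|_K]<\infty$ and $\mathbb E[\log^+\Lambda(\Phi_0)]<\infty$; and $\mathbb E[\log\Lambda(\Phi_0^{(r)})]<0$ (possibly $-\infty$) for some integer $r\ge1$.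 **Condition D.2**, for a stationary solution $(h_t)_{t\in\mathbb Z}$ of the stochastic recurrence equation $h_{t+1}=\Phi_t(h_t)$ on $\mathbb C(K,[0,\infty)^q)$. For all $j\in\{1,\dots,q\}$ and $k\in\{1,\dots,d+q\}$, $$\mathbb E\Big[\log^+\sup_{\theta\in K}|\partial_j^k\psi_0(\theta,h_0(\theta))|\Big]<\infty,$$ and there are a stationary sequence $(\bar C_1(t))_{t\in\mathbb Z}$ with $\mathbb E[\log^+\bar C_1(0)]<\infty$ and $\kappa\in(0,1]$ such that a.s., for all $t\in\mathbb Z$, all such $j,k$ and all $u,\tilde u\in[0,\infty)^q$, $$\sup_{\theta\in K}|\partial_j^k\psi_t(\theta,u)-\partial_j^k\psi_t(\theta,\tilde u)|\le\bar C_1(t)|u-\tilde u|^\kappa .$$ **Proposition 6.1.** Assume D.1. Then the equation $h_{t+1}=\Phi_t(h_t)$, $t\in\mathbb Z$, has a stationary solution $(h_t)$. If D.2 holds for $(h_t)$, then the linear stochastic recurrence equation on $\mathbb C(K,\mathbb R^{dq})$ $$[d_{t+1}(\theta)]_{(j-1)d+k}=\partial_j^k\psi_t(\theta,h_t(\theta))+\sum_{i=1}^q\partial_j^{d+i}\psi_t(\theta,h_t(\theta))\,[d_t(\theta)]_{(i-1)d+k},\qquad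 1\le j\le q,\ 1\le k\le d,\ t\in\mathbb Z,$$ has a stationary solution $(d_t)$, unique up to almost sure equality; it is ergodic and (in a suitable version) $d_t$ is $\mathcal F_{t-1}$-measurable for every $t$. For every $t\in\mathbb Z$, almost surely $h_t$ is continuously differentiable on $K$ with $h_t'=d_t$, where $f'=(\partial f_j/\partial\theta_k)_{j,k}\in\mathbb R^{dq}$. Moreover, the functions $\hat h_t$ are continuously differentiable on $K$, and $\|\hat h_t'-d_t\|_K\to0$ exponentially fast a.s. as $t\to\infty$: there is a constant $\gamma>1$ with $\gamma^t\|\hat h_t'-d_t\|_K\to0$ a.s. -/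

import Mathlib

open MeasureTheory ProbabilityTheory Filter Topology
open scoped ENNReal NNReal

noncomputable section

/-! ### Random elements and stationary ergodic sequences -/

/-- The Borel `σ`-algebra of the sup-norm topology (compact-open topology) on `C(X, Y)`. -/
instance instMeasurableSpaceContinuousMap {X Y : Type*} [TopologicalSpace X]
    [TopologicalSpace Y] : MeasurableSpace C(X, Y) := borel _

instance instBorelSpaceContinuousMap {X Y : Type*} [TopologicalSpace X]
    [TopologicalSpace Y] : BorelSpace C(X, Y) := ⟨rfl⟩

/-- The left shift on two-sided sequences. -/
def shiftSeq {E : Type*} (x : ℤ → E) : ℤ → E := fun t => x (t + 1)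

/-- The law of the process `v` on the path space `ℤ → E` with the product `σ`-algebra. -/
def processLaw {Ω E : Type*} [MeasurableSpace Ω] [MeasurableSpace E] (P : Measure Ω)
    (v : ℤ → Ω → E) : Measure (ℤ → E) :=
  P.map (fun ω t => v t ω)

/-- `v` is a (strictly) stationary sequence of random elements. -/
structure IsStationarySeq {Ω E : Type*} [MeasurableSpace Ω] [MeasurableSpace E]
    (P : Measure Ω) (v : ℤ → Ω → E) : Prop where
  aemeasurable : ∀ t, AEMeasurable (v t) P
  map_shift : (processLaw P v).map shiftSeq = processLaw P v

/-- `v` is a stationary ergodic sequence: the shift preserves the law of `v` and is ergodic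
with respect to it. -/
structure IsStationaryErgodicSeq {Ω E : Type*} [MeasurableSpace Ω] [MeasurableSpace E]
    (P : Measure Ω) (v : ℤ → Ω → E) : Prop where
  aemeasurable : ∀ t, AEMeasurable (v t) P
  ergodic : Ergodic shiftSeq (processLaw P v)

/-- Exponentially fast almost sure convergence to zero of a sequence of norms: there is a
deterministic `γ > 1` with `γ ^ t * u t → 0` almost surely. -/
def ExpFastAS {Ω : Type*} [MeasurableSpace Ω] (P : Measure Ω) (u : ℕ → Ω → ℝ≥0∞) : Prop :=
  ∃ γ : ℝ≥0, 1 < γ ∧ ∀ᵐ ω ∂P, Tendsto (fun t : ℕ => (γ : ℝ≥0∞) ^ t * u t ω) atTop (𝓝 0)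

/-! ### Logarithmic moments, Lipschitz constants, iterates -/

/-- `log⁺ y = max (log y) 0`, for `y ∈ [0, ∞]`. -/
def logPlus (y : ℝ≥0∞) : ℝ≥0∞ := (ENNReal.log y).toENNReal

/-- `log⁻ y = max (-log y) 0`, for `y ∈ [0, ∞]`; the value at `0` is `∞`. -/
def logMinus (y : ℝ≥0∞) : ℝ≥0∞ := (-ENNReal.log y).toENNReal

/-- `E[log⁺ Y] < ∞`. -/
def FiniteLogPlusMoment {Ω : Type*} [MeasurableSpace Ω] (P : Measure Ω) (Y : Ω → ℝ≥0∞) : Prop :=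
  ∫⁻ ω, logPlus (Y ω) ∂P < ∞

/-- `E[log Y] < 0`: the expectation `E[log⁺ Y] - E[log⁻ Y]` is well defined in `[-∞, ∞)` and
negative; the value `-∞` is allowed. -/
def NegativeLogMean {Ω : Type*} [MeasurableSpace Ω] (P : Measure Ω) (Y : Ω → ℝ≥0∞) : Prop :=
  ∫⁻ ω, logPlus (Y ω) ∂P < ∫⁻ ω, logMinus (Y ω) ∂P

/-- The Lipschitz constant `Λ(φ) = sup_{x ≠ y} d(φ x, φ y) / d(x, y)`. -/
def lipConst {E : Type*} [MetricSpace E] (φ : E → E) : ℝ≥0∞ :=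
  ⨆ (x : E) (y : E) (_ : x ≠ y), edist (φ x) (φ y) / edist x y

/-- `φ_t^{(r)} = φ_t ∘ φ_{t-1} ∘ ⋯ ∘ φ_{t-r+1}`, with `φ_t^{(0)} = id`. -/
def pastIterate {E : Type*} (φ : ℤ → E → E) : ℤ → ℕ → E → E
  | _, 0 => id
  | t, r + 1 => φ t ∘ pastIterate φ (t - 1) r

/-! ### Function spaces and continuous differentiability on closed sets -/

/-- `ℝⁿ` with the Euclidean norm. -/
abbrev Vec (n : ℕ) : Type := EuclideanSpace ℝ (Fin n)

/-- `ℝ^{dq}`, the space of first derivatives of maps `ℝᵈ → ℝ^q`; the coordinate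
`(j - 1) d + k` is indexed by the pair `(j, k)`. -/
abbrev DerivVec (d q : ℕ) : Type := EuclideanSpace ℝ (Fin q × Fin d)

/-- `[0, ∞)^q`. -/
def orthant (q : ℕ) : Set (Vec q) := {u | ∀ j, 0 ≤ u j}

/-- `C(K, [0, ∞)^q)` with the metric of the sup norm. -/
abbrev NonnegFun {d : ℕ} (K : TopologicalSpace.Compacts (Vec d)) (q : ℕ) : Type :=
  {s : C(K, Vec q) // ∀ θ, s θ ∈ orthant q}

/-- The constant function with value `ς`. -/
def constFun {d q : ℕ} (K : TopologicalSpace.Compacts (Vec d)) (ς : orthant q) : NonnegFun K q :=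
  ⟨ContinuousMap.const K (ς : Vec q), fun _ => ς.2⟩

/-- The sup norm `‖f‖_K` with values in `[0, ∞]`. -/
def supNorm {d : ℕ} (K : TopologicalSpace.Compacts (Vec d)) {F : Type*} [NormedAddCommGroup F]
    (f : K → F) : ℝ≥0∞ :=
  ⨆ θ : K, ‖f θ‖ₑ

/-- `f` is continuously differentiable on a set `S` that is the closure of its interior: `f` is
continuous on `S`, differentiable in the interior of `S`, and the derivative extends continuously
from the interior to `S`. -/
def C1On {E F : Type*} [NormedAddCommGroup E] [NormedSpace ℝ E] [NormedAddCommGroup F]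
    [NormedSpace ℝ F] (S : Set E) (f : E → F) : Prop :=
  ContinuousOn f S ∧
    ∃ D : E → E →L[ℝ] F, ContinuousOn D S ∧ ∀ x ∈ interior S, HasFDerivAt f (D x) x

/-- The derivative on `S` of a function that is continuously differentiable on `S`: the continuous
extension to `S` of the derivative in the interior of `S`. -/
def derivOn {E F : Type*} [NormedAddCommGroup E] [NormedSpace ℝ E] [NormedAddCommGroup F]
    [NormedSpace ℝ F] (S : Set E) (f : E → F) : E → E →L[ℝ] F :=
  extendFrom (interior S) (fderiv ℝ f)

open Classical in
/-- A function on `K` as a function on `ℝᵈ`, with value `0` outside `K`. -/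
def zeroExt {d q : ℕ} (K : TopologicalSpace.Compacts (Vec d)) (f : K → Vec q) : Vec d → Vec q :=
  fun θ => if h : θ ∈ K then f ⟨θ, h⟩ else 0

/-- `f : K → ℝ^q` is continuously differentiable on `K`. -/
def IsC1 {d q : ℕ} (K : TopologicalSpace.Compacts (Vec d)) (f : K → Vec q) : Prop :=
  C1On (K : Set (Vec d)) (zeroExt K f)

/-- The vector `f'(θ)` of the first partial derivatives `∂ f_j / ∂ θ_k` of `f : K → ℝ^q`. -/
def firstDeriv {d q : ℕ} (K : TopologicalSpace.Compacts (Vec d)) (f : K → Vec q) (θ : K) :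
    DerivVec d q :=
  WithLp.toLp 2 fun jk =>
    (derivOn (K : Set (Vec d)) (zeroExt K f) θ (EuclideanSpace.single jk.2 1)) jk.1

/-! ### The conditionally heteroscedastic model -/

/-- A parametric family `{g_θ : θ ∈ Θ}` of nonnegative functions `g_θ(x, u)` on
`ℝᵖ × [0, ∞)^q`, measurable in `x`. The values of `g` outside `Θ × ℝᵖ × [0, ∞)^q` play no role. -/
structure VolatilityFamily (d p q : ℕ) where
  Θ : Set (Vec d)
  g : Vec d → (Fin p → ℝ) → Vec q → ℝ
  nonneg : ∀ θ ∈ Θ, ∀ x, ∀ u ∈ orthant q, 0 ≤ g θ x u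
  measurable : ∀ θ ∈ Θ, ∀ u ∈ orthant q, Measurable fun x => g θ x u

/-- `(Z_t)` is i.i.d. with mean zero and second moment one. -/
structure IsNoise {Ω : Type*} [MeasurableSpace Ω] (P : Measure Ω) (Z : ℤ → Ω → ℝ) : Prop where
  measurable : ∀ t, Measurable (Z t)
  indep : iIndepFun Z P
  identDistrib : ∀ t, IdentDistrib (Z t) (Z 0) P P
  memLp : MemLp (Z 0) 2 P
  mean : ∫ ω, Z 0 ω ∂P = 0
  second_moment : ∫ ω, Z 0 ω ^ 2 ∂P = 1

/-- `ℱ_t = σ(Z_k ; k ≤ t)`. -/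
@[reducible] def pastField {Ω : Type*} (Z : ℤ → Ω → ℝ) (t : ℤ) : MeasurableSpace Ω :=
  ⨆ k : ℤ, ⨆ _ : k ≤ t, MeasurableSpace.comap (Z k) inferInstance

/-- The vector `(Y_t, Y_{t-1}, …, Y_{t-n+1})`. -/
def lagVec {Ω : Type*} (n : ℕ) (Y : ℤ → Ω → ℝ) (t : ℤ) (ω : Ω) : Fin n → ℝ :=
  fun i => Y (t - (i : ℕ)) ω

namespace VolatilityFamily

variable {d p q : ℕ} (M : VolatilityFamily d p q)

/-- `((X_t, σ_t))` solves `X_t = σ_t Z_t`,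
`σ_t² = g_θ(X_{t-1}, …, X_{t-p}; σ_{t-1}², …, σ_{t-q}²)`, where `σ_t` is nonnegative and
`ℱ_{t-1}`-measurable. -/
structure IsSolution {Ω : Type*} [MeasurableSpace Ω] (P : Measure Ω) (Z : ℤ → Ω → ℝ)
    (θ : Vec d) (X σ : ℤ → Ω → ℝ) : Prop where
  measurable : ∀ t, Measurable[pastField Z (t - 1)] (σ t)
  nonneg : ∀ t, ∀ᵐ ω ∂P, 0 ≤ σ t ω
  obs : ∀ t, ∀ᵐ ω ∂P, X t ω = σ t ω * Z t ω
  vol : ∀ t, ∀ᵐ ω ∂P, σ t ω ^ 2 =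
    M.g θ (lagVec p X (t - 1) ω) (WithLp.toLp 2 fun i => lagVec q σ (t - 1) ω i ^ 2)

/-- `((X_t, σ_t))` is the unique stationary ergodic solution of the model with parameter `θ`. -/
structure IsUniqueStationaryErgodicSolution {Ω : Type*} [MeasurableSpace Ω] (P : Measure Ω)
    (Z : ℤ → Ω → ℝ) (θ : Vec d) (X σ : ℤ → Ω → ℝ) : Prop where
  isSolution : M.IsSolution P Z θ X σ
  stationaryErgodic : IsStationaryErgodicSeq P fun t ω => (X t ω, σ t ω)
  unique : ∀ X' σ' : ℤ → Ω → ℝ, M.IsSolution P Z θ X' σ' →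
    IsStationaryErgodicSeq P (fun t ω => (X' t ω, σ' t ω)) →
      ∀ t, ∀ᵐ ω ∂P, X' t ω = X t ω ∧ σ' t ω = σ t ω

/-- The map `(θ, u) ↦ (g_θ(x, u), u_1, …, u_{q-1})`; with `x = (X_t, …, X_{t-p+1})` this is
`ψ_{t,1}`. -/
def psi (x : Fin p → ℝ) (z : Vec d × Vec q) : Vec q :=
  WithLp.toLp 2 fun j : Fin q =>
    if (j : ℕ) = 0 then M.g z.1 x z.2 else z.2 ⟨(j : ℕ) - 1, by omega⟩

/-- The regularity of the family on the compact set `K`: `K` lies in the interior of `Θ`, `K` is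
the closure of its interior, and `(θ, u) ↦ g_θ(x, u)` is continuously differentiable on
`K × [0, ∞)^q` for every `x`. -/
structure IsRegularOn (K : TopologicalSpace.Compacts (Vec d)) : Prop where
  subset_interior : (K : Set (Vec d)) ⊆ interior M.Θ
  closure_interior : closure (interior (K : Set (Vec d))) = K
  c1 : ∀ x, C1On ((K : Set (Vec d)) ×ˢ orthant q) fun z => M.g z.1 x z.2

variable {M} {K : TopologicalSpace.Compacts (Vec d)}

/-- The map `Φ` on `C(K, [0, ∞)^q)` given by
`[Φ(s)](θ) = (g_θ(x, s(θ)), s_1(θ), …, s_{q-1}(θ))`; with `x = (X_t, …, X_{t-p+1})` this is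
`Φ_t`. -/
def IsRegularOn.Phi (hM : M.IsRegularOn K) (x : Fin p → ℝ) (s : NonnegFun K q) : NonnegFun K q :=
  ⟨⟨fun θ => M.psi x (θ, s.1 θ), by
      have h1 : Continuous fun θ : K => M.g θ x (s.1 θ) :=
        (hM.c1 x).1.comp_continuous (f := fun θ : K => ((θ : Vec d), s.1 θ))
          (by fun_prop) (fun θ => ⟨θ.2, s.2 θ⟩)
      refine (PiLp.continuous_toLp 2 _).comp (continuous_pi fun j => ?_)
      by_cases hj : (j : ℕ) = 0
      · simpa only [hj, if_true] using h1
      · simp only [hj, if_false]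
        fun_prop⟩, by
      intro θ j
      by_cases hj : (j : ℕ) = 0
      · simpa [psi, hj] using
          M.nonneg θ (interior_subset (hM.subset_interior θ.2)) x (s.1 θ) (s.2 θ)
      · simpa [psi, hj] using s.2 θ ⟨(j : ℕ) - 1, by omega⟩⟩

/-- The random map `Φ_t`. -/
def IsRegularOn.randomPhi (hM : M.IsRegularOn K) {Ω : Type*} (X : ℤ → Ω → ℝ) (ω : Ω) (t : ℤ) :
    NonnegFun K q → NonnegFun K q :=
  hM.Phi (lagVec p X t ω)

/-- `ĥ_0 = ς`, `ĥ_{t+1} = Φ_t(ĥ_t)`. -/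
def IsRegularOn.hHat (hM : M.IsRegularOn K) {Ω : Type*} (X : ℤ → Ω → ℝ) (ς : orthant q) :
    ℕ → Ω → NonnegFun K q
  | 0, _ => constFun K ς
  | t + 1, ω => hM.randomPhi X ω (t : ℤ) (hM.hHat X ς t ω)

/-- The contraction-on-average conditions on `(Φ_t)`. -/
structure IsRegularOn.IsContractiveOnAverage (hM : M.IsRegularOn K) {Ω : Type*}
    [MeasurableSpace Ω] (P : Measure Ω) (X : ℤ → Ω → ℝ) (ς : orthant q) : Prop where
  init : FiniteLogPlusMoment P fun ω => ‖(hM.randomPhi X ω 0 (constFun K ς)).1‖ₑ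
  lip : FiniteLogPlusMoment P fun ω => lipConst (hM.randomPhi X ω 0)
  contr : ∃ r : ℕ, 1 ≤ r ∧
    NegativeLogMean P fun ω => lipConst (pastIterate (hM.randomPhi X ω) 0 r)

/-- `h` is a stationary solution of the SRE `s_{t+1} = Φ_t(s_t)`, `t ∈ ℤ`, on
`C(K, [0, ∞)^q)`. -/
structure IsRegularOn.IsStationarySolution (hM : M.IsRegularOn K) {Ω : Type*}
    [MeasurableSpace Ω] (P : Measure Ω) (X : ℤ → Ω → ℝ) (h : ℤ → Ω → NonnegFun K q) : Prop where
  stationary : IsStationarySeq P h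
  sre : ∀ t, ∀ᵐ ω ∂P, h (t + 1) ω = hM.randomPhi X ω t (h t ω)

variable (M K)

/-- The unit directions of `ℝᵈ × ℝ^q`: the first `d` coordinates are the parameter coordinates,
the last `q` are the coordinates of `u`. -/
def direction : Fin d ⊕ Fin q → Vec d × Vec q :=
  Sum.elim (fun k => (EuclideanSpace.single k 1, 0)) (fun i => (0, EuclideanSpace.single i 1))

/-- The partial derivative `∂_j^k ψ(θ, u)` on `K × [0, ∞)^q`. -/
def dpsi (x : Fin p → ℝ) (j : Fin q) (k : Fin d ⊕ Fin q) (θ : Vec d) (u : Vec q) : ℝ :=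
  (derivOn ((K : Set (Vec d)) ×ˢ orthant q) (M.psi x) (θ, u) (direction k)) j

/-- The moment and Hölder conditions on the partial derivatives of `ψ_{t,1}`. -/
structure DerivCondition {Ω : Type*} [MeasurableSpace Ω] (P : Measure Ω) (X : ℤ → Ω → ℝ)
    (h : ℤ → Ω → NonnegFun K q) : Prop where
  moment : ∀ (j : Fin q) (k : Fin d ⊕ Fin q), FiniteLogPlusMoment P fun ω =>
    supNorm K fun θ => M.dpsi K (lagVec p X 0 ω) j k θ ((h 0 ω).1 θ)
  holder : ∃ (C : ℤ → Ω → ℝ) (κ : ℝ), IsStationarySeq P C ∧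
    (FiniteLogPlusMoment P fun ω => ENNReal.ofReal (C 0 ω)) ∧ 0 < κ ∧ κ ≤ 1 ∧
    ∀ t, ∀ᵐ ω ∂P, ∀ (j : Fin q) (k : Fin d ⊕ Fin q), ∀ u ∈ orthant q, ∀ u' ∈ orthant q,
      ∀ θ ∈ K, |M.dpsi K (lagVec p X t ω) j k θ u - M.dpsi K (lagVec p X t ω) j k θ u'| ≤
        C t ω * ‖u - u'‖ ^ κ

/-- `(d_t)` solves the linear SRE on `C(K, ℝ^{dq})`
`[d_{t+1}(θ)]_{(j,k)} = ∂_j^k ψ_{t,1}(θ, h_t(θ))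
  + ∑_i ∂_j^{d+i} ψ_{t,1}(θ, h_t(θ)) [d_t(θ)]_{(i,k)}`, `t ∈ ℤ`. -/
def SolvesDerivSRE {Ω : Type*} [MeasurableSpace Ω] (P : Measure Ω) (X : ℤ → Ω → ℝ)
    (h : ℤ → Ω → NonnegFun K q) (D : ℤ → Ω → C(K, DerivVec d q)) : Prop :=
  ∀ t, ∀ᵐ ω ∂P, ∀ (θ : K) (j : Fin q) (k : Fin d),
    D (t + 1) ω θ (j, k) =
      M.dpsi K (lagVec p X t ω) j (Sum.inl k) θ ((h t ω).1 θ) +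
        ∑ i : Fin q, M.dpsi K (lagVec p X t ω) j (Sum.inr i) θ ((h t ω).1 θ) * D t ω θ (i, k)

end VolatilityFamily

end

open MeasureTheory ProbabilityTheory Filter Topology
open scoped ENNReal NNReal

/-! Everything is reduced to statements about one path of the observations. Almost surely the
iterates of `Φ` started at time `i` contract like `exp (-ε n)`, up to a factor `exp (δ |i|)` with
`δ` as small as desired (`ContractsExp`), while the random coefficients grow subexponentially.
Backward iterates of a fixed point are then Cauchy and their limit solves the recursion. Any other
stationary solution agrees with this limit: its distance to a fixed point has the same law at all
times, so its contribution from the remote past vanishes in probability.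

The contraction is `ae_contractsExp`. The logarithm of the Lipschitz constant of an `r`-fold iterate
is majorised by an integrable function of negative mean, whose Birkhoff sums are controlled by a
maximal ergodic argument. Since the `r`-th power of an ergodic shift need not be ergodic, the path
is not cut at multiples of `r`. Instead a product of `r` consecutive Lipschitz constants, those of
the iterates of lengths `n, …, n + r - 1`, is moved forward one step at a time
(`prod_lipConst_le_exp`).

If `s` has derivative `e`, then `Φ s` has derivative `derivStep s e`, which is affine in `e`. The
linear part of an `n`-fold composition of these steps is the Jacobian in `u` of the `n`-fold
composition of `ψ(θ, ·)`, and its norm is at most the Lipschitz constant of the iterate of `Φ`,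
tested on constant functions (`dist_forwardIterate_pathStep_le`). Hence the derivative recursion
along any orbit inherits the contraction of `Φ`, and its stationary solution `d` arises as the same
kind of backward limit.

The derivative of an orbit started from a constant follows the derivative recursion along that orbit
instead of along `h`. The orbit approaches `h` exponentially fast, so by Hölder continuity the
one-step errors are exponentially small, and telescoping against the contraction bounds the distance
to `d` with explicit dependence on the starting time (`exists_dist_deriv_orbit_le`). Starting at `0`
gives the convergence of `ĥ_n'`. Starting at `t - n` shows that the derivatives of the backward
iterates converge uniformly to `d_t` while the iterates converge to `h_t`; hence `h_t' = d_t`. -/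

/-- `φ_{i+n-1} ∘ ⋯ ∘ φ_{i+1} ∘ φ_i`. -/
def forwardIterate {E : Type*} (φ : ℤ → E → E) (i : ℤ) : ℕ → E → E
  | 0 => id
  | n + 1 => fun u => φ (i + n) (forwardIterate φ i n u)

/-! ### Iterates of time-dependent maps -/

section ForwardIterate

variable {E : Type*} (φ : ℤ → E → E)

@[simp] theorem forwardIterate_zero (i : ℤ) (u : E) : forwardIterate φ i 0 u = u := rfl

theorem forwardIterate_succ (i : ℤ) (n : ℕ) (u : E) :
    forwardIterate φ i (n + 1) u = φ (i + n) (forwardIterate φ i n u) := rfl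

theorem forwardIterate_add (i : ℤ) (m n : ℕ) (u : E) :
    forwardIterate φ i (m + n) u = forwardIterate φ (i + m) n (forwardIterate φ i m u) := by
  induction n with
  | zero => rfl
  | succ n ih =>
    rw [← add_assoc, forwardIterate_succ, ih, forwardIterate_succ]
    congr 1
    push_cast
    ring

theorem forwardIterate_succ' (i : ℤ) (n : ℕ) (u : E) :
    forwardIterate φ i (n + 1) u = forwardIterate φ (i + 1) n (φ i u) := by
  have := forwardIterate_add φ i 1 n u
  rw [add_comm 1 n] at this
  simpa [forwardIterate_succ] using this

theorem pastIterate_eq_forwardIterate (t : ℤ) (n : ℕ) :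
    pastIterate φ t n = forwardIterate φ (t - n + 1) n := by
  induction n generalizing t with
  | zero => rfl
  | succ n ih =>
    funext u
    rw [pastIterate, Function.comp_apply, ih, forwardIterate_succ]
    push_cast
    congr 1
    · ring_nf
    · ring_nf

theorem forwardIterate_shift (i k : ℤ) (n : ℕ) :
    forwardIterate (fun t => φ (t + k)) i n = forwardIterate φ (i + k) n := by
  induction n with
  | zero => rfl
  | succ n ih =>
    funext u
    rw [forwardIterate_succ, forwardIterate_succ, ih]
    congr 1
    ring

theorem forwardIterate_eq_of_solves {h : ℤ → E} (hh : ∀ t, h (t + 1) = φ t (h t)) (i : ℤ) (n : ℕ) :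
    forwardIterate φ i n (h i) = h (i + n) := by
  induction n with
  | zero => simp
  | succ n ih =>
    rw [forwardIterate_succ, ih, ← hh]
    push_cast
    congr 1
    ring

end ForwardIterate

/-! ### Exponential contraction up to subexponential factors, for a deterministic sequence of maps
-/

/-- `a_i` grows at most subexponentially in both time directions. -/
def Subexponential (a : ℤ → ℝ) : Prop :=
  ∀ δ > 0, ∃ C > 0, ∀ i : ℤ, a i ≤ C * Real.exp (δ * |(i : ℝ)|)

/-- The iterates of `φ` contract exponentially at rate `ε`, up to a subexponential factor in the
starting time. -/
def ContractsExp {E : Type*} [MetricSpace E] (φ : ℤ → E → E) (ε : ℝ) : Prop :=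
  ∀ δ > 0, ∃ C > 0, ∀ (i : ℤ) (n : ℕ) (u v : E),
    dist (forwardIterate φ i n u) (forwardIterate φ i n v) ≤
      C * Real.exp (-ε * n + δ * |(i : ℝ)|) * dist u v

theorem Subexponential.mono {a b : ℤ → ℝ} (hb : Subexponential b) (h : ∀ i, a i ≤ b i) :
    Subexponential a := fun δ hδ => by
  obtain ⟨C, hC, hCb⟩ := hb δ hδ
  exact ⟨C, hC, fun i => (h i).trans (hCb i)⟩

theorem Subexponential.add {a b : ℤ → ℝ} (ha : Subexponential a) (hb : Subexponential b) :
    Subexponential fun i => a i + b i := fun δ hδ => by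
  obtain ⟨C, hC, hCa⟩ := ha δ hδ
  obtain ⟨C', hC', hCb⟩ := hb δ hδ
  exact ⟨C + C', by positivity, fun i => by
    rw [add_mul]
    exact add_le_add (hCa i) (hCb i)⟩

theorem Subexponential.const (c : ℝ) : Subexponential fun _ => c := fun δ hδ =>
  ⟨|c| + 1, by positivity, fun i => by
    have h1 : 1 ≤ Real.exp (δ * |(i : ℝ)|) := Real.one_le_exp (by positivity)
    nlinarith [le_abs_self c, abs_nonneg c]⟩

theorem Subexponential.sum {ι : Type*} (s : Finset ι) {a : ι → ℤ → ℝ}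
    (ha : ∀ j ∈ s, Subexponential (a j)) : Subexponential fun i => ∑ j ∈ s, a j i := by
  classical
  induction s using Finset.induction_on with
  | empty => simpa using Subexponential.const 0
  | insert j s hj ih =>
    simp only [Finset.sum_insert hj]
    exact (ha j (Finset.mem_insert_self j s)).add
      (ih fun k hk => ha k (Finset.mem_insert_of_mem hk))

theorem Subexponential.mul {a b : ℤ → ℝ} (ha : Subexponential a) (hb : Subexponential b)
    (hb0 : ∀ i, 0 ≤ b i) : Subexponential fun i => a i * b i := fun δ hδ => by
  obtain ⟨C, hC, hCa⟩ := ha (δ / 2) (half_pos hδ)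
  obtain ⟨C', hC', hCb⟩ := hb (δ / 2) (half_pos hδ)
  refine ⟨C * C', by positivity, fun i => ?_⟩
  calc a i * b i ≤ (C * Real.exp (δ / 2 * |(i : ℝ)|)) * (C' * Real.exp (δ / 2 * |(i : ℝ)|)) :=
        mul_le_mul (hCa i) (hCb i) (hb0 i) (by positivity)
    _ = C * C' * Real.exp (δ * |(i : ℝ)|) := by
        rw [mul_mul_mul_comm, ← Real.exp_add]
        ring_nf

theorem abs_add_natCast_le (i : ℤ) (n : ℕ) : |((i + n : ℤ) : ℝ)| ≤ |(i : ℝ)| + n := by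
  push_cast
  exact (abs_add_le _ _).trans (by simp)

theorem abs_sub_natCast_le (i : ℤ) (n : ℕ) : |((i - n : ℤ) : ℝ)| ≤ |(i : ℝ)| + n := by
  push_cast
  exact (abs_sub _ _).trans (by simp)

section Contracting

variable {E : Type*} [MetricSpace E] {φ : ℤ → E → E} {ε : ℝ}

theorem ContractsExp.continuous (hφ : ContractsExp φ ε) (t : ℤ) : Continuous (φ t) := by
  obtain ⟨C, hC, hCφ⟩ := hφ 1 one_pos
  have : LipschitzWith (Real.toNNReal (C * Real.exp (-ε * 1 + 1 * |(t : ℝ)|))) (φ t) :=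
    LipschitzWith.of_dist_le_mul fun u v => by
      have := hCφ t 1 u v
      rw [Real.coe_toNNReal _ (by positivity)]
      simpa [forwardIterate_succ] using this
  exact this.continuous

/-- Consecutive backward iterates started from a fixed point are exponentially close. -/
theorem ContractsExp.exists_backward_bound (hφ : ContractsExp φ ε) {o : E}
    (ho : Subexponential fun i => dist (φ i o) o) {δ : ℝ} (hδ : 0 < δ) :
    ∃ C > 0, ∀ (t : ℤ) (n : ℕ),
      dist (forwardIterate φ (t - n) n o) (forwardIterate φ (t - (n + 1 : ℕ)) (n + 1) o) ≤
        C * Real.exp (δ * |(t : ℝ)|) * Real.exp (δ - ε) ^ n := by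
  obtain ⟨C, hC, hCφ⟩ := hφ (δ / 2) (half_pos hδ)
  obtain ⟨C', hC', hCo⟩ := ho (δ / 2) (half_pos hδ)
  refine ⟨C * C' * Real.exp (δ / 2), by positivity, fun t n => ?_⟩
  -- Starting one step earlier only replaces `o` by its image under a single map; the remaining `n`
  -- contractions act on that displacement.
  have hstep : forwardIterate φ (t - (n + 1 : ℕ)) (n + 1) o =
      forwardIterate φ (t - n) n (φ (t - n - 1) o) := by
    have e1 : t - ((n + 1 : ℕ) : ℤ) + 1 = t - n := by push_cast; ring
    have e2 : t - ((n + 1 : ℕ) : ℤ) = t - n - 1 := by push_cast; ring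
    rw [forwardIterate_succ', e1, e2]
  have h1 := hCφ (t - n) n o (φ (t - n - 1) o)
  have h2 := hCo (t - n - 1)
  have h3 := abs_sub_natCast_le t n
  have h4 : |((t - n - 1 : ℤ) : ℝ)| ≤ |(t : ℝ)| + n + 1 := by
    have := abs_sub_natCast_le (t - n) 1
    push_cast at this h3 ⊢
    linarith
  rw [hstep]
  calc _ ≤ C * Real.exp (-ε * n + δ / 2 * |((t - n : ℤ) : ℝ)|) *
          dist o (φ (t - n - 1) o) := h1
    _ ≤ C * Real.exp (-ε * n + δ / 2 * |((t - n : ℤ) : ℝ)|) *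
          (C' * Real.exp (δ / 2 * |((t - n - 1 : ℤ) : ℝ)|)) := by
        rw [dist_comm]
        gcongr
    _ ≤ C * Real.exp (-ε * n + δ / 2 * (|(t : ℝ)| + n)) *
          (C' * Real.exp (δ / 2 * (|(t : ℝ)| + n + 1))) := by gcongr
    _ = _ := by
        rw [← Real.exp_nat_mul, mul_mul_mul_comm, ← Real.exp_add, mul_assoc (C * C'),
          ← Real.exp_add, mul_assoc (C * C'), ← Real.exp_add]
        congr 2
        ring

theorem ContractsExp.tendsto_backward [CompleteSpace E] (hφ : ContractsExp φ ε) (hε : 0 < ε)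
    {o : E} (ho : Subexponential fun i => dist (φ i o) o) (t : ℤ) :
    ∃ a, Tendsto (fun n : ℕ => forwardIterate φ (t - n) n o) atTop (𝓝 a) := by
  obtain ⟨C, hC, hCb⟩ := hφ.exists_backward_bound ho (half_pos hε)
  refine cauchySeq_tendsto_of_complete (cauchySeq_of_le_geometric (Real.exp (ε / 2 - ε))
    (C * Real.exp (ε / 2 * |(t : ℝ)|)) ?_ fun n => hCb t n)
  rw [Real.exp_lt_one_iff]
  linarith

theorem ContractsExp.subexponential_limit (hφ : ContractsExp φ ε) (hε : 0 < ε)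
    {o : E} (ho : Subexponential fun i => dist (φ i o) o) {h : ℤ → E}
    (hh : ∀ t : ℤ, Tendsto (fun n : ℕ => forwardIterate φ (t - n) n o) atTop (𝓝 (h t))) :
    Subexponential fun t => dist (h t) o := by
  intro δ hδ
  -- The cap at `ε / 2` keeps the ratio `exp (δ' - ε)` of the geometric series below one.
  set δ' := min δ (ε / 2) with hδ'
  have hδ'0 : 0 < δ' := lt_min hδ (half_pos hε)
  have hr : Real.exp (δ' - ε) < 1 := by
    rw [Real.exp_lt_one_iff]
    linarith [min_le_right δ (ε / 2)]
  obtain ⟨C, hC, hCb⟩ := hφ.exists_backward_bound ho hδ'0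
  refine ⟨C / (1 - Real.exp (δ' - ε)), div_pos hC (by linarith), fun t => ?_⟩
  have := dist_le_of_le_geometric_of_tendsto₀ _ _ hr (fun n => hCb t n) (hh t)
  rw [forwardIterate_zero, dist_comm] at this
  refine this.trans ?_
  rw [mul_div_right_comm]
  have : δ' ≤ δ := min_le_left _ _
  have : 0 < 1 - Real.exp (δ' - ε) := by linarith
  gcongr

theorem ContractsExp.limit_solves (hφ : ContractsExp φ ε)
    {o : E} {h : ℤ → E}
    (hh : ∀ t : ℤ, Tendsto (fun n : ℕ => forwardIterate φ (t - n) n o) atTop (𝓝 (h t))) (t : ℤ) :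
    h (t + 1) = φ t (h t) := by
  have h1 := ((hφ.continuous t).tendsto _).comp (hh t)
  have h2 := (hh (t + 1)).comp (tendsto_add_atTop_nat 1)
  refine tendsto_nhds_unique h2 (h1.congr fun n => ?_)
  simp only [Function.comp_apply]
  have : t + 1 - ((n + 1 : ℕ) : ℤ) = t - n := by push_cast; ring
  rw [this, forwardIterate_succ]
  congr 1
  ring

theorem ContractsExp.exists_dist_forwardIterate_le (hφ : ContractsExp φ ε) {o : E} {h : ℤ → E}
    (hh : ∀ t, h (t + 1) = φ t (h t)) (ho : Subexponential fun t => dist (h t) o)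
    {δ : ℝ} (hδ : 0 < δ) :
    ∃ C > 0, ∀ (i : ℤ) (n : ℕ), dist (forwardIterate φ i n o) (h (i + n)) ≤
      C * Real.exp (-ε * n + δ * |(i : ℝ)|) := by
  obtain ⟨C, hC, hCφ⟩ := hφ (δ / 2) (half_pos hδ)
  obtain ⟨C', hC', hCo⟩ := ho (δ / 2) (half_pos hδ)
  refine ⟨C * C', by positivity, fun i n => ?_⟩
  rw [← forwardIterate_eq_of_solves φ hh]
  calc _ ≤ C * Real.exp (-ε * n + δ / 2 * |(i : ℝ)|) * dist o (h i) := hCφ i n _ _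
    _ ≤ C * Real.exp (-ε * n + δ / 2 * |(i : ℝ)|) * (C' * Real.exp (δ / 2 * |(i : ℝ)|)) := by
        rw [dist_comm]
        gcongr
        exact hCo i
    _ = _ := by
        rw [mul_mul_mul_comm, ← Real.exp_add]
        congr 2
        ring

end Contracting

/-! ### Perturbed recursions -/

/-- Distance between an orbit of `χ` and an approximate orbit `d`, by telescoping. -/
theorem dist_forwardIterate_le_sum {E : Type*} [PseudoMetricSpace E] (χ : ℤ → E → E) (i : ℤ)
    (d : ℤ → E) (L : ℕ → ℕ → ℝ)
    (hL : ∀ (m n : ℕ) (u v : E), dist (forwardIterate χ (i + m) n u)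
      (forwardIterate χ (i + m) n v) ≤ L m n * dist u v) (n : ℕ) (u : E) :
    dist (forwardIterate χ i n u) (d (i + n)) ≤ L 0 n * dist u (d i) +
      ∑ m ∈ Finset.range n, L (m + 1) (n - 1 - m) * dist (χ (i + m) (d (i + m))) (d (i + m + 1)) := by
  have h0 : dist (forwardIterate χ i n u) (forwardIterate χ i n (d i)) ≤ L 0 n * dist u (d i) := by
    simpa using hL 0 n u (d i)
  -- The interpolating points follow `d` up to time `i + m` and `χ` from then on.
  have h1 := dist_le_range_sum_dist
    (fun m : ℕ => forwardIterate χ (i + m) (n - m) (d (i + m))) n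
  simp only [Nat.cast_zero, add_zero, Nat.sub_zero, Nat.sub_self, forwardIterate_zero] at h1
  refine (dist_triangle _ (forwardIterate χ i n (d i)) _).trans (add_le_add h0 (h1.trans ?_))
  refine Finset.sum_le_sum fun m hm => ?_
  have hm' := Finset.mem_range.1 hm
  obtain ⟨k, rfl⟩ : ∃ k, n = m + 1 + k := ⟨n - (m + 1), by omega⟩
  have e1 : m + 1 + k - m = k + 1 := by omega
  have e2 : m + 1 + k - (m + 1) = k := by omega
  have e3 : m + 1 + k - 1 - m = k := by omega
  have e4 : i + ((m + 1 : ℕ) : ℤ) = i + m + 1 := by push_cast; ring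
  rw [e1, e2, e3, forwardIterate_succ', e4]
  have := hL (m + 1) k (χ (i + m) (d (i + m))) (d (i + m + 1))
  rwa [e4] at this

/-- Exponential bounds in `dist_forwardIterate_le_sum`. -/
theorem dist_forwardIterate_le_exp {E : Type*} [PseudoMetricSpace E] (χ : ℤ → E → E) (i : ℤ)
    (d : ℤ → E) (u : E) {ε η δ C₁ C₂ C₃ : ℝ} (hη : η ≤ ε) (hδ : 0 < δ) (hC₁ : 0 < C₁)
    (hC₂ : 0 < C₂) (hC₃ : 0 < C₃)
    (hL : ∀ (m n : ℕ) (u v : E), dist (forwardIterate χ (i + m) n u)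
      (forwardIterate χ (i + m) n v) ≤
        C₁ * Real.exp (-ε * n + δ * |((i + m : ℤ) : ℝ)|) * dist u v)
    (hd : ∀ m : ℕ, dist (χ (i + m) (d (i + m))) (d (i + m + 1)) ≤
      C₂ * Real.exp (-η * m + δ * |(i : ℝ)|))
    (hu : dist u (d i) ≤ C₃ * Real.exp (δ * |(i : ℝ)|)) (n : ℕ) :
    dist (forwardIterate χ i n u) (d (i + n)) ≤
      (C₁ * C₃ + C₁ * C₂ * Real.exp η / δ) *
        Real.exp (-(η - 2 * δ) * n + 2 * δ * |(i : ℝ)|) := by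
  have hmain := dist_forwardIterate_le_sum χ i d
    (fun m n => C₁ * Real.exp (-ε * n + δ * |((i + m : ℤ) : ℝ)|)) hL n u
  refine hmain.trans ?_
  rw [add_mul]
  refine add_le_add ?_ ?_
  · calc _ ≤ C₁ * Real.exp (-ε * n + δ * |(i : ℝ)|) * (C₃ * Real.exp (δ * |(i : ℝ)|)) := by
          simp only [Nat.cast_zero, add_zero]
          gcongr
      _ = C₁ * C₃ * Real.exp (-ε * n + 2 * δ * |(i : ℝ)|) := by
          rw [mul_mul_mul_comm, ← Real.exp_add]
          congr 2
          ring
      _ ≤ _ := by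
          gcongr
          nlinarith [(Nat.cast_nonneg n : (0 : ℝ) ≤ n)]
  · calc _ ≤ ∑ m ∈ Finset.range n, C₁ * C₂ * Real.exp η *
            Real.exp (-η * n + δ * n + 2 * δ * |(i : ℝ)|) := by
          refine Finset.sum_le_sum fun m hm => ?_
          have hm' := Finset.mem_range.1 hm
          obtain ⟨k, rfl⟩ : ∃ k, n = m + 1 + k := ⟨n - (m + 1), by omega⟩
          have e3 : m + 1 + k - 1 - m = k := by omega
          rw [e3]
          calc _ ≤ C₁ * Real.exp (-ε * k + δ * (|(i : ℝ)| + ((m + 1 : ℕ) : ℝ))) *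
                (C₂ * Real.exp (-η * m + δ * |(i : ℝ)|)) := by
                have := abs_add_natCast_le i (m + 1)
                have := hd m
                gcongr
            _ = C₁ * C₂ * Real.exp (-ε * k + δ * (m + 1) - η * m + 2 * δ * |(i : ℝ)|) := by
                rw [mul_mul_mul_comm, ← Real.exp_add]
                push_cast
                congr 2
                ring
            -- Of the `n = m + 1 + k` steps, `m` decay at rate `η` and `k` at rate `ε ≥ η`; the one
            -- step without decay costs `exp η`.
            _ ≤ C₁ * C₂ * Real.exp (η + (-η * ((m + 1 + k : ℕ) : ℝ) +
                  δ * ((m + 1 + k : ℕ) : ℝ) + 2 * δ * |(i : ℝ)|)) := by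
                refine mul_le_mul_of_nonneg_left (Real.exp_le_exp.2 ?_) (by positivity)
                push_cast
                nlinarith [(Nat.cast_nonneg k : (0 : ℝ) ≤ k)]
            _ = _ := by rw [Real.exp_add, ← mul_assoc]
      _ = C₁ * C₂ * Real.exp η * (n * Real.exp (-η * n + δ * n + 2 * δ * |(i : ℝ)|)) := by
          rw [Finset.sum_const, Finset.card_range, nsmul_eq_mul]
          ring
      -- The number `n` of equal terms is absorbed by `exp (δ n) / δ`, which is the second `δ` lost
      -- in the rate.
      _ ≤ C₁ * C₂ * Real.exp η * (Real.exp (δ * n) / δ *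
            Real.exp (-η * n + δ * n + 2 * δ * |(i : ℝ)|)) := by
          gcongr
          rw [le_div_iff₀ hδ]
          linarith [Real.add_one_le_exp (δ * n)]
      _ = C₁ * C₂ * Real.exp η / δ * (Real.exp (δ * n) *
            Real.exp (-η * n + δ * n + 2 * δ * |(i : ℝ)|)) := by ring
      _ = _ := by
          rw [← Real.exp_add]
          congr 2
          ring

/-! ### Lipschitz constants -/

section LipConst

variable {E : Type*} [MetricSpace E]

theorem edist_le_lipConst_mul (φ : E → E) (x y : E) :
    edist (φ x) (φ y) ≤ lipConst φ * edist x y := by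
  by_cases hxy : x = y
  · simp [hxy]
  · rw [← ENNReal.div_le_iff (by simpa using hxy) (edist_ne_top x y)]
    exact le_iSup₂_of_le x y (le_iSup_of_le hxy le_rfl)

theorem lipConst_le {φ : E → E} {c : ℝ≥0∞} (h : ∀ x y, edist (φ x) (φ y) ≤ c * edist x y) :
    lipConst φ ≤ c :=
  iSup₂_le fun x y => iSup_le fun hxy =>
    (ENNReal.div_le_iff (by simpa using hxy) (edist_ne_top x y)).2 (h x y)

theorem lipConst_comp_le (φ ψ : E → E) :
    lipConst (fun u => φ (ψ u)) ≤ lipConst φ * lipConst ψ :=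
  lipConst_le fun x y => by
    rw [mul_assoc]
    exact (edist_le_lipConst_mul φ _ _).trans (by gcongr; exact edist_le_lipConst_mul ψ x y)

theorem lipConst_id_le : lipConst (id : E → E) ≤ 1 := lipConst_le fun x y => by simp

theorem lipConst_forwardIterate_add_le (φ : ℤ → E → E) (i : ℤ) (m n : ℕ) :
    lipConst (forwardIterate φ i (m + n)) ≤
      lipConst (forwardIterate φ (i + m) n) * lipConst (forwardIterate φ i m) := by
  have : forwardIterate φ i (m + n) =
      fun u => forwardIterate φ (i + m) n (forwardIterate φ i m u) :=
    funext fun u => forwardIterate_add φ i m n u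
  rw [this]
  exact lipConst_comp_le _ _

/-- On a separable space the Lipschitz constant of a continuous map is a countable supremum. -/
theorem lipConst_eq_iSup_denseSeq [TopologicalSpace.SeparableSpace E] [Nonempty E] {φ : E → E}
    (hφ : Continuous φ) :
    lipConst φ = ⨆ mn : ℕ × ℕ,
      edist (φ (TopologicalSpace.denseSeq E mn.1)) (φ (TopologicalSpace.denseSeq E mn.2)) /
        edist (TopologicalSpace.denseSeq E mn.1) (TopologicalSpace.denseSeq E mn.2) := by
  set e := TopologicalSpace.denseSeq E
  set c := ⨆ mn : ℕ × ℕ, edist (φ (e mn.1)) (φ (e mn.2)) / edist (e mn.1) (e mn.2) with hc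
  apply le_antisymm
  · apply lipConst_le
    -- Multiplication by `⊤` is discontinuous at `0`, so this case must be removed before the
    -- closedness argument.
    by_cases hct : c = ⊤
    · intro x y
      by_cases hxy : x = y
      · simp [hxy]
      · rw [hct, ENNReal.top_mul (by simpa using hxy)]
        exact le_top
    have hd : DenseRange fun mn : ℕ × ℕ => (e mn.1, e mn.2) :=
      (TopologicalSpace.denseRange_denseSeq E).prodMap (TopologicalSpace.denseRange_denseSeq E)
    have hcl : IsClosed {z : E × E | edist (φ z.1) (φ z.2) ≤ c * edist z.1 z.2} :=
      isClosed_le (by fun_prop) ((ENNReal.continuous_const_mul hct).comp (by fun_prop))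
    have hall : ∀ z : E × E, z ∈ {z : E × E | edist (φ z.1) (φ z.2) ≤ c * edist z.1 z.2} := by
      refine fun z => hd.induction_on z hcl fun mn => ?_
      by_cases hmn : e mn.1 = e mn.2
      · simp [hmn]
      · exact (ENNReal.div_le_iff (by simpa using hmn) (edist_ne_top _ _)).1
          (le_iSup (fun mn : ℕ × ℕ => edist (φ (e mn.1)) (φ (e mn.2)) / edist (e mn.1) (e mn.2)) mn)
    exact fun x y => hall (x, y)
  · refine iSup_le fun mn => ?_
    by_cases hmn : e mn.1 = e mn.2
    · simp [hmn]
    · exact (ENNReal.div_le_iff (by simpa using hmn) (edist_ne_top _ _)).2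
        (edist_le_lipConst_mul φ _ _)

end LipConst

/-! ### A maximal ergodic argument and linear bounds for Birkhoff sums -/

section MaximalErgodic

variable {α : Type*}

/-- The maximum of `0` and the first `n` Birkhoff sums of `f`. -/
def birkhoffMax (T : α → α) (f : α → ℝ) : ℕ → α → ℝ
  | 0 => 0
  | n + 1 => fun x => max 0 (f x + birkhoffMax T f n (T x))

theorem birkhoffMax_nonneg (T : α → α) (f : α → ℝ) (n : ℕ) (x : α) : 0 ≤ birkhoffMax T f n x := by
  cases n with
  | zero => exact le_rfl
  | succ n => exact le_max_left _ _

theorem birkhoffMax_mono (T : α → α) (f : α → ℝ) (x : α) :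
    Monotone fun n => birkhoffMax T f n x := by
  refine monotone_nat_of_le_succ fun n => ?_
  induction n generalizing x with
  | zero => exact birkhoffMax_nonneg T f 1 x
  | succ n ih => exact max_le_max le_rfl (by gcongr; exact ih (T x))

theorem birkhoffSum_le_birkhoffMax (T : α → α) (f : α → ℝ) (n : ℕ) (x : α) :
    birkhoffSum T f n x ≤ birkhoffMax T f n x := by
  induction n generalizing x with
  | zero => simp [birkhoffMax]
  | succ n ih =>
    rw [birkhoffSum_succ']
    exact (by gcongr; exact ih (T x) : _ ≤ f x + birkhoffMax T f n (T x)).trans (le_max_right _ _)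

variable [MeasurableSpace α] {μ : Measure α} {T : α → α} {f : α → ℝ}

theorem measurable_birkhoffMax (hT : Measurable T) (hf : Measurable f) (n : ℕ) :
    Measurable (birkhoffMax T f n) := by
  induction n with
  | zero => exact measurable_const
  | succ n ih => exact measurable_const.max (hf.add (ih.comp hT))

theorem integrable_birkhoffMax [IsFiniteMeasure μ] (hT : MeasurePreserving T μ μ)
    (hf : Integrable f μ) (n : ℕ) : Integrable (birkhoffMax T f n) μ := by
  induction n with
  | zero => exact integrable_zero _ _ _
  | succ n ih =>
    exact (integrable_const (0 : ℝ)).sup (hf.add (hT.integrable_comp_of_integrable ih))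

/-- The set of boundedness is invariant, hence null or conull. If it were null, then `M n ∘ T → ∞`,
so `M (n + 1) - M n ∘ T = max (-M n ∘ T) f` would converge to `f`, dominated by `|f|`. But the
integral of the left side equals `∫ M (n + 1) - ∫ M n ≥ 0`, which contradicts `∫ f < 0`. -/
theorem ae_bddAbove_birkhoffMax [IsProbabilityMeasure μ] (hT : Ergodic T μ) (hfm : Measurable f)
    (hf : Integrable f μ) (hneg : ∫ x, f x ∂μ < 0) :
    ∀ᵐ x ∂μ, BddAbove (Set.range fun n => birkhoffMax T f n x) := by
  set M := birkhoffMax T f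
  set A : Set α := {x | BddAbove (Set.range fun n => M n x)} with hA
  have hAm : MeasurableSet A :=
    measurableSet_bddAbove_range fun n => measurable_birkhoffMax hT.measurable hfm n
  have hinv : T ⁻¹' A = A := by
    ext x
    constructor
    · rintro ⟨B, hB⟩
      refine ⟨max 0 (f x + B), ?_⟩
      rintro _ ⟨n, rfl⟩
      refine (birkhoffMax_mono T f x (Nat.le_succ n)).trans (max_le_max le_rfl ?_)
      gcongr
      exact hB ⟨n, rfl⟩
    · rintro ⟨B, hB⟩
      refine ⟨B - f x, ?_⟩
      rintro _ ⟨n, rfl⟩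
      have h1 : M (n + 1) x ≤ B := hB ⟨n + 1, rfl⟩
      have h2 : f x + M n (T x) ≤ M (n + 1) x := le_max_right _ _
      simp only
      linarith
  rcases hT.toPreErgodic.ae_mem_or_ae_notMem hAm hinv with h | h
  · exact h
  exfalso
  have hMi := integrable_birkhoffMax hT.toMeasurePreserving hf
  have hlim : Tendsto (fun n => ∫ x, max (-M n (T x)) (f x) ∂μ) atTop (𝓝 (∫ x, f x ∂μ)) := by
    refine tendsto_integral_of_dominated_convergence (fun x => |f x|)
      (fun n => ?_) hf.abs (fun n => Eventually.of_forall fun x => ?_) ?_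
    · exact ((measurable_birkhoffMax hT.measurable hfm n).comp hT.measurable).neg.max hfm
        |>.aestronglyMeasurable
    · have h0 := birkhoffMax_nonneg T f n (T x)
      rw [Real.norm_eq_abs]
      rcases le_total (f x) 0 with hf0 | hf0
      · rw [abs_of_nonpos (max_le (by simpa [M] using h0) hf0), abs_of_nonpos hf0]
        exact neg_le_neg (le_max_right _ _)
      · rw [max_eq_right (by simp only [M]; linarith)]
    · filter_upwards [h] with x hx
      have hx' : T x ∉ A := fun h' => hx (by rwa [← hinv])
      have hev : ∀ᶠ n in atTop, max (-M n (T x)) (f x) = f x := by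
        simp only [hA, Set.mem_ofPred_eq, not_bddAbove_iff] at hx'
        obtain ⟨_, ⟨N, rfl⟩, hN⟩ := hx' (-f x)
        filter_upwards [eventually_ge_atTop N] with n hn
        have := birkhoffMax_mono T f (T x) hn
        exact max_eq_right (by simp only [M] at *; linarith)
      exact tendsto_const_nhds.congr' (hev.mono fun n hn => hn.symm)
  have hnonneg : ∀ n, 0 ≤ ∫ x, max (-M n (T x)) (f x) ∂μ := by
    intro n
    have e1 : ∀ x, max (-M n (T x)) (f x) = M (n + 1) x - M n (T x) := fun x => by
      have : M (n + 1) x = max 0 (f x + M n (T x)) := rfl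
      rw [this, ← max_sub_sub_right]
      simp
    have e2 : ∫ x, M n (T x) ∂μ = ∫ x, M n x ∂μ := by
      have := integral_map (μ := μ) hT.measurable.aemeasurable
        (f := M n) (measurable_birkhoffMax hT.measurable hfm n).aestronglyMeasurable
      rw [hT.map_eq] at this
      exact this.symm
    have e3 : ∫ x, (M (n + 1) x - M n (T x)) ∂μ = ∫ x, M (n + 1) x ∂μ - ∫ x, M n (T x) ∂μ :=
      integral_sub (hMi _) (hT.toMeasurePreserving.integrable_comp_of_integrable (hMi n))
    simp_rw [e1]
    rw [e3, e2, sub_nonneg]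
    exact integral_mono (hMi _) (hMi _) fun x => birkhoffMax_mono T f x (Nat.le_succ n)
  exact absurd (ge_of_tendsto' hlim hnonneg) (not_le.2 hneg)

/-- Subtracting `∫ f + δ` produces a function of mean `-δ`, to which the boundedness of the maxima
applies. -/
theorem ae_exists_birkhoffSum_le [IsProbabilityMeasure μ] (hT : Ergodic T μ) (hfm : Measurable f)
    (hf : Integrable f μ) {δ : ℝ} (hδ : 0 < δ) :
    ∀ᵐ x ∂μ, ∃ C, ∀ n : ℕ, birkhoffSum T f n x ≤ n * ∫ x, f x ∂μ + (C + δ * n) := by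
  set c := ∫ x, f x ∂μ
  have h := ae_bddAbove_birkhoffMax hT (f := fun x => f x - (c + δ)) (hfm.sub_const _)
    (hf.sub (integrable_const _)) (by
      rw [integral_sub hf (integrable_const _)]
      simp [c, hδ])
  filter_upwards [h] with x ⟨C, hC⟩
  refine ⟨C, fun n => ?_⟩
  have h1 := (birkhoffSum_le_birkhoffMax T (fun x => f x - (c + δ)) n x).trans (hC ⟨n, rfl⟩)
  simp only [birkhoffSum, Finset.sum_sub_distrib, Finset.sum_const, Finset.card_range,
    nsmul_eq_mul] at h1 ⊢
  linarith

/-- Two-sided subexponential control of Birkhoff sums of an integrable function. -/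
theorem ae_exists_abs_birkhoffSum_sub_le [IsProbabilityMeasure μ] (hT : Ergodic T μ)
    (hfm : Measurable f) (hf : Integrable f μ) :
    ∀ᵐ x ∂μ, ∀ δ > 0, ∃ C, ∀ n : ℕ, |birkhoffSum T f n x - n * ∫ x, f x ∂μ| ≤ C + δ * n := by
  have key : ∀ k : ℕ, ∀ᵐ x ∂μ, ∃ C, ∀ n : ℕ,
      |birkhoffSum T f n x - n * ∫ x, f x ∂μ| ≤ C + 1 / ((k : ℝ) + 1) * n := by
    intro k
    have hk : (0 : ℝ) < 1 / ((k : ℝ) + 1) := by positivity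
    filter_upwards [ae_exists_birkhoffSum_le hT hfm hf hk,
      ae_exists_birkhoffSum_le hT hfm.neg hf.neg hk] with x ⟨C, hC⟩ ⟨C', hC'⟩
    refine ⟨max C C', fun n => abs_le.2 ⟨?_, ?_⟩⟩
    · have := hC' n
      simp only [birkhoffSum, Pi.neg_apply, Finset.sum_neg_distrib, integral_neg] at this ⊢
      linarith [le_max_right C C']
    · linarith [hC n, le_max_left C C']
  filter_upwards [ae_all_iff.2 key] with x hx δ hδ
  obtain ⟨k, hk⟩ := exists_nat_one_div_lt hδ
  obtain ⟨C, hC⟩ := hx k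
  exact ⟨C, fun n => (hC n).trans (by gcongr)⟩

end MaximalErgodic

/-! ### The two-sided shift -/

section Shift

variable {E : Type*}

/-- The shift by `k` on two-sided sequences. -/
def shiftBy (k : ℤ) (x : ℤ → E) : ℤ → E := fun t => x (t + k)

@[simp] theorem shiftBy_zero (x : ℤ → E) : shiftBy 0 x = x :=
  funext fun t => congrArg x (add_zero t)

theorem shiftBy_shiftBy (k l : ℤ) (x : ℤ → E) : shiftBy k (shiftBy l x) = shiftBy (k + l) x :=
  funext fun t => congrArg x (by ring)

theorem shiftBy_one_iterate (n : ℕ) (x : ℤ → E) : (shiftBy 1)^[n] x = shiftBy n x := by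
  induction n with
  | zero => simp
  | succ n ih =>
    rw [Function.iterate_succ_apply', ih, shiftBy_shiftBy]
    push_cast
    rw [add_comm]

theorem shiftBy_neg_one_iterate (n : ℕ) (x : ℤ → E) : (shiftBy (-1))^[n] x = shiftBy (-n) x := by
  induction n with
  | zero => simp
  | succ n ih =>
    rw [Function.iterate_succ_apply', ih, shiftBy_shiftBy]
    congr 1
    push_cast
    ring

variable [MeasurableSpace E]

theorem measurable_shiftBy (k : ℤ) : Measurable (shiftBy k : (ℤ → E) → ℤ → E) :=
  measurable_pi_lambda _ fun t => measurable_pi_apply (t + k)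

/-- The shift as a measurable automorphism. -/
def shiftEquiv (E : Type*) [MeasurableSpace E] : (ℤ → E) ≃ᵐ (ℤ → E) where
  toFun := shiftBy 1
  invFun := shiftBy (-1)
  left_inv x := by rw [shiftBy_shiftBy]; simp
  right_inv x := by rw [shiftBy_shiftBy]; simp
  measurable_toFun := measurable_shiftBy 1
  measurable_invFun := measurable_shiftBy (-1)

variable {μ : Measure (ℤ → E)}

theorem ergodic_shiftBy_neg_one (h : Ergodic shiftSeq μ) : Ergodic (shiftBy (-1)) μ :=
  Ergodic.symm (e := shiftEquiv E) h

theorem measurePreserving_shiftBy (h : MeasurePreserving shiftSeq μ μ) (k : ℤ) :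
    MeasurePreserving (shiftBy k) μ μ := by
  have h1 : MeasurePreserving (shiftBy 1) μ μ := h
  have h2 : MeasurePreserving (shiftBy (-1)) μ μ :=
    MeasurePreserving.symm (shiftEquiv E) h
  rcases Int.eq_nat_or_neg k with ⟨n, rfl | rfl⟩
  · have := h1.iterate n
    rwa [funext (shiftBy_one_iterate n)] at this
  · have := h2.iterate n
    rwa [funext (shiftBy_neg_one_iterate n)] at this

/-- A primitive of the stationary sequence `f(x_{·+k})` has linear growth with slope `∫ f`. -/
theorem ae_exists_primitive [IsProbabilityMeasure μ] (h : Ergodic shiftSeq μ)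
    {f : (ℤ → E) → ℝ} (hfm : Measurable f) (hf : Integrable f μ) :
    ∀ᵐ x ∂μ, ∃ S : ℤ → ℝ, (∀ k, S (k + 1) = S k + f (shiftBy k x)) ∧
      ∀ δ > 0, ∃ C, ∀ k : ℤ, |S k - k * ∫ x, f x ∂μ| ≤ C + δ * |(k : ℝ)| := by
  have hg := measurePreserving_shiftBy h.toMeasurePreserving (-1 : ℤ)
  have hgi : ∫ x, f (shiftBy (-1) x) ∂μ = ∫ x, f x ∂μ := by
    have := integral_map (μ := μ) hg.measurable.aemeasurable (f := f) hfm.aestronglyMeasurable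
    rw [hg.map_eq] at this
    exact this.symm
  have h1 := ae_exists_abs_birkhoffSum_sub_le (T := shiftBy 1) h hfm hf
  have h2 := ae_exists_abs_birkhoffSum_sub_le (ergodic_shiftBy_neg_one h)
    (hfm.comp hg.measurable) (hg.integrable_comp_of_integrable hf)
  filter_upwards [h1, h2] with x hx hx'
  simp only [birkhoffSum, Function.comp_apply, shiftBy_one_iterate, shiftBy_neg_one_iterate,
    shiftBy_shiftBy, hgi] at hx hx'
  -- On the negative side `S` is minus a Birkhoff sum of `f ∘ shiftBy (-1)` under the inverse shift,
  -- which is ergodic as well.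
  let S : ℤ → ℝ
    | Int.ofNat n => ∑ k ∈ Finset.range n, f (shiftBy k x)
    | Int.negSucc n => -∑ k ∈ Finset.range (n + 1), f (shiftBy (-1 + -(k : ℤ)) x)
  refine ⟨S, fun k => ?_, fun δ hδ => ?_⟩
  · cases k with
    | ofNat n => exact Finset.sum_range_succ (fun k : ℕ => f (shiftBy (k : ℤ) x)) n
    | negSucc n =>
      cases n with
      | zero =>
        change ∑ k ∈ Finset.range 0, f (shiftBy k x) =
          -∑ k ∈ Finset.range 1, f (shiftBy (-1 + -(k : ℤ)) x) + f (shiftBy (-1) x)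
        simp
      | succ n =>
        change -∑ k ∈ Finset.range (n + 1), f (shiftBy (-1 + -(k : ℤ)) x) =
          -∑ k ∈ Finset.range (n + 1 + 1), f (shiftBy (-1 + -(k : ℤ)) x) +
            f (shiftBy (Int.negSucc (n + 1)) x)
        rw [Finset.sum_range_succ _ (n + 1)]
        have : Int.negSucc (n + 1) = -1 + -((n + 1 : ℕ) : ℤ) := by
          rw [Int.negSucc_eq]; push_cast; ring
        rw [this]
        ring
  · obtain ⟨C, hC⟩ := hx δ hδ
    obtain ⟨C', hC'⟩ := hx' δ hδ
    refine ⟨max C C', fun k => ?_⟩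
    cases k with
    | ofNat n =>
      have := hC n
      simp only [S, Int.ofNat_eq_natCast, Int.cast_natCast, Nat.abs_cast]
      linarith [le_max_left C C']
    | negSucc n =>
      have h3 := hC' (n + 1)
      have e : |((Int.negSucc n : ℤ) : ℝ)| = ((n + 1 : ℕ) : ℝ) := by
        rw [Int.cast_negSucc, abs_neg, Nat.abs_cast]
      rw [e, Int.cast_negSucc, ← abs_neg]
      have e2 : -(S (Int.negSucc n) - -((n + 1 : ℕ) : ℝ) * ∫ x, f x ∂μ) =
          ∑ k ∈ Finset.range (n + 1), f (shiftBy (-1 + -(k : ℤ)) x) -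
            ((n + 1 : ℕ) : ℝ) * ∫ x, f x ∂μ := by
        simp only [S]
        ring
      rw [e2]
      linarith [le_max_right C C']

end Shift

/-! ### Logarithmic moments and subexponential growth -/

section LogMoments

theorem measurable_logPlus : Measurable logPlus :=
  EReal.continuous_toENNReal.measurable.comp ENNReal.measurable_log

theorem measurable_logMinus : Measurable logMinus :=
  EReal.continuous_toENNReal.measurable.comp ENNReal.measurable_log.neg

theorem logPlus_eq_top_iff {y : ℝ≥0∞} : logPlus y = ⊤ ↔ y = ⊤ := by
  simp [logPlus]

theorem logPlus_of_le_one {y : ℝ≥0∞} (h : y ≤ 1) : logPlus y = 0 := by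
  simpa [logPlus, EReal.toENNReal_eq_zero_iff] using h

theorem logMinus_of_one_le {y : ℝ≥0∞} (h : 1 ≤ y) : logMinus y = 0 := by
  simpa [logMinus, EReal.toENNReal_eq_zero_iff, EReal.neg_le] using h

theorem logPlus_of_one_le {y : ℝ≥0∞} (h : 1 ≤ y) (h' : y ≠ ⊤) :
    logPlus y = ENNReal.ofReal (Real.log y.toReal) := by
  rw [logPlus, ENNReal.log_pos_real (by rintro rfl; simp at h) h', EReal.real_coe_toENNReal]

theorem logMinus_of_ne {y : ℝ≥0∞} (h : y ≠ 0) (h' : y ≠ ⊤) :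
    logMinus y = ENNReal.ofReal (-Real.log y.toReal) := by
  rw [logMinus, ENNReal.log_pos_real h h', ← EReal.coe_neg, EReal.real_coe_toENNReal]

theorem toReal_le_exp_logPlus {y : ℝ≥0∞} (h : y ≠ ⊤) :
    y.toReal ≤ Real.exp (logPlus y).toReal := by
  rcases le_total y 1 with h1 | h1
  · rw [logPlus_of_le_one h1]
    simpa using ENNReal.toReal_mono ENNReal.one_ne_top h1
  · have h2 : 1 ≤ y.toReal := by simpa using ENNReal.toReal_mono h h1
    rw [logPlus_of_one_le h1 h, ENNReal.toReal_ofReal (Real.log_nonneg h2),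
      Real.exp_log (by linarith)]

/-- `y ≤ exp (log⁺ y - min (log⁻ y) N)`. -/
theorem toReal_le_exp_logPlus_sub {y : ℝ≥0∞} (h : y ≠ ⊤) (N : ℕ) :
    y.toReal ≤ Real.exp ((logPlus y).toReal - (min (logMinus y) N).toReal) := by
  rcases le_total 1 y with h1 | h1
  · rw [logMinus_of_one_le h1]
    simpa using toReal_le_exp_logPlus h
  · rw [logPlus_of_le_one h1]
    by_cases h0 : y = 0
    · simp only [h0, ENNReal.toReal_zero]
      positivity
    have hpos := ENNReal.toReal_pos h0 h
    have hle : y.toReal ≤ 1 := by simpa using ENNReal.toReal_mono ENNReal.one_ne_top h1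
    have hlog : 0 ≤ -Real.log y.toReal := by
      have := Real.log_nonpos hpos.le hle
      linarith
    have h2 : (min (logMinus y) N).toReal ≤ -Real.log y.toReal := by
      rw [logMinus_of_ne h0 h]
      refine (ENNReal.toReal_mono ENNReal.ofReal_ne_top (min_le_left _ _)).trans ?_
      rw [ENNReal.toReal_ofReal hlog]
    calc y.toReal = Real.exp (Real.log y.toReal) := (Real.exp_log hpos).symm
      _ ≤ _ := Real.exp_le_exp.2 (by simp; linarith)

variable {α : Type*} [MeasurableSpace α] {μ : Measure α}

/-- The negative part of the logarithm is truncated at a level `N`. By monotone convergence some `N`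
keeps the mean negative, and the truncated function is integrable even when the mean of `log Y` is
`-∞`. -/
theorem NegativeLogMean.exists_integrable {Y : α → ℝ≥0∞} [IsFiniteMeasure μ] (hY : Measurable Y)
    (h : NegativeLogMean μ Y) :
    ∃ f : α → ℝ, Measurable f ∧ Integrable f μ ∧ ∫ x, f x ∂μ < 0 ∧
      ∀ᵐ x ∂μ, Y x ≤ ENNReal.ofReal (Real.exp (f x)) := by
  have hp : Measurable fun x => logPlus (Y x) := measurable_logPlus.comp hY
  have hm : ∀ N : ℕ, Measurable fun x => min (logMinus (Y x)) (N : ℝ≥0∞) := fun N =>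
    (measurable_logMinus.comp hY).min measurable_const
  have hpt : ∫⁻ x, logPlus (Y x) ∂μ ≠ ⊤ := (lt_of_lt_of_le h le_top).ne
  have hsup : ∫⁻ x, logMinus (Y x) ∂μ = ⨆ N : ℕ, ∫⁻ x, min (logMinus (Y x)) N ∂μ := by
    rw [← lintegral_iSup hm fun M N hMN x =>
      min_le_min le_rfl (by exact_mod_cast hMN)]
    refine lintegral_congr fun x => ?_
    have := inf_iSup_eq (logMinus (Y x)) fun N : ℕ => (N : ℝ≥0∞)
    rwa [ENNReal.iSup_natCast, inf_top_eq] at this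
  have h' : ∫⁻ x, logPlus (Y x) ∂μ < ⨆ N : ℕ, ∫⁻ x, min (logMinus (Y x)) N ∂μ := by
    rw [← hsup]
    exact h
  obtain ⟨N, hN⟩ := lt_iSup_iff.1 h'
  have hmt : ∫⁻ x, min (logMinus (Y x)) N ∂μ ≠ ⊤ := by
    refine ((lintegral_mono fun x => min_le_right _ _).trans_lt ?_).ne
    rw [lintegral_const]
    exact ENNReal.mul_lt_top (ENNReal.natCast_lt_top N) (measure_lt_top μ _)
  have hpi := integrable_toReal_of_lintegral_ne_top hp.aemeasurable hpt
  have hmi := integrable_toReal_of_lintegral_ne_top (hm N).aemeasurable hmt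
  have hpf : ∀ᵐ x ∂μ, logPlus (Y x) < ⊤ := ae_lt_top hp hpt
  refine ⟨fun x => (logPlus (Y x)).toReal - (min (logMinus (Y x)) N).toReal,
    hp.ennreal_toReal.sub (hm N).ennreal_toReal, hpi.sub hmi, ?_, ?_⟩
  · rw [integral_sub hpi hmi, integral_toReal hp.aemeasurable hpf,
      integral_toReal (hm N).aemeasurable (ae_lt_top (hm N) hmt), sub_neg]
    exact (ENNReal.toReal_lt_toReal hpt hmt).2 hN
  · filter_upwards [hpf] with x hx
    have hx' : Y x ≠ ⊤ := fun h => hx.ne (logPlus_eq_top_iff.2 h)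
    exact ENNReal.le_ofReal_iff_toReal_le hx' (Real.exp_pos _).le |>.2
      (toReal_le_exp_logPlus_sub hx' N)

/-- Random variables with a common law of finite logarithmic moment grow subexponentially. -/
theorem ae_subexponential_of_finiteLogPlusMoment {P : Measure α} [IsProbabilityMeasure P]
    {v : ℤ → α → ℝ≥0∞} (hv : ∀ t, AEMeasurable (v t) P) (hlaw : ∀ t, P.map (v t) = P.map (v 0))
    (h : FiniteLogPlusMoment P (v 0)) :
    ∀ᵐ ω ∂P, (∀ t, v t ω ≠ ⊤) ∧ Subexponential fun t => (v t ω).toReal := by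
  set ν := P.map (v 0) with hν
  have : IsProbabilityMeasure ν := Measure.isProbabilityMeasure_map (hv 0)
  have htop : ∫⁻ y, logPlus y ∂ν ≠ ⊤ := by
    rw [hν, lintegral_map' measurable_logPlus.aemeasurable (hv 0)]
    exact h.ne
  have hfin : ∀ t, ∀ᵐ ω ∂P, v t ω ≠ ⊤ := fun t => by
    have : ∀ᵐ y ∂ν, y ≠ ⊤ := by
      filter_upwards [ae_lt_top measurable_logPlus htop] with y hy hy'
      exact hy.ne (logPlus_eq_top_iff.2 hy')
    rw [← hlaw t] at this
    exact ae_of_ae_map (hv t) this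
  have key : ∀ k : ℕ, ∀ᵐ ω ∂P, ∀ᶠ n : ℕ in atTop,
      (logPlus (v n ω)).toReal ≤ 1 / ((k : ℝ) + 1) * n ∧
      (logPlus (v (-n) ω)).toReal ≤ 1 / ((k : ℝ) + 1) * n := by
    intro k
    set δ : ℝ := 1 / ((k : ℝ) + 1) with hδdef
    have hδ : 0 < δ := by positivity
    -- Borel–Cantelli: the tail probabilities of an integrable variable are summable. Only the
    -- common law enters, no dependence structure.
    have hsum : (∑' j : ℕ, ν {y | (logPlus y).toReal / δ ∈ Set.Ioi (j : ℝ)}) < ∞ := by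
      let _ : MeasureSpace ℝ≥0∞ := ⟨ν⟩
      exact tsum_prob_mem_Ioi_lt_top (X := fun y : ℝ≥0∞ => (logPlus y).toReal / δ)
        ((integrable_toReal_of_lintegral_ne_top measurable_logPlus.aemeasurable htop).div_const δ)
        (fun y => div_nonneg ENNReal.toReal_nonneg hδ.le)
    have hms : ∀ j : ℕ, MeasurableSet {y : ℝ≥0∞ | (logPlus y).toReal / δ ∈ Set.Ioi (j : ℝ)} :=
      fun j => (measurable_logPlus.ennreal_toReal.div_const δ) measurableSet_Ioi
    have hseq : ∀ τ : ℕ → ℤ, ∀ᵐ ω ∂P, ∀ᶠ n : ℕ in atTop,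
        (logPlus (v (τ n) ω)).toReal ≤ δ * n := by
      intro τ
      have hBC : ∀ᵐ ω ∂P, ∀ᶠ n : ℕ in atTop,
          ω ∉ v (τ n) ⁻¹' {y | (logPlus y).toReal / δ ∈ Set.Ioi (n : ℝ)} := by
        refine ae_eventually_notMem (ne_of_lt ?_)
        refine lt_of_le_of_lt (le_of_eq ?_) hsum
        refine tsum_congr fun n => ?_
        rw [← hlaw (τ n), Measure.map_apply_of_aemeasurable (hv _) (hms n)]
      filter_upwards [hBC] with ω hω
      filter_upwards [hω] with n hn
      simp only [Set.mem_preimage, Set.mem_ofPred_eq, Set.mem_Ioi, not_lt] at hn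
      rwa [div_le_iff₀ hδ, mul_comm] at hn
    filter_upwards [hseq fun n => n, hseq fun n => -n] with ω h1 h2
    exact h1.and h2
  filter_upwards [ae_all_iff.2 hfin, ae_all_iff.2 key] with ω hω hk
  refine ⟨hω, fun δ hδ => ?_⟩
  obtain ⟨k, hkδ⟩ := exists_nat_one_div_lt hδ
  obtain ⟨N, hN⟩ := eventually_atTop.1 (hk k)
  -- The finite sum takes care of the times before the eventual bound sets in; afterwards the
  -- constant `1` suffices.
  refine ⟨1 + ∑ t ∈ Finset.Icc (-N : ℤ) N, (v t ω).toReal, by positivity, fun t => ?_⟩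
  have hexp : 1 ≤ Real.exp (δ * |(t : ℝ)|) := Real.one_le_exp (by positivity)
  have hs0 : 0 ≤ ∑ t ∈ Finset.Icc (-N : ℤ) N, (v t ω).toReal :=
    Finset.sum_nonneg fun _ _ => ENNReal.toReal_nonneg
  by_cases ht : t ∈ Finset.Icc (-N : ℤ) N
  · have := Finset.single_le_sum (f := fun t => (v t ω).toReal)
      (fun _ _ => ENNReal.toReal_nonneg) ht
    nlinarith
  · have hle : (logPlus (v t ω)).toReal ≤ 1 / ((k : ℝ) + 1) * |(t : ℝ)| := by
      rw [Finset.mem_Icc] at ht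
      rcases Int.eq_nat_or_neg t with ⟨n, rfl | rfl⟩
      · have := (hN n (by omega)).1
        simpa using this
      · have := (hN n (by omega)).2
        simpa using this
    calc (v t ω).toReal ≤ Real.exp (logPlus (v t ω)).toReal := toReal_le_exp_logPlus (hω t)
      _ ≤ Real.exp (δ * |(t : ℝ)|) := Real.exp_le_exp.2 (hle.trans (by gcongr))
      _ ≤ _ := by nlinarith

/-- Identically distributed random variables times an exponentially small factor vanish along a
subsequence. -/
theorem exists_subseq_exp_mul_tendsto_zero {P : Measure α} [IsProbabilityMeasure P]
    {y : ℕ → α → ℝ} (hy : ∀ n, AEMeasurable (y n) P) (hlaw : ∀ n, P.map (y n) = P.map (y 0))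
    {ε : ℝ} (hε : 0 < ε) :
    ∃ ns : ℕ → ℕ, StrictMono ns ∧
      ∀ᵐ ω ∂P, Tendsto (fun k => Real.exp (-ε * ns k) * y (ns k) ω) atTop (𝓝 0) := by
  have hmeas : TendstoInMeasure P (fun (n : ℕ) ω => Real.exp (-ε * n) * y n ω) atTop fun _ => 0 := by
    -- With `y 0` frozen the convergence is pointwise. Convergence in measure to a constant depends
    -- on the law of each term only, so it carries over to `y n`.
    have h0 : TendstoInMeasure P (fun (n : ℕ) ω => Real.exp (-ε * n) * y 0 ω) atTop fun _ => 0 := by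
      refine tendstoInMeasure_of_tendsto_ae
        (fun n => ((hy 0).const_mul _).aestronglyMeasurable) ?_
      refine Eventually.of_forall fun ω => ?_
      have h1 : Tendsto (fun n : ℕ => Real.exp (-ε * n)) atTop (𝓝 0) :=
        Real.tendsto_exp_atBot.comp
          ((tendsto_natCast_atTop_atTop).const_mul_atTop_of_neg (neg_lt_zero.2 hε))
      simpa using h1.mul_const (y 0 ω)
    intro a ha
    refine (h0 a ha).congr fun n => ?_
    have hset : MeasurableSet {z : ℝ | a ≤ edist (Real.exp (-ε * n) * z) 0} :=
      measurableSet_le measurable_const (by fun_prop)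
    have e : ∀ m, P {ω | a ≤ edist (Real.exp (-ε * n) * y m ω) 0} =
        P.map (y m) {z : ℝ | a ≤ edist (Real.exp (-ε * n) * z) 0} := fun m => by
      rw [Measure.map_apply_of_aemeasurable (hy m) hset]
      rfl
    rw [e 0, e n, hlaw n]
  obtain ⟨ns, hns, h⟩ := hmeas.exists_seq_tendsto_ae
  exact ⟨ns, hns, h⟩

end LogMoments

/-! ### From contraction on average to almost sure exponential contraction -/

section AverageContraction

theorem Subexponential.shift {a : ℤ → ℝ} (ha : Subexponential a) (k : ℤ) :
    Subexponential fun i => a (i + k) := fun δ hδ => by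
  obtain ⟨C, hC, hCa⟩ := ha δ hδ
  refine ⟨C * Real.exp (δ * |(k : ℝ)|), by positivity, fun i => (hCa _).trans ?_⟩
  rw [mul_assoc, ← Real.exp_add, ← mul_add]
  push_cast
  have := abs_add_le (i : ℝ) k
  gcongr
  linarith

variable {F : Type*} [MetricSpace F]

theorem lipConst_forwardIterate_succ_le (φ : ℤ → F → F) (i : ℤ) (n : ℕ) :
    lipConst (forwardIterate φ i (n + 1)) ≤
      lipConst (φ (i + n)) * lipConst (forwardIterate φ i n) :=
  lipConst_comp_le _ _

theorem exists_subexponential_lipConst_forwardIterate {φ : ℤ → F → F}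
    (hfin : ∀ t, lipConst (φ t) ≠ ⊤) (hsub : Subexponential fun t => (lipConst (φ t)).toReal)
    (n : ℕ) :
    ∃ b : ℤ → ℝ, (∀ i, 0 ≤ b i) ∧ Subexponential b ∧
      ∀ i, lipConst (forwardIterate φ i n) ≤ ENNReal.ofReal (b i) := by
  induction n with
  | zero =>
    refine ⟨fun _ => 1, fun _ => zero_le_one, Subexponential.const 1, fun i => ?_⟩
    rw [ENNReal.ofReal_one]
    exact lipConst_id_le
  | succ n ih =>
    obtain ⟨b, hb0, hb, hle⟩ := ih
    refine ⟨fun i => (lipConst (φ (i + n))).toReal * b i,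
      fun i => mul_nonneg ENNReal.toReal_nonneg (hb0 i), (hsub.shift n).mul hb hb0, fun i => ?_⟩
    rw [ENNReal.ofReal_mul ENNReal.toReal_nonneg, ENNReal.ofReal_toReal (hfin _)]
    exact (lipConst_forwardIterate_succ_le φ i n).trans (by gcongr; exact hle i)

theorem exists_subexponential_prod {ι : Type*} (s : Finset ι) {a : ι → ℤ → ℝ≥0∞}
    (ha : ∀ k ∈ s, ∃ b : ℤ → ℝ, (∀ i, 0 ≤ b i) ∧ Subexponential b ∧
      ∀ i, a k i ≤ ENNReal.ofReal (b i)) :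
    ∃ b : ℤ → ℝ, (∀ i, 0 ≤ b i) ∧ Subexponential b ∧
      ∀ i, ∏ k ∈ s, a k i ≤ ENNReal.ofReal (b i) := by
  classical
  induction s using Finset.induction_on with
  | empty => exact ⟨fun _ => 1, fun _ => zero_le_one, Subexponential.const 1, fun i => by simp⟩
  | insert j s hj ih =>
    obtain ⟨b, hb0, hb, hle⟩ := ih fun k hk => ha k (Finset.mem_insert_of_mem hk)
    obtain ⟨b', hb0', hb', hle'⟩ := ha j (Finset.mem_insert_self j s)
    refine ⟨fun i => b' i * b i, fun i => mul_nonneg (hb0' i) (hb0 i), hb'.mul hb hb0, fun i => ?_⟩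
    rw [Finset.prod_insert hj, ENNReal.ofReal_mul (hb0' i)]
    exact mul_le_mul' (hle' i) (hle i)

/-- The product of `r` consecutive Lipschitz constants is controlled by the Lipschitz constants of
the blocks of length `r`. -/
theorem prod_lipConst_le_exp (φ : ℤ → F → F) {r : ℕ} (hr : 1 ≤ r) (S : ℤ → ℝ) (f : ℤ → ℝ)
    (hS : ∀ k, S (k + 1) = S k + f k)
    (hf : ∀ k, lipConst (forwardIterate φ k r) ≤ ENNReal.ofReal (Real.exp (f k))) (i : ℤ) (n : ℕ) :
    ∏ k ∈ Finset.range r, lipConst (forwardIterate φ i (n + k)) ≤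
      (∏ k ∈ Finset.range r, lipConst (forwardIterate φ i k)) *
        ENNReal.ofReal (Real.exp (S (i + n) - S i)) := by
  induction n with
  | zero => simp
  | succ n ih =>
    -- Moving the window by one drops the factor of length `n` and gains the one of length `n + r`,
    -- which is at most the dropped factor times a block of length `r` started at `i + n`.
    have hstep : ∏ k ∈ Finset.range r, lipConst (forwardIterate φ i (n + 1 + k)) ≤
        (∏ k ∈ Finset.range r, lipConst (forwardIterate φ i (n + k))) *
          lipConst (forwardIterate φ (i + n) r) := by
      cases r with
      | zero => omega
      | succ r =>
        rw [Finset.prod_range_succ, Finset.prod_range_succ', mul_assoc]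
        refine mul_le_mul' (le_of_eq (Finset.prod_congr rfl fun k _ => ?_)) ?_
        · rw [show n + 1 + k = n + (k + 1) by ring]
        · rw [show n + 1 + r = n + (r + 1) by ring, mul_comm]
          exact lipConst_forwardIterate_add_le φ i n (r + 1)
    calc _ ≤ _ := hstep
      _ ≤ (∏ k ∈ Finset.range r, lipConst (forwardIterate φ i k)) *
          ENNReal.ofReal (Real.exp (S (i + n) - S i)) * ENNReal.ofReal (Real.exp (f (i + n))) :=
        mul_le_mul' ih (hf _)
      _ = _ := by
        rw [mul_assoc, ← ENNReal.ofReal_mul (Real.exp_pos _).le, ← Real.exp_add]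
        congr 3
        have := hS (i + n)
        push_cast
        rw [← add_assoc, this]
        ring

/-- Contraction of long iterates, from linear decay of the sum of the logarithms of the Lipschitz
constants of the blocks of length `r`. -/
theorem contractsExp_of_primitive {φ : ℤ → F → F} {r : ℕ} (hr : 1 ≤ r) {S f : ℤ → ℝ} {ε : ℝ}
    (hε : 0 < ε) (hfin : ∀ t, lipConst (φ t) ≠ ⊤)
    (hsub : Subexponential fun t => (lipConst (φ t)).toReal)
    (hS : ∀ k, S (k + 1) = S k + f k)
    (hf : ∀ k, lipConst (forwardIterate φ k r) ≤ ENNReal.ofReal (Real.exp (f k)))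
    (hgrow : ∀ δ > 0, ∃ C, ∀ k : ℤ, |S k - k * (-(2 * ε * r))| ≤ C + δ * |(k : ℝ)|) :
    ContractsExp φ ε := by
  have hr0 : (0 : ℝ) < r := by exact_mod_cast hr
  have hb := exists_subexponential_lipConst_forwardIterate hfin hsub
  obtain ⟨b₁, hb₁0, hb₁, hle₁⟩ := exists_subexponential_prod (Finset.range r)
    (a := fun k i => lipConst (forwardIterate φ i k)) fun k _ => hb k
  obtain ⟨b₂, hb₂0, hb₂, hle₂⟩ := exists_subexponential_prod (Finset.range r)
    (a := fun k i => lipConst (forwardIterate φ (i + k) (r - k))) fun k _ => by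
      obtain ⟨b, hb0, hb, hle⟩ := hb (r - k)
      exact ⟨fun i => b (i + k), fun i => hb0 _, hb.shift k, fun i => hle _⟩
  obtain ⟨b₃, hb₃0, hb₃, hle₃⟩ : ∃ b : ℤ → ℝ, (∀ i, 0 ≤ b i) ∧ Subexponential b ∧
      ∀ i, ∀ n < r, lipConst (forwardIterate φ i n) ≤ ENNReal.ofReal (b i) := by
    choose b hb0 hb hle using hb
    refine ⟨fun i => ∑ n ∈ Finset.range r, b n i, fun i => Finset.sum_nonneg fun n _ => hb0 n i,
      Subexponential.sum _ fun n _ => hb n, fun i n hn => (hle n i).trans ?_⟩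
    exact ENNReal.ofReal_le_ofReal (Finset.single_le_sum (f := fun n => b n i)
      (fun n _ => hb0 n i) (Finset.mem_range.2 hn))
  -- The iterate of length `n + r` is split at `n + k` for every `k < r`. Multiplying the `r`
  -- estimates makes the whole window appear, at the price of an `r`-th power on the left.
  have hblock : ∀ (i : ℤ) (n : ℕ), lipConst (forwardIterate φ i (n + r)) ^ r ≤
      ENNReal.ofReal (b₂ (i + n) * (b₁ i * Real.exp (S (i + n) - S i))) := by
    intro i n
    calc lipConst (forwardIterate φ i (n + r)) ^ r
        = ∏ k ∈ Finset.range r, lipConst (forwardIterate φ i (n + r)) := by simp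
      _ ≤ ∏ k ∈ Finset.range r, (lipConst (forwardIterate φ (i + n + k) (r - k)) *
            lipConst (forwardIterate φ i (n + k))) := by
          refine Finset.prod_le_prod' fun k hk => ?_
          have hk' := Finset.mem_range.1 hk
          have := lipConst_forwardIterate_add_le φ i (n + k) (r - k)
          rw [show n + k + (r - k) = n + r by omega] at this
          rw [add_assoc i]
          exact_mod_cast this
      _ ≤ ENNReal.ofReal (b₂ (i + n)) * (ENNReal.ofReal (b₁ i) *
            ENNReal.ofReal (Real.exp (S (i + n) - S i))) := by
          rw [Finset.prod_mul_distrib]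
          refine mul_le_mul' (hle₂ (i + n)) ((prod_lipConst_le_exp φ hr S f hS hf i n).trans ?_)
          gcongr
          exact hle₁ i
      _ = _ := by
          rw [ENNReal.ofReal_mul (hb₂0 _), ENNReal.ofReal_mul (hb₁0 _)]
  intro δ hδ
  -- The errors add up to `δ' (4 |i| + 2 n)`. The `n` part is paid by half of the slope `-2 ε r`,
  -- the other part by `r δ |i|`.
  set δ' := min δ ε / 6 with hδ'
  have hδ'0 : 0 < δ' := by positivity
  have h6 : 6 * δ' ≤ δ := by rw [hδ']; linarith [min_le_left δ ε]
  have h6' : 6 * δ' ≤ ε := by rw [hδ']; linarith [min_le_right δ ε]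
  obtain ⟨C₁, hC₁, hC₁b⟩ := hb₁ δ' hδ'0
  obtain ⟨C₂, hC₂, hC₂b⟩ := hb₂ δ' hδ'0
  obtain ⟨C₃, hC₃, hC₃b⟩ := hb₃ δ hδ
  obtain ⟨C₄, hC₄⟩ := hgrow δ' hδ'0
  set B := C₂ * C₁ * Real.exp (2 * C₄) with hB
  have hB0 : 0 < B := by positivity
  -- With `A ≥ 1` and `r ≥ 1` one has `B ≤ A ^ r`, so that an `r`-th root can be taken without real
  -- powers.
  set A := max 1 B with hA
  have hA1 : 1 ≤ A := le_max_left _ _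
  have hAr : B ≤ A ^ r := (le_max_right _ _).trans (le_self_pow₀ hA1 (by omega))
  have hlong : ∀ (i : ℤ) (n : ℕ), lipConst (forwardIterate φ i (n + r)) ≤
      ENNReal.ofReal (A * Real.exp (-ε * n + δ * |(i : ℝ)|)) := by
    intro i n
    rw [← ENNReal.pow_le_pow_left_iff (n := r) (by omega)]
    rw [← ENNReal.ofReal_pow (by positivity)]
    refine (hblock i n).trans (ENNReal.ofReal_le_ofReal ?_)
    have e1 := abs_le.1 (hC₄ (i + n))
    have e2 := abs_le.1 (hC₄ i)
    have e3 := abs_add_natCast_le i n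
    have hdiff : S (i + n) - S i ≤ -(2 * ε * r) * n + 2 * C₄ + δ' * (2 * |(i : ℝ)| + n) := by
      have h3 : δ' * |((i + n : ℤ) : ℝ)| ≤ δ' * (|(i : ℝ)| + n) := by gcongr
      push_cast at e1 h3
      nlinarith [e1.2, e2.1]
    calc b₂ (i + n) * (b₁ i * Real.exp (S (i + n) - S i))
        ≤ (C₂ * Real.exp (δ' * (|(i : ℝ)| + n))) * ((C₁ * Real.exp (δ' * |(i : ℝ)|)) *
          Real.exp (-(2 * ε * r) * n + 2 * C₄ + δ' * (2 * |(i : ℝ)| + n))) := by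
          have := hb₁0 i
          refine mul_le_mul ((hC₂b _).trans (by gcongr)) ?_ (by positivity) (by positivity)
          exact mul_le_mul (hC₁b i) (Real.exp_le_exp.2 hdiff) (by positivity) (by positivity)
      _ = B * Real.exp (-(2 * ε * r) * n + δ' * (4 * |(i : ℝ)| + 2 * n)) := by
          rw [hB]
          rw [show C₂ * Real.exp (δ' * (|(i : ℝ)| + n)) * (C₁ * Real.exp (δ' * |(i : ℝ)|) *
            Real.exp (-(2 * ε * r) * n + 2 * C₄ + δ' * (2 * |(i : ℝ)| + n))) =
            C₂ * C₁ * (Real.exp (δ' * (|(i : ℝ)| + n)) * Real.exp (δ' * |(i : ℝ)|) *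
            Real.exp (-(2 * ε * r) * n + 2 * C₄ + δ' * (2 * |(i : ℝ)| + n))) by ring]
          rw [← Real.exp_add, ← Real.exp_add, mul_assoc (C₂ * C₁), ← Real.exp_add]
          congr 2
          ring
      _ ≤ A ^ r * Real.exp (r * (-ε * n + δ * |(i : ℝ)|)) := by
          refine mul_le_mul hAr (Real.exp_le_exp.2 ?_) (by positivity) (by positivity)
          have hr1 : (1 : ℝ) ≤ r := by exact_mod_cast hr
          have hn : (0 : ℝ) ≤ n := Nat.cast_nonneg n
          have hi : 0 ≤ |(i : ℝ)| := abs_nonneg _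
          have t1 : δ' * (4 * |(i : ℝ)|) ≤ r * (δ * |(i : ℝ)|) := by
            have : 1 * (δ * |(i : ℝ)|) ≤ r * (δ * |(i : ℝ)|) := by gcongr
            nlinarith
          have t2 : δ' * (2 * n) ≤ ε * r * n := by
            have : 1 * (ε * n) ≤ r * (ε * n) := by gcongr
            nlinarith
          nlinarith
      _ = _ := by rw [mul_pow, ← Real.exp_nat_mul]
  set C := max (A * Real.exp (ε * r)) (C₃ * Real.exp (ε * r)) with hC
  have hC0 : 0 < C := lt_max_of_lt_left (by positivity)
  refine ⟨C, hC0, fun i n u v => ?_⟩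
  have hL : lipConst (forwardIterate φ i n) ≤
      ENNReal.ofReal (C * Real.exp (-ε * n + δ * |(i : ℝ)|)) := by
    rcases lt_or_ge n r with hn | hn
    · refine (hle₃ i n hn).trans (ENNReal.ofReal_le_ofReal ((hC₃b i).trans ?_))
      have hn' : (n : ℝ) ≤ r := by exact_mod_cast hn.le
      calc C₃ * Real.exp (δ * |(i : ℝ)|)
          ≤ C₃ * Real.exp (ε * r + (-ε * n + δ * |(i : ℝ)|)) := by
            refine mul_le_mul_of_nonneg_left (Real.exp_le_exp.2 ?_) hC₃.le
            nlinarith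
        _ = C₃ * Real.exp (ε * r) * Real.exp (-ε * n + δ * |(i : ℝ)|) := by
            rw [Real.exp_add, mul_assoc]
        _ ≤ _ := by
            gcongr
            exact le_max_right _ _
    · obtain ⟨m, rfl⟩ : ∃ m, n = m + r := ⟨n - r, by omega⟩
      refine (hlong i m).trans (ENNReal.ofReal_le_ofReal ?_)
      calc A * Real.exp (-ε * m + δ * |(i : ℝ)|)
          = A * Real.exp (ε * r) * Real.exp (-ε * (m + r : ℕ) + δ * |(i : ℝ)|) := by
            rw [mul_assoc, ← Real.exp_add]
            push_cast
            congr 2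
            ring
        _ ≤ _ := by
            gcongr
            exact le_max_left _ _
  have := (edist_le_lipConst_mul (forwardIterate φ i n) u v).trans (mul_le_mul' hL le_rfl)
  rw [edist_dist, edist_dist, ← ENNReal.ofReal_mul (by positivity)] at this
  exact (ENNReal.ofReal_le_ofReal_iff (by positivity)).1 this

variable {E : Type*} [MeasurableSpace E] {μ : Measure (ℤ → E)}

theorem map_comp_shiftBy (hμ : MeasurePreserving shiftSeq μ μ) {β : Type*} [MeasurableSpace β]
    {g : (ℤ → E) → β} (hg : AEMeasurable g μ) (k : ℤ) :
    μ.map (fun x => g (shiftBy k x)) = μ.map g := by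
  have h := measurePreserving_shiftBy hμ k
  have hg' : AEMeasurable g (μ.map (shiftBy k)) := by rwa [h.map_eq]
  have := AEMeasurable.map_map_of_aemeasurable hg' h.measurable.aemeasurable
  rw [h.map_eq] at this
  exact this.symm

/-- Negative expected logarithm of the Lipschitz constant of an iterate implies almost sure
exponential contraction of the iterates of a stationary ergodic sequence of random maps. -/
theorem ae_contractsExp [IsProbabilityMeasure μ] (hμ : Ergodic shiftSeq μ) {Φ : (ℤ → E) → ℤ → F → F}
    (hΦ : ∀ k x t, Φ (shiftBy k x) t = Φ x (t + k))
    (hmeas : ∀ i n, Measurable fun x => lipConst (forwardIterate (Φ x) i n))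
    (hlip : FiniteLogPlusMoment μ fun x => lipConst (Φ x 0))
    {r : ℕ} (hr : 1 ≤ r) (hcontr : NegativeLogMean μ fun x => lipConst (pastIterate (Φ x) 0 r)) :
    ∃ ε > 0, ∀ᵐ x ∂μ, ContractsExp (Φ x) ε := by
  have hr0 : (0 : ℝ) < r := by exact_mod_cast hr
  have hiter : ∀ k x i n, forwardIterate (Φ (shiftBy k x)) i n = forwardIterate (Φ x) (i + k) n := by
    intro k x i n
    rw [← forwardIterate_shift]
    congr 1
    exact funext fun t => hΦ k x t
  have hone : ∀ x t, Φ x t = forwardIterate (Φ x) t 1 := fun x t => funext fun u => by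
    simp [forwardIterate_succ]
  simp_rw [pastIterate_eq_forwardIterate] at hcontr
  obtain ⟨f, hfm, hfi, hfneg, hfle⟩ := hcontr.exists_integrable (hmeas _ _)
  set c := ∫ x, f x ∂μ with hc
  -- This `ε` makes the slope `c` of the Birkhoff sums equal to `-2 ε r`.
  refine ⟨-c / (2 * r), div_pos (neg_pos.2 hfneg) (by positivity), ?_⟩
  have hsub : ∀ᵐ x ∂μ, (∀ t, lipConst (Φ x t) ≠ ⊤) ∧
      Subexponential fun t => (lipConst (Φ x t)).toReal := by
    have hm : ∀ t, Measurable fun x => lipConst (Φ x t) := fun t => by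
      simp_rw [hone]
      exact hmeas t 1
    refine ae_subexponential_of_finiteLogPlusMoment (v := fun t x => lipConst (Φ x t))
      (fun t => (hm t).aemeasurable) (fun t => ?_) hlip
    rw [← map_comp_shiftBy hμ.toMeasurePreserving (hm 0).aemeasurable t]
    simp_rw [hΦ, zero_add]
  -- The block ending at time `0` starts at `1 - r`, so a shift by `k + r - 1` moves its start to
  -- `k`.
  have hle : ∀ᵐ x ∂μ, ∀ k, lipConst (forwardIterate (Φ x) k r) ≤
      ENNReal.ofReal (Real.exp (f (shiftBy (k + r - 1) x))) := by
    refine ae_all_iff.2 fun k => ?_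
    filter_upwards [(measurePreserving_shiftBy hμ.toMeasurePreserving
      (k + r - 1)).quasiMeasurePreserving.ae hfle] with x hx
    rw [hiter] at hx
    convert hx using 3
    ring
  filter_upwards [hsub, hle, ae_exists_primitive hμ hfm hfi] with x hx1 hx2 ⟨S, hS, hSg⟩
  refine contractsExp_of_primitive hr (S := fun k => S (k + r - 1))
    (f := fun k => f (shiftBy (k + r - 1) x)) (div_pos (neg_pos.2 hfneg) (by positivity))
    hx1.1 hx1.2 (fun k => ?_) hx2 (fun δ hδ => ?_)
  · rw [← hS]
    congr 1
    ring
  · obtain ⟨C, hC⟩ := hSg δ hδ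
    refine ⟨C + δ * r + r * |c|, fun k => ?_⟩
    have h1 := hC (k + r - 1)
    have h2 : -(2 * (-c / (2 * r)) * r) = c := by field_simp
    rw [h2]
    have hr1 : (1 : ℝ) ≤ r := by exact_mod_cast hr
    have e : (((k + r - 1 : ℤ)) : ℝ) = k + (r - 1) := by push_cast; ring
    rw [e] at h1
    have h3 : |(k : ℝ) + (r - 1)| ≤ |(k : ℝ)| + r := by
      refine (abs_add_le _ _).trans ?_
      rw [abs_of_nonneg (by linarith : (0 : ℝ) ≤ r - 1)]
      linarith
    have h4 : |(r - 1) * c| ≤ r * |c| := by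
      rw [abs_mul, abs_of_nonneg (by linarith : (0 : ℝ) ≤ r - 1)]
      nlinarith [abs_nonneg c]
    have h5 : S (k + r - 1) - k * c = (S (k + r - 1) - (k + (r - 1)) * c) + (r - 1) * c := by ring
    rw [h5]
    refine (abs_add_le _ _).trans ?_
    nlinarith

end AverageContraction

/-! ### Measurability in spaces of continuous functions -/

section FunctionSpaceMeasurability

/-- A map into `C(X, Y)` is measurable if all its evaluations are. -/
theorem measurable_continuousMap_of_eval {α X Y : Type*} [MeasurableSpace α] [TopologicalSpace X]
    [CompactSpace X] [TopologicalSpace.SeparableSpace X] [MetricSpace Y] [MeasurableSpace Y]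
    [BorelSpace Y] [SecondCountableTopology C(X, Y)] {f : α → C(X, Y)}
    (h : ∀ x, Measurable fun a => f a x) : Measurable f := by
  -- A closed sup-norm ball is described by the evaluations on a countable dense set, and open sets
  -- are countable unions of balls.
  have hd : ∀ g : C(X, Y), Measurable fun a => dist (f a) g := by
    intro g
    refine measurable_of_Iic fun r => ?_
    rcases lt_or_ge r 0 with hr | hr
    · have : (fun a => dist (f a) g) ⁻¹' Set.Iic r = ∅ := by
        ext a
        simpa using hr.trans_le dist_nonneg
      rw [this]
      exact MeasurableSet.empty
    · obtain ⟨s, hsc, hsd⟩ := TopologicalSpace.exists_countable_dense X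
      have : (fun a => dist (f a) g) ⁻¹' Set.Iic r = ⋂ x ∈ s, {a | dist (f a x) (g x) ≤ r} := by
        ext a
        simp only [Set.mem_preimage, Set.mem_Iic, Set.mem_iInter, Set.mem_ofPred_eq,
          ContinuousMap.dist_le hr]
        refine ⟨fun H x _ => H x, fun H x => ?_⟩
        have hcl : IsClosed {x | dist (f a x) (g x) ≤ r} := isClosed_le (by fun_prop) (by fun_prop)
        have : closure s ⊆ {x | dist (f a x) (g x) ≤ r} := closure_minimal (fun x hx => H x hx) hcl
        exact this (hsd x)
      rw [this]
      refine MeasurableSet.biInter hsc fun x _ => ?_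
      have : Measurable fun y : Y => dist y (g x) := by fun_prop
      exact measurableSet_le (this.comp (h x)) measurable_const
  refine measurable_of_isOpen fun U hU => ?_
  choose! r hr0 hr using Metric.isOpen_iff.1 hU
  obtain ⟨T, hTc, hT⟩ := TopologicalSpace.isOpen_iUnion_countable
    (fun x : U => Metric.ball (x : C(X, Y)) (r x)) fun x => Metric.isOpen_ball
  have hU' : U = ⋃ x : U, Metric.ball (x : C(X, Y)) (r x) := by
    refine Set.Subset.antisymm (fun x hx => Set.mem_iUnion.2 ⟨⟨x, hx⟩, ?_⟩)
      (Set.iUnion_subset fun x => hr x x.2)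
    exact Metric.mem_ball_self (hr0 x hx)
  rw [hU', ← hT, Set.preimage_iUnion₂]
  refine MeasurableSet.biUnion hTc fun x _ => ?_
  exact measurableSet_lt (hd x) measurable_const

/-- A map into a space of linear maps on a finite-dimensional space is measurable if all its
evaluations are. -/
theorem measurable_clm_of_apply {α V W : Type*} [MeasurableSpace α] [NormedAddCommGroup V]
    [NormedSpace ℝ V] [FiniteDimensional ℝ V] [NormedAddCommGroup W] [NormedSpace ℝ W]
    [FiniteDimensional ℝ W] [MeasurableSpace W] [BorelSpace W] {f : α → V →L[ℝ] W}
    (h : ∀ v, Measurable fun a => f a v) : Measurable f := by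
  set b := Module.finBasis ℝ V
  have key : ∀ a, f a = ∑ i, (ContinuousLinearMap.toSpanSingleton ℝ (f a (b i))).comp
      (LinearMap.toContinuousLinearMap (b.coord i)) := by
    intro a
    ext v
    conv_lhs => rw [← b.sum_repr v, map_sum]
    simp
  have hc : ∀ i, Continuous fun w : W => (ContinuousLinearMap.toSpanSingleton ℝ w).comp
      (LinearMap.toContinuousLinearMap (b.coord i)) := fun i =>
    (ContinuousLinearMap.toSpanSingletonCLE (𝕜 := ℝ) (E := W)).continuous.clm_comp continuous_const
  have : ProperSpace W := FiniteDimensional.proper_real W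
  rw [funext key]
  exact Finset.measurable_sum _ fun i _ => (hc i).measurable.comp (h (b i))

/-- Measurability holds on the whole space, including the points without convergence. This is what
allows limits to be measurable for the uncompleted past σ-fields. -/
theorem measurable_limUnder_of_polish {α Y : Type*} [MeasurableSpace α] [MetricSpace Y]
    [CompleteSpace Y] [SecondCountableTopology Y] [Nonempty Y] [MeasurableSpace Y] [BorelSpace Y]
    {f : ℕ → α → Y} (h : ∀ n, Measurable (f n)) :
    Measurable fun a => limUnder atTop fun n => f n a :=
  (StronglyMeasurable.limUnder fun n => (h n).stronglyMeasurable).measurable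

end FunctionSpaceMeasurability

/-! ### Differentiability on closed sets and the orthant -/

section ClosedDifferentiability

variable {V W : Type*} [NormedAddCommGroup V] [NormedSpace ℝ V] [NormedAddCommGroup W]
  [NormedSpace ℝ W] {S : Set V} {f : V → W}

theorem derivOn_eq_of_hasFDerivAt (hS : S ⊆ closure (interior S)) {D : V → V →L[ℝ] W}
    (hD : ContinuousOn D S) (h : ∀ x ∈ interior S, HasFDerivAt f (D x) x) {x : V} (hx : x ∈ S) :
    derivOn S f x = D x := by
  refine extendFrom_eq (hS hx) ?_
  refine ((hD x hx).mono_left (nhdsWithin_mono x interior_subset)).congr' ?_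
  filter_upwards [self_mem_nhdsWithin] with y hy
  exact (h y hy).fderiv.symm

theorem C1On.continuousOn_derivOn (hf : C1On S f) (hS : S ⊆ closure (interior S)) :
    ContinuousOn (derivOn S f) S := by
  obtain ⟨-, D, hD, h⟩ := hf
  exact hD.congr fun x hx => derivOn_eq_of_hasFDerivAt hS hD h hx

theorem C1On.hasFDerivAt_derivOn (hf : C1On S f) (hS : S ⊆ closure (interior S)) {x : V}
    (hx : x ∈ interior S) : HasFDerivAt f (derivOn S f x) x := by
  obtain ⟨-, D, hD, h⟩ := hf
  rw [derivOn_eq_of_hasFDerivAt hS hD h (interior_subset hx)]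
  exact h x hx

theorem C1On.euclidean {n : ℕ} {f : Fin n → V → ℝ} (hf : ∀ j, C1On S (f j)) :
    C1On S fun z => (WithLp.toLp 2 fun j => f j z : Vec n) := by
  choose hc D hD h using hf
  refine ⟨(PiLp.continuous_toLp 2 _).comp_continuousOn (continuousOn_pi.2 hc),
    fun z => ∑ j, (ContinuousLinearMap.toSpanSingleton ℝ
      (EuclideanSpace.single j (1 : ℝ) : Vec n)).comp (D j z), ?_, fun x hx => ?_⟩
  · exact continuousOn_finsetSum _ fun j _ => continuousOn_const.clm_comp (hD j)
  · rw [← hasFDerivWithinAt_univ, hasFDerivWithinAt_euclidean]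
    intro j
    rw [hasFDerivWithinAt_univ]
    have e : PiLp.proj 2 (fun _ : Fin n => ℝ) j ∘L (∑ j, (ContinuousLinearMap.toSpanSingleton ℝ
        (EuclideanSpace.single j (1 : ℝ) : Vec n)).comp (D j x)) = D j x := by
      ext v
      simp
    have := h j x hx
    rw [← e] at this
    exact this

theorem C1On.of_clm (L : V →L[ℝ] W) : C1On S L :=
  ⟨L.continuous.continuousOn, fun _ => L, continuousOn_const, fun _ _ => L.hasFDerivAt⟩

end ClosedDifferentiability

section Orthant

variable (q : ℕ)

theorem isClosed_orthant : IsClosed (orthant q) := by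
  have : orthant q = ⋂ j, {u : Vec q | 0 ≤ u j} := by
    ext u
    simp [orthant]
  rw [this]
  exact isClosed_iInter fun j => isClosed_le continuous_const (by fun_prop)

theorem convex_orthant : Convex ℝ (orthant q) := by
  intro u hu v hv a b ha hb _ j
  simpa using add_nonneg (mul_nonneg ha (hu j)) (mul_nonneg hb (hv j))

theorem closure_interior_orthant : closure (interior (orthant q)) = orthant q := by
  rw [(convex_orthant q).closure_interior_eq_closure_of_nonempty_interior,
    (isClosed_orthant q).closure_eq]
  have ho : IsOpen {u : Vec q | ∀ j, 0 < u j} := by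
    have : {u : Vec q | ∀ j, 0 < u j} = ⋂ j, {u : Vec q | 0 < u j} := by
      ext u
      simp
    rw [this]
    exact isOpen_iInter_of_finite fun j => isOpen_lt continuous_const (by fun_prop)
  exact ⟨WithLp.toLp 2 fun _ => 1, interior_maximal (fun u hu j => (hu j).le) ho
    (by simp)⟩

end Orthant

/-! ### The random maps and their limits: measurability and shift equivariance -/

namespace VolatilityFamily

variable {d p q : ℕ} {M : VolatilityFamily d p q} {K : TopologicalSpace.Compacts (Vec d)}

theorem IsRegularOn.prod_subset_closure_interior (hM : M.IsRegularOn K) :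
    (K : Set (Vec d)) ×ˢ orthant q ⊆ closure (interior ((K : Set (Vec d)) ×ˢ orthant q)) := by
  rw [interior_prod_eq, closure_prod_eq, hM.closure_interior, closure_interior_orthant]

theorem IsRegularOn.c1_psi (hM : M.IsRegularOn K) (x : Fin p → ℝ) :
    C1On ((K : Set (Vec d)) ×ˢ orthant q) (M.psi x) := by
  refine C1On.euclidean fun j => ?_
  by_cases hj : (j : ℕ) = 0
  · simpa only [hj, if_true] using hM.c1 x
  · simp only [hj, if_false]
    exact C1On.of_clm ((EuclideanSpace.proj (⟨(j : ℕ) - 1, by omega⟩ : Fin q)).comp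
      (ContinuousLinearMap.snd ℝ (Vec d) (Vec q)))

theorem IsRegularOn.measurable_psi (hM : M.IsRegularOn K) {z : Vec d × Vec q}
    (hz : z ∈ (K : Set (Vec d)) ×ˢ orthant q) : Measurable fun x => M.psi x z := by
  refine (WithLp.measurable_toLp 2 _).comp (measurable_pi_lambda _ fun j => ?_)
  by_cases hj : (j : ℕ) = 0
  · simpa only [hj, if_true] using
      M.measurable z.1 (interior_subset (hM.subset_interior hz.1)) z.2 hz.2
  · simp only [hj, if_false]
    exact measurable_const

/-- The derivative is a limit of difference quotients with steps `1 / (n + 1)`. The index is moved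
by `N` to keep the points in `S`, where alone measurability is known. -/
theorem measurable_derivOn_apply_interior {V W X : Type*} [NormedAddCommGroup V] [NormedSpace ℝ V]
    [NormedAddCommGroup W] [NormedSpace ℝ W] [MeasurableSpace W] [BorelSpace W] [MeasurableSpace X]
    {S : Set V} (hS : S ⊆ closure (interior S)) {f : X → V → W} (hf : ∀ x, C1On S (f x))
    (hm : ∀ z ∈ S, Measurable fun x => f x z) [SecondCountableTopology W]
    {z : V} (hz : z ∈ interior S) (v : V) : Measurable fun x => derivOn S (f x) z v := by
  have hc : Tendsto (fun n : ℕ => ((n : ℝ) + 1)) atTop atTop :=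
    tendsto_atTop_add_const_right _ _ tendsto_natCast_atTop_atTop
  have hin : ∀ᶠ n : ℕ in atTop, z + ((n : ℝ) + 1)⁻¹ • v ∈ S := by
    have : Tendsto (fun n : ℕ => z + ((n : ℝ) + 1)⁻¹ • v) atTop (𝓝 (z + (0 : ℝ) • v)) :=
      tendsto_const_nhds.add ((tendsto_inv_atTop_zero.comp hc).smul_const v)
    rw [zero_smul, add_zero] at this
    exact this (mem_interior_iff_mem_nhds.1 hz)
  obtain ⟨N, hN⟩ := eventually_atTop.1 hin
  refine measurable_of_tendsto_metrizable (f := fun (n : ℕ) (x : X) =>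
    (((n + N : ℕ) : ℝ) + 1) • (f x (z + (((n + N : ℕ) : ℝ) + 1)⁻¹ • v) - f x z)) (fun n => ?_) ?_
  · exact ((hm _ (hN _ (by omega))).sub (hm z (interior_subset hz))).const_smul _
  · refine tendsto_pi_nhds.2 fun x => ?_
    have hder := (hf x).hasFDerivAt_derivOn hS hz
    have := hder.lim v (c := fun n : ℕ => (n : ℝ) + 1) (l := atTop)
      (tendsto_norm_atTop_atTop.comp hc)
    exact this.comp (tendsto_add_atTop_nat N)

/-- Boundary points are reached from the interior, because the extended derivative is continuous on
`S`. -/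
theorem measurable_derivOn_apply {V W X : Type*} [NormedAddCommGroup V] [NormedSpace ℝ V]
    [NormedAddCommGroup W] [NormedSpace ℝ W] [MeasurableSpace W] [BorelSpace W] [MeasurableSpace X]
    {S : Set V} (hS : S ⊆ closure (interior S)) {f : X → V → W} (hf : ∀ x, C1On S (f x))
    (hm : ∀ z ∈ S, Measurable fun x => f x z) [SecondCountableTopology W]
    {z : V} (hz : z ∈ S) (v : V) : Measurable fun x => derivOn S (f x) z v := by
  obtain ⟨w, hw, hlim⟩ := mem_closure_iff_seq_limit.1 (hS hz)
  refine measurable_of_tendsto_metrizable (f := fun n x => derivOn S (f x) (w n) v)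
    (fun n => measurable_derivOn_apply_interior hS hf hm (hw n) v) ?_
  refine tendsto_pi_nhds.2 fun x => ?_
  have h1 : Tendsto (fun n => derivOn S (f x) (w n)) atTop (𝓝 (derivOn S (f x) z)) :=
    ((hf x).continuousOn_derivOn hS z hz).tendsto.comp
      (tendsto_nhdsWithin_iff.2 ⟨hlim, Eventually.of_forall fun n => interior_subset (hw n)⟩)
  exact ((ContinuousLinearMap.apply ℝ W v).continuous.tendsto _).comp h1

theorem isClosed_nonnegFun (K : TopologicalSpace.Compacts (Vec d)) (q : ℕ) :
    IsClosed {s : C(K, Vec q) | ∀ θ, s θ ∈ orthant q} := by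
  have : {s : C(K, Vec q) | ∀ θ, s θ ∈ orthant q} =
      ⋂ θ, (fun s : C(K, Vec q) => s θ) ⁻¹' orthant q := by
    ext s
    simp
  rw [this]
  exact isClosed_iInter fun θ => (isClosed_orthant q).preimage (by fun_prop)

instance instCompleteSpaceNonnegFun : CompleteSpace (NonnegFun K q) :=
  (isClosed_nonnegFun K q).completeSpace_coe

instance instNonemptyNonnegFun : Nonempty (NonnegFun K q) :=
  ⟨constFun K ⟨0, fun _ => le_rfl⟩⟩

/-- The derivative of `(θ, u) ↦ ψ(θ, u)` along the graph of `s`. -/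
noncomputable def IsRegularOn.grad (hM : M.IsRegularOn K) (x : Fin p → ℝ) (s : NonnegFun K q) :
    C(K, Vec d × Vec q →L[ℝ] Vec q) where
  toFun θ := derivOn ((K : Set (Vec d)) ×ˢ orthant q) (M.psi x) (θ, s.1 θ)
  continuous_toFun :=
    ((hM.c1_psi x).continuousOn_derivOn hM.prod_subset_closure_interior).comp_continuous
      (f := fun θ : K => ((θ : Vec d), s.1 θ)) (by fun_prop) fun θ => ⟨θ.2, s.2 θ⟩

theorem IsRegularOn.grad_apply (hM : M.IsRegularOn K) (x : Fin p → ℝ) (s : NonnegFun K q) (θ : K) :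
    hM.grad x s θ = derivOn ((K : Set (Vec d)) ×ˢ orthant q) (M.psi x) (θ, s.1 θ) := rfl

theorem continuous_id_prod {X : Type*} [TopologicalSpace X] {e : X → Vec d →L[ℝ] Vec q}
    (he : Continuous e) : Continuous fun x => (ContinuousLinearMap.id ℝ (Vec d)).prod (e x) := by
  have h : ∀ x, (ContinuousLinearMap.id ℝ (Vec d)).prod (e x) =
      ContinuousLinearMap.inl ℝ (Vec d) (Vec q) +
        (ContinuousLinearMap.inr ℝ (Vec d) (Vec q)).comp (e x) := fun x => by
    ext v <;> simp
  simp_rw [h]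
  exact continuous_const.add (continuous_const.clm_comp he)

/-- The action of `Φ` on derivatives: if `s` has derivative `e`, then `Φ(s)` has derivative
`derivStep s e`. -/
noncomputable def IsRegularOn.derivStep (hM : M.IsRegularOn K) (x : Fin p → ℝ)
    (s : NonnegFun K q) (e : C(K, Vec d →L[ℝ] Vec q)) : C(K, Vec d →L[ℝ] Vec q) where
  toFun θ := (hM.grad x s θ).comp ((ContinuousLinearMap.id ℝ (Vec d)).prod (e θ))
  continuous_toFun := by
    exact (hM.grad x s).continuous.clm_comp (continuous_id_prod e.continuous)

theorem continuous_subtype_eval : Continuous fun z : NonnegFun K q × K => z.1.1 z.2 := by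
  have : Continuous fun z : C(K, Vec q) × K => z.1 z.2 := continuous_eval
  exact this.comp (by fun_prop : Continuous fun z : NonnegFun K q × K => (z.1.1, z.2))

theorem IsRegularOn.continuous_Phi (hM : M.IsRegularOn K) (x : Fin p → ℝ) :
    Continuous (hM.Phi x) := by
  refine Continuous.subtype_mk (ContinuousMap.continuous_of_continuous_uncurry _ ?_) _
  exact (hM.c1_psi x).1.comp_continuous
    (f := fun z : NonnegFun K q × K => ((z.2 : Vec d), z.1.1 z.2))
    ((continuous_subtype_val.comp continuous_snd).prodMk continuous_subtype_eval)
    fun z => ⟨z.2.2, z.1.2 z.2⟩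

theorem IsRegularOn.continuous_grad (hM : M.IsRegularOn K) (x : Fin p → ℝ) :
    Continuous (hM.grad x) := by
  refine ContinuousMap.continuous_of_continuous_uncurry _ ?_
  exact ((hM.c1_psi x).continuousOn_derivOn hM.prod_subset_closure_interior).comp_continuous
    (f := fun z : NonnegFun K q × K => ((z.2 : Vec d), z.1.1 z.2))
    ((continuous_subtype_val.comp continuous_snd).prodMk continuous_subtype_eval)
    fun z => ⟨z.2.2, z.1.2 z.2⟩

/-- A Carathéodory argument: the map is continuous in the function and measurable in the
observations, which gives joint measurability. -/
theorem IsRegularOn.measurable_Phi (hM : M.IsRegularOn K) :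
    Measurable fun z : NonnegFun K q × (Fin p → ℝ) => hM.Phi z.2 z.1 := by
  refine measurable_uncurry_of_continuous_of_measurable
    (u := fun (s : NonnegFun K q) (x : Fin p → ℝ) => hM.Phi x s) hM.continuous_Phi fun s => ?_
  refine Measurable.subtype_mk (measurable_continuousMap_of_eval fun θ => ?_)
  exact hM.measurable_psi ⟨θ.2, s.2 θ⟩

theorem IsRegularOn.measurable_grad (hM : M.IsRegularOn K) :
    Measurable fun z : NonnegFun K q × (Fin p → ℝ) => hM.grad z.2 z.1 := by
  refine measurable_uncurry_of_continuous_of_measurable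
    (u := fun (s : NonnegFun K q) (x : Fin p → ℝ) => hM.grad x s) hM.continuous_grad fun s => ?_
  refine measurable_continuousMap_of_eval fun θ => measurable_clm_of_apply fun v => ?_
  exact measurable_derivOn_apply hM.prod_subset_closure_interior hM.c1_psi
    (fun z hz => hM.measurable_psi hz) ⟨θ.2, s.2 θ⟩ v

attribute [irreducible] IsRegularOn.grad

theorem IsRegularOn.measurable_grad_comp (hM : M.IsRegularOn K) {Ω : Type*} [MeasurableSpace Ω]
    {s : Ω → NonnegFun K q} {x : Ω → Fin p → ℝ} (hs : Measurable s) (hx : Measurable x) :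
    Measurable fun ω => hM.grad (x ω) (s ω) :=
  hM.measurable_grad.comp (hs.prodMk hx)

theorem continuous_comp_id_prod :
    Continuous fun z : C(K, Vec d × Vec q →L[ℝ] Vec q) × C(K, Vec d →L[ℝ] Vec q) =>
      (⟨fun θ => (z.1 θ).comp ((ContinuousLinearMap.id ℝ (Vec d)).prod (z.2 θ)), by
        exact z.1.continuous.clm_comp (continuous_id_prod z.2.continuous)⟩ :
        C(K, Vec d →L[ℝ] Vec q)) := by
  refine ContinuousMap.continuous_of_continuous_uncurry _ ?_
  have h1 : Continuous fun y : (C(K, Vec d × Vec q →L[ℝ] Vec q) × C(K, Vec d →L[ℝ] Vec q)) × K =>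
      y.1.1 y.2 := by fun_prop
  have h2 : Continuous fun y : (C(K, Vec d × Vec q →L[ℝ] Vec q) × C(K, Vec d →L[ℝ] Vec q)) × K =>
      y.1.2 y.2 := by fun_prop
  exact h1.clm_comp (continuous_id_prod h2)

/-- `Φ_t` as a function of the path of the observations. -/
noncomputable def IsRegularOn.pathPhi (hM : M.IsRegularOn K) (x : ℤ → ℝ) (t : ℤ) :
    NonnegFun K q → NonnegFun K q :=
  hM.Phi fun i => x (t - (i : ℕ))

/-- The limit of the backward iterates of `Φ` started in `o`. -/
noncomputable def IsRegularOn.limitSol (hM : M.IsRegularOn K) (o : NonnegFun K q) (x : ℤ → ℝ)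
    (t : ℤ) : NonnegFun K q :=
  limUnder atTop fun n : ℕ => forwardIterate (hM.pathPhi x) (t - n) n o

/-- The derivative recursion along the sequence `h`. -/
noncomputable def IsRegularOn.pathStep (hM : M.IsRegularOn K) (x : ℤ → ℝ) (h : ℤ → NonnegFun K q)
    (t : ℤ) : C(K, Vec d →L[ℝ] Vec q) → C(K, Vec d →L[ℝ] Vec q) :=
  hM.derivStep (fun i => x (t - (i : ℕ))) (h t)

/-- The limit of the backward iterates of the derivative recursion along `limitSol`. -/
noncomputable def IsRegularOn.limitDeriv (hM : M.IsRegularOn K) (o : NonnegFun K q) (x : ℤ → ℝ)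
    (t : ℤ) : C(K, Vec d →L[ℝ] Vec q) :=
  limUnder atTop fun n : ℕ => forwardIterate (hM.pathStep x (hM.limitSol o x)) (t - n) n 0

section Measurability

variable {Ω : Type*} [MeasurableSpace Ω] {Y : ℤ → Ω → ℝ}

theorem measurable_lags (n : ℕ) {t : ℤ} (hY : ∀ k ≤ t, Measurable (Y k)) :
    Measurable fun ω => (fun i => Y (t - (i : ℕ)) ω : Fin n → ℝ) :=
  measurable_pi_lambda _ fun i => hY _ (by omega)

theorem IsRegularOn.measurable_forwardIterate_pathPhi (hM : M.IsRegularOn K) {s : Ω → NonnegFun K q}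
    (hs : Measurable s) (i : ℤ) (n : ℕ) (hY : ∀ k < i + n, Measurable (Y k)) :
    Measurable fun ω => forwardIterate (hM.pathPhi fun t => Y t ω) i n (s ω) := by
  induction n with
  | zero => exact hs
  | succ n ih =>
    push_cast at hY
    exact hM.measurable_Phi.comp ((ih fun k hk => hY k (by omega)).prodMk
      (measurable_lags p fun k hk => hY k (by omega)))

theorem IsRegularOn.measurable_limitSol (hM : M.IsRegularOn K) (o : NonnegFun K q) {t : ℤ}
    (hY : ∀ k < t, Measurable (Y k)) :
    Measurable fun ω => hM.limitSol o (fun t => Y t ω) t :=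
  measurable_limUnder_of_polish fun n =>
    hM.measurable_forwardIterate_pathPhi measurable_const _ _ fun k hk => hY k (by omega)

theorem IsRegularOn.measurable_grad_limitSol (hM : M.IsRegularOn K) (o : NonnegFun K q) {t : ℤ}
    (hY : ∀ k ≤ t, Measurable (Y k)) :
    Measurable fun ω => hM.grad (fun i => Y (t - (i : ℕ)) ω) (hM.limitSol o (fun t => Y t ω) t) := by
  exact hM.measurable_grad_comp (hM.measurable_limitSol o fun k hk => hY k hk.le)
    (measurable_lags p hY)

theorem IsRegularOn.measurable_forwardIterate_pathStep (hM : M.IsRegularOn K) (o : NonnegFun K q)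
    {e : Ω → C(K, Vec d →L[ℝ] Vec q)} (he : Measurable e) (i : ℤ) (n : ℕ)
    (hY : ∀ k < i + n, Measurable (Y k)) :
    Measurable fun ω => forwardIterate
      (hM.pathStep (fun t => Y t ω) (hM.limitSol o fun t => Y t ω)) i n (e ω) := by
  induction n with
  | zero => exact he
  | succ n ih =>
    push_cast at hY
    exact continuous_comp_id_prod.measurable.comp
      ((hM.measurable_grad_limitSol o fun k hk => hY k (by omega)).prodMk
        (ih fun k hk => hY k (by omega)))

theorem IsRegularOn.measurable_limitDeriv (hM : M.IsRegularOn K) (o : NonnegFun K q) {t : ℤ}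
    (hY : ∀ k < t, Measurable (Y k)) :
    Measurable fun ω => hM.limitDeriv o (fun t => Y t ω) t :=
  measurable_limUnder_of_polish fun n =>
    hM.measurable_forwardIterate_pathStep o measurable_const _ _ fun k hk => hY k (by omega)

theorem IsRegularOn.continuous_forwardIterate_pathPhi (hM : M.IsRegularOn K) (x : ℤ → ℝ) (i : ℤ)
    (n : ℕ) : Continuous (forwardIterate (hM.pathPhi x) i n) := by
  induction n with
  | zero => exact continuous_id
  | succ n ih => exact (hM.continuous_Phi _).comp ih

/-- By continuity of the iterates, the Lipschitz constant is a supremum over countably many pairs of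
fixed functions, and each term is measurable in the path. -/
theorem IsRegularOn.measurable_lipConst_forwardIterate (hM : M.IsRegularOn K) (i : ℤ) (n : ℕ) :
    Measurable fun x : ℤ → ℝ => lipConst (forwardIterate (hM.pathPhi x) i n) := by
  simp_rw [fun x => lipConst_eq_iSup_denseSeq (hM.continuous_forwardIterate_pathPhi x i n)]
  refine Measurable.iSup fun mn => Measurable.div_const ?_ _
  have h : ∀ s : NonnegFun K q,
      Measurable fun x : ℤ → ℝ => forwardIterate (hM.pathPhi x) i n s := fun s =>
    hM.measurable_forwardIterate_pathPhi (Y := fun t (x : ℤ → ℝ) => x t) measurable_const i n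
      fun k _ => measurable_pi_apply k
  exact (h _).edist (h _)

end Measurability

section Equivariance

theorem IsRegularOn.pathPhi_shiftBy (hM : M.IsRegularOn K) (k : ℤ) (x : ℤ → ℝ) (t : ℤ) :
    hM.pathPhi (shiftBy k x) t = hM.pathPhi x (t + k) := by
  simp only [pathPhi, shiftBy]
  congr 1
  funext i
  congr 1
  ring

theorem IsRegularOn.limitSol_shiftBy (hM : M.IsRegularOn K) (o : NonnegFun K q) (k : ℤ)
    (x : ℤ → ℝ) (t : ℤ) : hM.limitSol o (shiftBy k x) t = hM.limitSol o x (t + k) := by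
  have h : hM.pathPhi (shiftBy k x) = fun t => hM.pathPhi x (t + k) :=
    funext fun t => hM.pathPhi_shiftBy k x t
  simp only [limitSol, h, forwardIterate_shift]
  congr 1
  funext n
  rw [show t - n + k = t + k - n by ring]

theorem IsRegularOn.pathStep_shiftBy (hM : M.IsRegularOn K) (k : ℤ) (x : ℤ → ℝ)
    (h : ℤ → NonnegFun K q) (t : ℤ) :
    hM.pathStep (shiftBy k x) (fun s => h (s + k)) t = hM.pathStep x h (t + k) := by
  simp only [pathStep, shiftBy]
  congr 1
  funext i
  congr 1
  ring

theorem IsRegularOn.limitDeriv_shiftBy (hM : M.IsRegularOn K) (o : NonnegFun K q) (k : ℤ)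
    (x : ℤ → ℝ) (t : ℤ) : hM.limitDeriv o (shiftBy k x) t = hM.limitDeriv o x (t + k) := by
  have h : hM.pathStep (shiftBy k x) (hM.limitSol o (shiftBy k x)) =
      fun t => hM.pathStep x (hM.limitSol o x) (t + k) := by
    funext t
    rw [← hM.pathStep_shiftBy]
    congr 1
    exact funext fun t => hM.limitSol_shiftBy o k x t
  simp only [limitDeriv, h, forwardIterate_shift]
  congr 1
  funext n
  rw [show t - n + k = t + k - n by ring]

end Equivariance

/-! ### Differentiating the recursion -/

/-- `s` has derivative `e` in the interior of `K`. -/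
def HasDerivInterior (K : TopologicalSpace.Compacts (Vec d)) (s : C(K, Vec q))
    (e : C(K, Vec d →L[ℝ] Vec q)) : Prop :=
  ∀ θ : K, (θ : Vec d) ∈ interior (K : Set (Vec d)) → HasFDerivAt (zeroExt K s) (e θ) θ

theorem zeroExt_apply (f : K → Vec q) (θ : K) : zeroExt K f θ = f θ := by
  simp [zeroExt]

theorem subset_closure_interior (hM : M.IsRegularOn K) :
    (K : Set (Vec d)) ⊆ closure (interior (K : Set (Vec d))) := hM.closure_interior.ge

open Classical in
/-- The extension by zero of a map defined on `K`. -/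
noncomputable def extendZero {W : Type*} [Zero W] (e : K → W) (θ : Vec d) : W :=
  if h : θ ∈ K then e ⟨θ, h⟩ else 0

theorem extendZero_apply {W : Type*} [Zero W] (e : K → W) (θ : K) : extendZero e θ = e θ := by
  simp [extendZero]

theorem continuousOn_of_restrict {W : Type*} [TopologicalSpace W] {f : Vec d → W} {e : K → W}
    (he : Continuous e) (h : ∀ θ : K, f θ = e θ) : ContinuousOn f (K : Set (Vec d)) := by
  rw [continuousOn_iff_continuous_domRestrict]
  exact he.congr fun θ => (h θ).symm

theorem HasDerivInterior.isC1 {s : C(K, Vec q)} {e : C(K, Vec d →L[ℝ] Vec q)}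
    (h : HasDerivInterior K s e) : IsC1 K s := by
  refine ⟨continuousOn_of_restrict s.continuous fun θ => zeroExt_apply _ θ, extendZero e,
    continuousOn_of_restrict e.continuous fun θ => extendZero_apply _ θ, fun x hx => ?_⟩
  rw [extendZero_apply e ⟨x, interior_subset hx⟩]
  exact h ⟨x, interior_subset hx⟩ hx

theorem HasDerivInterior.derivOn_eq (hM : M.IsRegularOn K) {s : C(K, Vec q)}
    {e : C(K, Vec d →L[ℝ] Vec q)} (h : HasDerivInterior K s e) (θ : K) :
    derivOn (K : Set (Vec d)) (zeroExt K s) θ = e θ := by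
  rw [derivOn_eq_of_hasFDerivAt (D := extendZero e) (subset_closure_interior hM)
    (continuousOn_of_restrict e.continuous fun θ => extendZero_apply _ θ) (fun x hx => ?_) θ.2,
    extendZero_apply]
  rw [extendZero_apply e ⟨x, interior_subset hx⟩]
  exact h ⟨x, interior_subset hx⟩ hx

theorem hasDerivInterior_const (c : Vec q) :
    HasDerivInterior K (ContinuousMap.const K c) 0 := by
  intro θ hθ
  refine (hasFDerivAt_const c (θ : Vec d)).congr_of_eventuallyEq ?_
  filter_upwards [mem_interior_iff_mem_nhds.1 hθ] with x hx
  exact zeroExt_apply _ ⟨x, hx⟩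

/-- Uniform convergence of the derivatives and pointwise convergence of the functions allow the
limit and the derivative to be interchanged. -/
theorem HasDerivInterior.of_tendsto {s : ℕ → C(K, Vec q)} {e : ℕ → C(K, Vec d →L[ℝ] Vec q)}
    {s' : C(K, Vec q)} {e' : C(K, Vec d →L[ℝ] Vec q)} (h : ∀ n, HasDerivInterior K (s n) (e n))
    (hs : Tendsto s atTop (𝓝 s')) (he : Tendsto e atTop (𝓝 e')) : HasDerivInterior K s' e' := by
  intro θ hθ
  have hu : TendstoUniformlyOn (fun n => extendZero (e n)) (extendZero e') atTop
      (interior (K : Set (Vec d))) := by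
    rw [ContinuousMap.tendsto_iff_tendstoUniformly] at he
    intro V hV
    filter_upwards [he V hV] with n hn x hx
    have := hn ⟨x, interior_subset hx⟩
    rwa [← extendZero_apply e', ← extendZero_apply (e n)] at this
  have := hasFDerivAt_of_tendstoUniformlyOn (f := fun n => zeroExt K (s n)) (g := zeroExt K s')
    isOpen_interior hu (fun n x hx => ?_) (fun x hx => ?_) hθ
  · rwa [extendZero_apply] at this
  · rw [extendZero_apply (e n) ⟨x, interior_subset hx⟩]
    exact h n ⟨x, interior_subset hx⟩ hx
  · have hc : Continuous fun f : C(K, Vec q) => f ⟨x, interior_subset hx⟩ := by fun_prop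
    have := (hc.tendsto s').comp hs
    rw [zeroExt_apply s' ⟨x, interior_subset hx⟩]
    exact this.congr fun n => (zeroExt_apply (s n) ⟨x, interior_subset hx⟩).symm

/-- `ψ` is differentiable within `K × [0, ∞)^q`, up to the boundary of `[0, ∞)^q`, near parameters
in the interior of `K`. -/
theorem IsRegularOn.exists_hasFDerivWithinAt_psi (hM : M.IsRegularOn K) (x : Fin p → ℝ) {θ : Vec d}
    (hθ : θ ∈ interior (K : Set (Vec d))) :
    ∃ U ∈ 𝓝 θ, ∀ u ∈ orthant q, HasFDerivWithinAt (M.psi x)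
      (derivOn ((K : Set (Vec d)) ×ˢ orthant q) (M.psi x) (θ, u)) (U ×ˢ orthant q) (θ, u) := by
  obtain ⟨r, hr, hrK⟩ := Metric.nhds_basis_closedBall.mem_iff.1 (mem_interior_iff_mem_nhds.1 hθ)
  set S := (K : Set (Vec d)) ×ˢ orthant q
  -- `K` need not be convex, so it is replaced by a ball around `θ`; extending a derivative to the
  -- closure needs a convex open set.
  set B := Metric.ball θ r ×ˢ interior (orthant q) with hB
  have hBo : IsOpen B := Metric.isOpen_ball.prod isOpen_interior
  have hBc : closure B = Metric.closedBall θ r ×ˢ orthant q := by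
    rw [hB, closure_prod_eq, closure_ball θ hr.ne', closure_interior_orthant]
  have hBS : closure B ⊆ S := by
    rw [hBc]
    exact Set.prod_mono hrK le_rfl
  have hBi : B ⊆ interior S := interior_maximal (subset_closure.trans hBS) hBo
  have hsub := hM.prod_subset_closure_interior
  have hder : ∀ z ∈ B, HasFDerivAt (M.psi x) (derivOn S (M.psi x) z) z := fun z hz =>
    (hM.c1_psi x).hasFDerivAt_derivOn hsub (hBi hz)
  refine ⟨Metric.ball θ r, Metric.ball_mem_nhds θ hr, fun u hu => ?_⟩
  have hmem : (θ, u) ∈ S := ⟨interior_subset hθ, hu⟩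
  have key := hasFDerivWithinAt_closure_of_tendsto_fderiv (f := M.psi x) (s := B) (x := (θ, u))
    (f' := derivOn S (M.psi x) (θ, u))
    (fun z hz => (hder z hz).differentiableAt.differentiableWithinAt)
    ((convex_ball θ r).prod (convex_orthant q).interior) hBo
    (fun z hz => ((hM.c1_psi x).1 z (hBS hz)).mono (subset_closure.trans hBS)) ?_
  · refine key.mono ?_
    rw [hBc]
    exact Set.prod_mono Metric.ball_subset_closedBall le_rfl
  · have h1 := (((hM.c1_psi x).continuousOn_derivOn hsub) (θ, u) hmem).tendsto.mono_left
      (nhdsWithin_mono (θ, u) (subset_closure.trans hBS))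
    refine h1.congr' ?_
    filter_upwards [self_mem_nhdsWithin] with z hz
    exact (hder z hz).fderiv.symm

/-- The chain rule. The values of `s` may lie on the boundary of the orthant, where `ψ` is
differentiable only within a set; this is enough, since the graph of `s` near `θ` stays in that set.
-/
theorem HasDerivInterior.derivStep (hM : M.IsRegularOn K) (x : Fin p → ℝ) {s : NonnegFun K q}
    {e : C(K, Vec d →L[ℝ] Vec q)} (h : HasDerivInterior K s.1 e) :
    HasDerivInterior K (hM.Phi x s).1 (hM.derivStep x s e) := by
  intro θ hθ
  obtain ⟨U, hU, hψ⟩ := hM.exists_hasFDerivWithinAt_psi x hθ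
  have hKn := mem_interior_iff_mem_nhds.1 hθ
  have hf : HasFDerivAt (fun y => (y, zeroExt K s.1 y))
      ((ContinuousLinearMap.id ℝ (Vec d)).prod (e θ)) (θ : Vec d) :=
    (hasFDerivAt_id (θ : Vec d)).prodMk (h θ hθ)
  have hmaps : ∀ᶠ y in 𝓝 (θ : Vec d), (y, zeroExt K s.1 y) ∈ U ×ˢ orthant q := by
    filter_upwards [hU, hKn] with y hy hyK
    refine ⟨hy, ?_⟩
    simp only
    rw [zeroExt_apply s.1 ⟨y, hyK⟩]
    exact s.2 _
  have hcomp := (hψ (s.1 θ) (s.2 θ)).comp_hasFDerivAt_of_eq (θ : Vec d) hf hmaps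
    (by rw [zeroExt_apply])
  have heq : (hM.derivStep x s e) θ = (derivOn ((K : Set (Vec d)) ×ˢ orthant q) (M.psi x)
      (θ, s.1 θ)).comp ((ContinuousLinearMap.id ℝ (Vec d)).prod (e θ)) := by
    rw [← hM.grad_apply]
    rfl
  rw [heq]
  refine hcomp.congr_of_eventuallyEq ?_
  filter_upwards [hKn] with y hy
  rw [zeroExt_apply _ ⟨y, hy⟩, Function.comp_apply, zeroExt_apply s.1 ⟨y, hy⟩]
  rfl

theorem HasDerivInterior.forwardIterate (hM : M.IsRegularOn K) (x : ℤ → ℝ)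
    (h : ℤ → NonnegFun K q) (i : ℤ) (hh : ∀ m : ℕ, h (i + m + 1) = hM.pathPhi x (i + m) (h (i + m)))
    {e : C(K, Vec d →L[ℝ] Vec q)} (he : HasDerivInterior K (h i).1 e) (n : ℕ) :
    HasDerivInterior K (h (i + n)).1 (forwardIterate (hM.pathStep x h) i n e) := by
  induction n with
  | zero => simpa using he
  | succ n ih =>
    have := ih.derivStep hM fun j => x (i + n - (j : ℕ))
    rw [forwardIterate_succ]
    push_cast
    rw [← add_assoc, hh]
    exact this

theorem dense_interior (hM : M.IsRegularOn K) :
    Dense {θ : K | (θ : Vec d) ∈ interior (K : Set (Vec d))} := by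
  intro θ
  obtain ⟨w, hw, hlim⟩ := mem_closure_iff_seq_limit.1 (subset_closure_interior hM θ.2)
  refine mem_closure_iff_seq_limit.2 ⟨fun n => ⟨w n, interior_subset (hw n)⟩, hw, ?_⟩
  exact tendsto_subtype_rng.2 hlim

theorem derivStep_apply (hM : M.IsRegularOn K) (x : Fin p → ℝ) (s : NonnegFun K q)
    (e : C(K, Vec d →L[ℝ] Vec q)) (θ : K) :
    hM.derivStep x s e θ =
      (hM.grad x s θ).comp ((ContinuousLinearMap.id ℝ (Vec d)).prod (e θ)) := rfl

/-- The step is affine in `e`: the parameter derivative cancels in a difference and only the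
derivative in `u` survives. -/
theorem derivStep_sub (hM : M.IsRegularOn K) (x : Fin p → ℝ) (s : NonnegFun K q)
    (e e' : C(K, Vec d →L[ℝ] Vec q)) (θ : K) :
    hM.derivStep x s e θ - hM.derivStep x s e' θ =
      ((hM.grad x s θ).comp (ContinuousLinearMap.inr ℝ (Vec d) (Vec q))).comp (e θ - e' θ) := by
  refine ContinuousLinearMap.ext fun v => ?_
  change hM.grad x s θ (v, e θ v) - hM.grad x s θ (v, e' θ v) =
    hM.grad x s θ (0, e θ v - e' θ v)
  rw [← map_sub, Prod.mk_sub_mk, sub_self]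

theorem forwardIterate_pathPhi_apply (hM : M.IsRegularOn K) (x : ℤ → ℝ) (i : ℤ) (n : ℕ)
    (s : NonnegFun K q) (θ : K) : (forwardIterate (hM.pathPhi x) i n s).1 θ =
      forwardIterate (fun t u => M.psi (fun j => x (t - (j : ℕ))) (θ, u)) i n (s.1 θ) := by
  induction n with
  | zero => rfl
  | succ n ih =>
    rw [forwardIterate_succ, forwardIterate_succ, ← ih]
    rfl

/-- At parameters in the interior of `K`, the iterated derivative recursion is given by the
derivative of the iterates of `u ↦ ψ(θ, u)`. -/
theorem exists_jacobian (hM : M.IsRegularOn K) (x : ℤ → ℝ) (h : ℤ → NonnegFun K q) (i : ℤ)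
    (hh : ∀ m : ℕ, h (i + m + 1) = hM.pathPhi x (i + m) (h (i + m))) {θ : K}
    (hθ : (θ : Vec d) ∈ interior (K : Set (Vec d))) (n : ℕ) :
    ∃ J : Vec q → Vec q →L[ℝ] Vec q, ContinuousOn J (orthant q) ∧
      (∀ u ∈ orthant q, HasFDerivWithinAt
        (forwardIterate (fun t u => M.psi (fun j => x (t - (j : ℕ))) (θ, u)) i n)
        (J u) (orthant q) u) ∧
      ∀ e e', forwardIterate (hM.pathStep x h) i n e θ - forwardIterate (hM.pathStep x h) i n e' θ =
        (J ((h i).1 θ)).comp (e θ - e' θ) := by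
  induction n with
  | zero =>
    exact ⟨fun _ => ContinuousLinearMap.id ℝ (Vec q), continuousOn_const,
      fun u _ => (hasFDerivAt_id u).hasFDerivWithinAt, fun e e' => by simp⟩
  | succ n ih =>
    obtain ⟨J, hJc, hJd, hJe⟩ := ih
    set F := forwardIterate (fun t u => M.psi (fun j => x (t - (j : ℕ))) ((θ : Vec d), u)) i n with hF
    set y : Fin p → ℝ := fun j => x (i + n - (j : ℕ))
    set S := (K : Set (Vec d)) ×ˢ orthant q
    have hmaps : ∀ u ∈ orthant q, F u ∈ orthant q := fun u hu => by
      have := (forwardIterate (hM.pathPhi x) i n (constFun K ⟨u, hu⟩)).2 θ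
      rwa [forwardIterate_pathPhi_apply] at this
    have horb : (h (i + n)).1 θ = F ((h i).1 θ) := by
      rw [hF, ← forwardIterate_pathPhi_apply hM]
      congr 2
      clear_value F y
      clear hJe hJd hmaps hF
      induction n with
      | zero => simp
      | succ n ihn =>
        rw [forwardIterate_succ, ← ihn, ← hh]
        push_cast
        rw [add_assoc]
    obtain ⟨U, hU, hψ⟩ := hM.exists_hasFDerivWithinAt_psi y hθ
    refine ⟨fun u => ((derivOn S (M.psi y) (θ, F u)).comp
      (ContinuousLinearMap.inr ℝ (Vec d) (Vec q))).comp (J u), ?_, fun u hu => ?_, fun e e' => ?_⟩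
    · have hFc : ContinuousOn F (orthant q) := fun u hu => (hJd u hu).continuousWithinAt
      have h1 : ContinuousOn (fun u => derivOn S (M.psi y) ((θ : Vec d), F u)) (orthant q) :=
        ((hM.c1_psi y).continuousOn_derivOn hM.prod_subset_closure_interior).comp
          (continuousOn_const.prodMk hFc) fun u hu => ⟨θ.2, hmaps u hu⟩
      exact (h1.clm_comp continuousOn_const).clm_comp hJc
    · have h1 : HasFDerivWithinAt (fun u : Vec q => ((θ : Vec d), u))
          (ContinuousLinearMap.inr ℝ (Vec d) (Vec q)) (orthant q) (F u) :=
        (hasFDerivAt_prodMk_right (θ : Vec d) (F u)).hasFDerivWithinAt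
      have h2 := (hψ (F u) (hmaps u hu)).comp (F u) h1 fun v hv => ⟨mem_of_mem_nhds hU, hv⟩
      exact h2.comp u (hJd u hu) hmaps
    · rw [forwardIterate_succ, forwardIterate_succ]
      refine (derivStep_sub hM _ _ _ _ θ).trans ?_
      rw [hJe, hM.grad_apply, horb]
      rfl

/-- The derivative recursion contracts at least as much as the iterates of `Φ`. -/
theorem dist_forwardIterate_pathStep_le (hM : M.IsRegularOn K) (x : ℤ → ℝ) (h : ℤ → NonnegFun K q)
    (i : ℤ) (hh : ∀ m : ℕ, h (i + m + 1) = hM.pathPhi x (i + m) (h (i + m))) (n : ℕ) {L : ℝ}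
    (hL0 : 0 ≤ L) (hL : ∀ s s' : NonnegFun K q, dist (forwardIterate (hM.pathPhi x) i n s)
      (forwardIterate (hM.pathPhi x) i n s') ≤ L * dist s s') (e e' : C(K, Vec d →L[ℝ] Vec q)) :
    dist (forwardIterate (hM.pathStep x h) i n e) (forwardIterate (hM.pathStep x h) i n e') ≤
      L * dist e e' := by
  rw [ContinuousMap.dist_le (by positivity)]
  set f := forwardIterate (hM.pathStep x h) i n e
  set f' := forwardIterate (hM.pathStep x h) i n e'
  -- Jacobians are available for parameters in the interior of `K` only; the estimate passes to the
  -- remaining ones by density.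
  have hcl : IsClosed {θ : K | dist (f θ) (f' θ) ≤ L * dist e e'} :=
    isClosed_le (by fun_prop) continuous_const
  suffices hint : {θ : K | (θ : Vec d) ∈ interior (K : Set (Vec d))} ⊆
      {θ : K | dist (f θ) (f' θ) ≤ L * dist e e'} from fun θ =>
    closure_minimal hint hcl (dense_interior hM θ)
  intro θ hθ
  obtain ⟨J, hJc, hJd, hJe⟩ := exists_jacobian hM x h i hh hθ n
  set F := forwardIterate (fun t u => M.psi (fun j => x (t - (j : ℕ))) ((θ : Vec d), u)) i n
  -- Testing the Lipschitz bound for iterates of `Φ` on constant functions bounds the iterates of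
  -- `ψ(θ, ·)` at each fixed `θ`.
  have hlip : ∀ u ∈ orthant q, ∀ v ∈ orthant q, ‖F u - F v‖ ≤ L * ‖u - v‖ := by
    intro u hu v hv
    have h1 := hL (constFun K ⟨u, hu⟩) (constFun K ⟨v, hv⟩)
    have h2 : dist (constFun K ⟨u, hu⟩) (constFun K ⟨v, hv⟩) ≤ dist u v :=
      (ContinuousMap.dist_le dist_nonneg).2 fun _ => le_rfl
    have h3 := (ContinuousMap.dist_apply_le_dist (f := (forwardIterate (hM.pathPhi x) i n
      (constFun K ⟨u, hu⟩)).1) (g := (forwardIterate (hM.pathPhi x) i n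
      (constFun K ⟨v, hv⟩)).1) θ).trans (h1.trans (mul_le_mul_of_nonneg_left h2 hL0))
    rw [forwardIterate_pathPhi_apply, forwardIterate_pathPhi_apply, dist_eq_norm, dist_eq_norm] at h3
    exact h3
  have hJint : ∀ u ∈ interior (orthant q), ‖J u‖ ≤ L := by
    intro u hu
    have hn := mem_interior_iff_mem_nhds.1 hu
    refine ((hJd u (interior_subset hu)).hasFDerivAt hn).le_of_lip' hL0 ?_
    filter_upwards [hn] with v hv using hlip v hv u (interior_subset hu)
  -- A Lipschitz bound controls the derivative at interior points; the values of `h` may lie on the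
  -- boundary, which is reached by continuity of `J`.
  have hJle : ∀ u ∈ orthant q, ‖J u‖ ≤ L := by
    intro u hu
    have hu' : u ∈ closure (interior (orthant q)) := by rwa [closure_interior_orthant]
    have := mem_closure_iff_nhdsWithin_neBot.1 hu'
    have hlim : Tendsto (fun v => ‖J v‖) (𝓝[interior (orthant q)] u) (𝓝 ‖J u‖) :=
      ((hJc u hu).tendsto.mono_left (nhdsWithin_mono u interior_subset)).norm
    exact le_of_tendsto hlim (by filter_upwards [self_mem_nhdsWithin] with v hv using hJint v hv)
  rw [Set.mem_ofPred_eq, dist_eq_norm, hJe]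
  refine (ContinuousLinearMap.opNorm_comp_le _ _).trans ?_
  refine mul_le_mul (hJle _ ((h i).2 θ)) ?_ (norm_nonneg _) hL0
  rw [← dist_eq_norm]
  exact ContinuousMap.dist_apply_le_dist θ

end VolatilityFamily

/-! ### Coordinates and norm bounds for the derivative recursion -/

theorem euclidean_norm_le_sum {n : ℕ} (w : Vec n) : ‖w‖ ≤ ∑ j, |w j| := by
  have h : w = ∑ j, w j • (EuclideanSpace.single j (1 : ℝ) : Vec n) := by
    ext i
    simp [Pi.single_apply]
  conv_lhs => rw [h]
  refine (norm_sum_le _ _).trans (Finset.sum_le_sum fun j _ => ?_)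
  rw [norm_smul]
  simp

/-- The operator norm is bounded by the sum of the absolute values of the matrix entries. -/
theorem clm_norm_le_sum {n m : ℕ} (A : Vec n →L[ℝ] Vec m) :
    ‖A‖ ≤ ∑ j, ∑ k, |A (EuclideanSpace.single k 1) j| := by
  refine ContinuousLinearMap.opNorm_le_bound _
    (Finset.sum_nonneg fun _ _ => Finset.sum_nonneg fun _ _ => abs_nonneg _) fun v => ?_
  have h : v = ∑ k, v k • (EuclideanSpace.single k (1 : ℝ) : Vec n) := by
    ext i
    simp [Pi.single_apply]
  refine (euclidean_norm_le_sum _).trans ?_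
  rw [Finset.sum_mul]
  refine Finset.sum_le_sum fun j _ => ?_
  have hj : A v j = ∑ k, v k * A (EuclideanSpace.single k 1) j := by
    conv_lhs => rw [h, map_sum]
    simp
  rw [hj, Finset.sum_mul]
  refine (Finset.abs_sum_le_sum_abs _ _).trans (Finset.sum_le_sum fun k _ => ?_)
  rw [abs_mul, mul_comm]
  gcongr
  exact PiLp.norm_apply_le v k

/-- Linear maps `ℝᵈ → ℝ^q` as vectors of partial derivatives. -/
noncomputable def derivEquiv (d q : ℕ) : (Vec d →L[ℝ] Vec q) ≃L[ℝ] DerivVec d q :=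
  LinearEquiv.toContinuousLinearEquiv
    { toFun := fun A => WithLp.toLp 2 fun jk => A (EuclideanSpace.single jk.2 1) jk.1
      map_add' := fun A B => by ext jk; simp
      map_smul' := fun c A => by ext jk; simp
      invFun := fun w => ∑ k : Fin d, (ContinuousLinearMap.toSpanSingleton ℝ
        (WithLp.toLp 2 fun j => w (j, k) : Vec q)).comp (EuclideanSpace.proj k)
      left_inv := fun A => by
        ext v j
        have h : v = ∑ k, v k • (EuclideanSpace.single k (1 : ℝ) : Vec d) := by
          ext i
          simp [Pi.single_apply]
        conv_rhs => rw [h, map_sum]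
        simp
      right_inv := fun w => by
        ext jk
        simp }

theorem derivEquiv_apply {d q : ℕ} (A : Vec d →L[ℝ] Vec q) (j : Fin q) (k : Fin d) :
    derivEquiv d q A (j, k) = A (EuclideanSpace.single k 1) j := rfl

namespace VolatilityFamily

variable {d p q : ℕ} {M : VolatilityFamily d p q} {K : TopologicalSpace.Compacts (Vec d)}

theorem grad_direction (hM : M.IsRegularOn K) (x : Fin p → ℝ) (s : NonnegFun K q) (θ : K)
    (j : Fin q) (k : Fin d ⊕ Fin q) :
    hM.grad x s θ (direction k) j = M.dpsi K x j k θ (s.1 θ) := by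
  rw [hM.grad_apply]
  rfl

/-- In coordinates, the operator form of the step is exactly the linear recursion for `d`, so
solving one is solving the other. -/
theorem derivEquiv_derivStep (hM : M.IsRegularOn K) (x : Fin p → ℝ) (s : NonnegFun K q)
    (e : C(K, Vec d →L[ℝ] Vec q)) (θ : K) (j : Fin q) (k : Fin d) :
    derivEquiv d q (hM.derivStep x s e θ) (j, k) = M.dpsi K x j (Sum.inl k) θ (s.1 θ) +
      ∑ i : Fin q, M.dpsi K x j (Sum.inr i) θ (s.1 θ) * derivEquiv d q (e θ) (i, k) := by
  simp_rw [← grad_direction hM, derivEquiv_apply, derivStep_apply]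
  set G := hM.grad x s θ
  set w := e θ (EuclideanSpace.single k 1) with hw
  have h : ((EuclideanSpace.single k 1 : Vec d), w) =
      direction (Sum.inl k) + ∑ i, w i • direction (d := d) (Sum.inr i) := by
    have : w = ∑ i, w i • (EuclideanSpace.single i (1 : ℝ) : Vec q) := by
      ext i
      simp [Pi.single_apply]
    refine Prod.ext ?_ ?_
    · simp [direction, Prod.fst_sum]
    · simp only [direction, Sum.elim_inl, Sum.elim_inr, Prod.snd_add, zero_add, Prod.snd_sum,
        Prod.smul_snd]
      exact this
  change G (EuclideanSpace.single k 1, w) j = _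
  rw [h, map_add, map_sum]
  simp [mul_comm]

theorem norm_comp_inl_le (T : Vec d × Vec q →L[ℝ] Vec q) :
    ‖T.comp (ContinuousLinearMap.inl ℝ (Vec d) (Vec q))‖ ≤
      ∑ j, ∑ k : Fin d, |T (direction (Sum.inl k)) j| :=
  clm_norm_le_sum _

theorem norm_comp_inr_le (T : Vec d × Vec q →L[ℝ] Vec q) :
    ‖T.comp (ContinuousLinearMap.inr ℝ (Vec d) (Vec q))‖ ≤
      ∑ j, ∑ k : Fin q, |T (direction (Sum.inr k)) j| :=
  clm_norm_le_sum _

theorem norm_comp_id_prod_le (T : Vec d × Vec q →L[ℝ] Vec q) (A : Vec d →L[ℝ] Vec q) :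
    ‖T.comp ((ContinuousLinearMap.id ℝ (Vec d)).prod A)‖ ≤
      ∑ j, ∑ k : Fin d, |T (direction (Sum.inl k)) j| +
        (∑ j, ∑ k : Fin q, |T (direction (Sum.inr k)) j|) * ‖A‖ := by
  have h : T.comp ((ContinuousLinearMap.id ℝ (Vec d)).prod A) =
      T.comp (ContinuousLinearMap.inl ℝ (Vec d) (Vec q)) +
        (T.comp (ContinuousLinearMap.inr ℝ (Vec d) (Vec q))).comp A := by
    refine ContinuousLinearMap.ext fun v => ?_
    change T (v, A v) = T (v, 0) + T (0, A v)
    rw [← map_add]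
    simp
  rw [h]
  refine (norm_add_le _ _).trans (add_le_add (norm_comp_inl_le T) ?_)
  refine (ContinuousLinearMap.opNorm_comp_le _ _).trans ?_
  gcongr
  exact norm_comp_inr_le T

/-- At `e = 0` only the parameter derivatives remain. The bound measures the one-step displacement
of the starting point of the backward iteration. -/
theorem norm_derivStep_zero_le (hM : M.IsRegularOn K) (x : Fin p → ℝ) (s : NonnegFun K q)
    {a : Fin q → Fin d → ℝ} (ha0 : ∀ j k, 0 ≤ a j k)
    (ha : ∀ j k, ∀ θ : K, |M.dpsi K x j (Sum.inl k) θ (s.1 θ)| ≤ a j k) :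
    ‖hM.derivStep x s 0‖ ≤ ∑ j, ∑ k, a j k := by
  rw [ContinuousMap.norm_le _ (Finset.sum_nonneg fun j _ => Finset.sum_nonneg fun k _ => ha0 j k)]
  intro θ
  rw [derivStep_apply]
  refine (norm_comp_id_prod_le _ _).trans ?_
  simp only [ContinuousMap.zero_apply, norm_zero, mul_zero, add_zero]
  refine Finset.sum_le_sum fun j _ => Finset.sum_le_sum fun k _ => ?_
  rw [grad_direction]
  exact ha j k θ

/-- Hölder continuity of the partial derivatives bounds the dependence of the derivative step on
the base function. -/
theorem dist_derivStep_le (hM : M.IsRegularOn K) (x : Fin p → ℝ) (s s' : NonnegFun K q)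
    (e : C(K, Vec d →L[ℝ] Vec q)) {c κ : ℝ} (hc : 0 ≤ c) (hκ : 0 ≤ κ)
    (hH : ∀ (j : Fin q) (k : Fin d ⊕ Fin q), ∀ u ∈ orthant q, ∀ u' ∈ orthant q, ∀ θ ∈ K,
      |M.dpsi K x j k θ u - M.dpsi K x j k θ u'| ≤ c * ‖u - u'‖ ^ κ) :
    dist (hM.derivStep x s e) (hM.derivStep x s' e) ≤
      ((q * d + q * q : ℕ) : ℝ) * c * dist s s' ^ κ * (1 + ‖e‖) := by
  rw [ContinuousMap.dist_le (by positivity)]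
  intro θ
  rw [dist_eq_norm, derivStep_apply, derivStep_apply, ← ContinuousLinearMap.sub_comp]
  refine (norm_comp_id_prod_le _ _).trans ?_
  have hb : ∀ j k, |(hM.grad x s θ - hM.grad x s' θ) (direction k) j| ≤ c * dist s s' ^ κ := by
    intro j k
    have h1 : (hM.grad x s θ - hM.grad x s' θ) (direction k) j =
        M.dpsi K x j k θ (s.1 θ) - M.dpsi K x j k θ (s'.1 θ) := by
      rw [← grad_direction hM, ← grad_direction hM]
      rfl
    rw [h1]
    refine (hH j k _ (s.2 θ) _ (s'.2 θ) θ θ.2).trans ?_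
    gcongr
    rw [← dist_eq_norm]
    exact ContinuousMap.dist_apply_le_dist (f := s.1) (g := s'.1) θ
  set b := c * dist s s' ^ κ
  have hb0 : 0 ≤ b := by positivity
  have h1 : ∑ j, ∑ k : Fin d, |(hM.grad x s θ - hM.grad x s' θ) (direction (Sum.inl k)) j| ≤
      (q * d : ℕ) * b := by
    refine (Finset.sum_le_sum fun j _ => Finset.sum_le_sum fun k _ => hb j (Sum.inl k)).trans ?_
    simp [mul_assoc]
  have h2 : ∑ j, ∑ k : Fin q, |(hM.grad x s θ - hM.grad x s' θ) (direction (Sum.inr k)) j| ≤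
      (q * q : ℕ) * b := by
    refine (Finset.sum_le_sum fun j _ => Finset.sum_le_sum fun k _ => hb j (Sum.inr k)).trans ?_
    simp [mul_assoc]
  have h3 : ‖e θ‖ ≤ ‖e‖ := e.norm_coe_le_norm θ
  calc _ ≤ (q * d : ℕ) * b + (q * q : ℕ) * b * ‖e‖ := by gcongr
    _ ≤ ((q * d : ℕ) * b + (q * q : ℕ) * b) * (1 + ‖e‖) := by
        have : 0 ≤ ((q * d : ℕ) : ℝ) * b * ‖e‖ := by positivity
        have : 0 ≤ ((q * q : ℕ) : ℝ) * b := by positivity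
        nlinarith
    _ = _ := by push_cast; ring

theorem dist_zero_derivFun (e : C(K, Vec d →L[ℝ] Vec q)) : dist e 0 = ‖e‖ :=
  (dist_eq_norm e 0).trans (congrArg norm (sub_zero e))

/-! ### The derivative recursion on a single contracting path -/

section GoodPath

variable (hM : M.IsRegularOn K) {x : ℤ → ℝ} {o : NonnegFun K q} {ε : ℝ}

theorem limitSol_tendsto (hc : ContractsExp (hM.pathPhi x) ε) (hε : 0 < ε)
    (ho : Subexponential fun t => dist (hM.pathPhi x t o) o) (t : ℤ) :
    Tendsto (fun n : ℕ => forwardIterate (hM.pathPhi x) (t - n) n o) atTop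
      (𝓝 (hM.limitSol o x t)) :=
  tendsto_nhds_limUnder (hc.tendsto_backward hε ho t)

/-- The derivative recursion inherits the rate and the constants of `Φ`; no separate contraction
hypothesis on the partial derivatives is needed. -/
theorem contractsExp_pathStep (hc : ContractsExp (hM.pathPhi x) ε) {h : ℤ → NonnegFun K q}
    (hh : ∀ t, h (t + 1) = hM.pathPhi x t (h t)) : ContractsExp (hM.pathStep x h) ε := by
  intro δ hδ
  obtain ⟨C, hC, hCφ⟩ := hc δ hδ
  exact ⟨C, hC, fun i n => dist_forwardIterate_pathStep_le hM x h i (fun m => hh _) n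
    (by positivity) (hCφ i n)⟩

theorem limitDeriv_tendsto (hc : ContractsExp (hM.pathPhi x) ε) (hε : 0 < ε)
    (hh : ∀ t, hM.limitSol o x (t + 1) = hM.pathPhi x t (hM.limitSol o x t))
    (hd : Subexponential fun t => ‖hM.pathStep x (hM.limitSol o x) t 0‖) (t : ℤ) :
    Tendsto (fun n : ℕ => forwardIterate (hM.pathStep x (hM.limitSol o x)) (t - n) n 0) atTop
      (𝓝 (hM.limitDeriv o x t)) :=
  tendsto_nhds_limUnder ((contractsExp_pathStep hM hc hh).tendsto_backward hε
    (hd.mono fun _ => (dist_zero_derivFun _).le) t)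

/-- The orbit of `o` started at time `i`. -/
noncomputable def IsRegularOn.orbitFrom (o : NonnegFun K q) (x : ℤ → ℝ) (i t : ℤ) :
    NonnegFun K q :=
  forwardIterate (hM.pathPhi x) i (t - i).toNat o

theorem orbitFrom_add (i : ℤ) (n : ℕ) :
    hM.orbitFrom o x i (i + n) = forwardIterate (hM.pathPhi x) i n o := by
  simp [IsRegularOn.orbitFrom]

theorem orbitFrom_succ (i : ℤ) (n : ℕ) :
    hM.orbitFrom o x i (i + n + 1) = hM.pathPhi x (i + n) (hM.orbitFrom o x i (i + n)) := by
  have := orbitFrom_add hM (o := o) (x := x) i (n + 1)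
  push_cast at this
  rw [add_assoc, this, orbitFrom_add, forwardIterate_succ]

/-- The derivative of the orbit of a constant function approaches the solution of the derivative
recursion, uniformly in the starting time. -/
theorem exists_dist_deriv_orbit_le (hc : ContractsExp (hM.pathPhi x) ε) (hε : 0 < ε)
    {h : ℤ → NonnegFun K q} {e : ℤ → C(K, Vec d →L[ℝ] Vec q)}
    (hh : ∀ t, h (t + 1) = hM.pathPhi x t (h t)) (ho : Subexponential fun t => dist (h t) o)
    (he : ∀ t, e (t + 1) = hM.pathStep x h t (e t)) (he0 : Subexponential fun t => ‖e t‖)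
    {c : ℤ → ℝ} (hc0 : ∀ t, 0 ≤ c t) (hcs : Subexponential c) {κ : ℝ} (hκ0 : 0 < κ) (hκ1 : κ ≤ 1)
    (hH : ∀ t, ∀ (j : Fin q) (k : Fin d ⊕ Fin q), ∀ u ∈ orthant q, ∀ u' ∈ orthant q, ∀ θ ∈ K,
      |M.dpsi K (fun i => x (t - (i : ℕ))) j k θ u - M.dpsi K (fun i => x (t - (i : ℕ))) j k θ u'| ≤
        c t * ‖u - u'‖ ^ κ) :
    ∃ C > 0, ∀ (i : ℤ) (n : ℕ),
      dist (forwardIterate (hM.pathStep x (hM.orbitFrom o x i)) i n 0) (e (i + n)) ≤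
        C * Real.exp (-(κ * ε / 4) * n + κ * ε / 8 * |(i : ℝ)|) := by
  -- The Hölder exponent turns the decay `ε` of orbits into `κ ε` for the one-step errors, and half
  -- of this is kept as `η`. With `δ = η / 8`, the loss `2 δ` leaves a rate above `κ ε / 4` and a
  -- factor `exp (κ ε / 8 * |i|)`. The choice `δ' = δ / 3` leaves room for both occurrences of `δ'
  -- |i|` in the error.
  set η := κ * ε / 2 with hη
  have hη0 : 0 < η := by positivity
  have hηε : η ≤ ε := by nlinarith
  set δ := η / 8 with hδdef
  have hδ : 0 < δ := by positivity
  set δ' := δ / 3 with hδ'def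
  have hδ' : 0 < δ' := by positivity
  obtain ⟨C₁, hC₁, hC₁b⟩ := hc δ hδ
  obtain ⟨C₃, hC₃, hC₃b⟩ := he0 δ hδ
  obtain ⟨A, hA, hAb⟩ := hc.exists_dist_forwardIterate_le hh ho hδ'
  obtain ⟨B, hB, hBb⟩ := (((Subexponential.const 1).add he0).mul hcs hc0) (δ' ) hδ'
  -- The added one keeps `N` positive when `q = 0`.
  set N : ℝ := ((q * d + q * q : ℕ) : ℝ) + 1 with hN
  have hN0 : 0 < N := by positivity
  set C₂ := N * B * A ^ κ with hC₂def
  have hC₂ : 0 < C₂ := by positivity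
  refine ⟨C₁ * C₃ + C₁ * C₂ * Real.exp η / δ, by positivity, fun i n => ?_⟩
  -- The orbit solves the recursion from time `i` on. This suffices, as the contraction estimate
  -- looks only at times after its own start.
  have horb : ∀ m : ℕ, ∀ k : ℕ, hM.orbitFrom o x i (i + m + k + 1) =
      hM.pathPhi x (i + m + k) (hM.orbitFrom o x i (i + m + k)) := fun m k => by
    have := orbitFrom_succ hM (o := o) (x := x) i (m + k)
    push_cast at this
    rwa [← add_assoc] at this
  have hmain := dist_forwardIterate_le_exp (hM.pathStep x (hM.orbitFrom o x i)) i e 0 hηε hδ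
    hC₁ hC₂ hC₃
    (fun m n u v => dist_forwardIterate_pathStep_le hM x _ (i + m) (horb m) n (by positivity)
      (hC₁b (i + m) n) u v) (fun m => ?_) ((dist_zero_left (e i)).trans_le (hC₃b i)) n
  · refine hmain.trans ?_
    refine mul_le_mul_of_nonneg_left (Real.exp_le_exp.2 ?_) (by positivity)
    have h1 : (0 : ℝ) ≤ n := Nat.cast_nonneg n
    have h2 : 0 ≤ |(i : ℝ)| := abs_nonneg _
    have e1 : κ * ε / 4 = η / 2 := by rw [hη]; ring
    have e2 : κ * ε / 8 = η / 4 := by rw [hη]; ring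
    rw [e1, e2, hδdef]
    nlinarith
  · rw [he]
    refine (dist_derivStep_le hM _ _ _ _ (hc0 (i + m)) hκ0.le (hH (i + m))).trans ?_
    have h1 : dist (hM.orbitFrom o x i (i + m)) (h (i + m)) ^ κ ≤
        A ^ κ * Real.exp (κ * (-ε * m + δ' * |(i : ℝ)|)) := by
      rw [orbitFrom_add]
      refine (Real.rpow_le_rpow dist_nonneg (hAb i m) hκ0.le).trans (le_of_eq ?_)
      rw [Real.mul_rpow hA.le (Real.exp_pos _).le, ← Real.exp_mul, mul_comm κ]
    have h2 : (1 + ‖e (i + m)‖) * c (i + m) ≤ B * Real.exp (δ' * (|(i : ℝ)| + m)) := by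
      refine (hBb (i + m)).trans ?_
      have := abs_add_natCast_le i m
      gcongr
    calc _ = ((q * d + q * q : ℕ) : ℝ) * ((1 + ‖e (i + m)‖) * c (i + m)) *
            dist (hM.orbitFrom o x i (i + m)) (h (i + m)) ^ κ := by ring
      _ ≤ N * (B * Real.exp (δ' * (|(i : ℝ)| + m))) *
            (A ^ κ * Real.exp (κ * (-ε * m + δ' * |(i : ℝ)|))) := by
          have := hc0 (i + m)
          gcongr
          rw [hN]
          linarith
      _ = C₂ * Real.exp (δ' * (|(i : ℝ)| + m) + κ * (-ε * m + δ' * |(i : ℝ)|)) := by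
          rw [Real.exp_add, hC₂def]
          ring
      _ ≤ _ := by
          refine mul_le_mul_of_nonneg_left (Real.exp_le_exp.2 ?_) hC₂.le
          have h1 : (0 : ℝ) ≤ m := Nat.cast_nonneg m
          have h2 : 0 ≤ |(i : ℝ)| := abs_nonneg _
          have t1 : κ * (δ' * |(i : ℝ)|) ≤ δ' * |(i : ℝ)| :=
            mul_le_of_le_one_left (by positivity) hκ1
          have t2 : δ' * |(i : ℝ)| * 3 = δ * |(i : ℝ)| := by rw [hδ'def]; ring
          have t3 : κ * (ε * m) = 2 * (η * m) := by rw [hη]; ring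
          have t4 : δ' * m ≤ η * m := by
            gcongr
            rw [hδ'def, hδdef]
            linarith
          have t5 : 0 ≤ δ' * |(i : ℝ)| := by positivity
          nlinarith

/-- The stationary solution is continuously differentiable, with derivative given by the solution
of the derivative recursion. -/
theorem hasDerivInterior_limit {ς : orthant q} (hε : 0 < ε)
    {h : ℤ → NonnegFun K q} {e : ℤ → C(K, Vec d →L[ℝ] Vec q)}
    (hlim : ∀ t : ℤ, Tendsto (fun n : ℕ => forwardIterate (hM.pathPhi x) (t - n) n (constFun K ς))
      atTop (𝓝 (h t))) {κ C : ℝ} (hκ0 : 0 < κ)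
    (hb : ∀ (i : ℤ) (n : ℕ),
      dist (forwardIterate (hM.pathStep x (hM.orbitFrom (constFun K ς) x i)) i n 0) (e (i + n)) ≤
        C * Real.exp (-(κ * ε / 4) * n + κ * ε / 8 * |(i : ℝ)|)) (hC : 0 ≤ C) (t : ℤ) :
    HasDerivInterior K (h t).1 (e t) := by
  refine HasDerivInterior.of_tendsto
    (s := fun n => (forwardIterate (hM.pathPhi x) (t - n) n (constFun K ς)).1)
    (e := fun n : ℕ => forwardIterate (hM.pathStep x (hM.orbitFrom (constFun K ς) x (t - n)))
      (t - n) n 0) (fun n => ?_) ((continuous_subtype_val.tendsto _).comp (hlim t)) ?_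
  -- The orbit is a constant function at its starting time, so the derivative recursion starts from
  -- zero.
  · have h0 : HasDerivInterior K (hM.orbitFrom (constFun K ς) x (t - n) (t - n)).1 0 := by
      have := orbitFrom_add hM (o := constFun K ς) (x := x) (t - n) 0
      simp only [Nat.cast_zero, add_zero, forwardIterate_zero] at this
      rw [this]
      exact hasDerivInterior_const _
    have := h0.forwardIterate hM x _ (t - n) (orbitFrom_succ hM (t - n)) n
    rwa [orbitFrom_add] at this
  · refine (tendsto_iff_dist_tendsto_zero (α := C(K, Vec d →L[ℝ] Vec q))).2 ?_
    have hlim0 : Tendsto (fun n : ℕ => C * Real.exp (κ * ε / 8 * |(t : ℝ)|) *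
        Real.exp (-(κ * ε / 8) * n)) atTop (𝓝 0) := by
      have h1 : Tendsto (fun n : ℕ => Real.exp (-(κ * ε / 8) * n)) atTop (𝓝 0) :=
        Real.tendsto_exp_atBot.comp (tendsto_natCast_atTop_atTop.const_mul_atTop_of_neg
          (neg_lt_zero.2 (by positivity)))
      simpa using h1.const_mul (C * Real.exp (κ * ε / 8 * |(t : ℝ)|))
    refine squeeze_zero (fun n => dist_nonneg) (fun n => ?_) hlim0
    -- The starting time costs at most `exp (κ ε / 8 * (|t| + n))`, half of the decay in `n`, so
    -- `exp (-(κ ε / 8) n)` remains.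
    have h1 := hb (t - n) n
    rw [sub_add_cancel] at h1
    refine h1.trans ?_
    rw [mul_assoc, ← Real.exp_add]
    refine mul_le_mul_of_nonneg_left (Real.exp_le_exp.2 ?_) hC
    have h2 := abs_sub_natCast_le t n
    have h3 : κ * ε / 8 * |((t - n : ℤ) : ℝ)| ≤ κ * ε / 8 * (|(t : ℝ)| + n) := by gcongr
    linarith

end GoodPath

end VolatilityFamily

/-! ### Stationary sequences, factors and uniqueness -/

section StationarySequences

variable {Ω E F : Type*} [MeasurableSpace Ω] [MeasurableSpace E] [MeasurableSpace F]
  {P : Measure Ω} {v : ℤ → Ω → E}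

theorem measurable_shiftSeq : Measurable (shiftSeq : (ℤ → E) → ℤ → E) := measurable_shiftBy 1

theorem map_eval_processLaw (hv : ∀ t, AEMeasurable (v t) P) (t : ℤ) :
    (processLaw P v).map (fun y => y t) = P.map (v t) :=
  AEMeasurable.map_map_of_aemeasurable (measurable_pi_apply t).aemeasurable
    (aemeasurable_pi_lambda _ hv)

theorem IsStationarySeq.map_eq (h : IsStationarySeq P v) (t : ℤ) : P.map (v t) = P.map (v 0) := by
  have hstep : ∀ t, P.map (v (t + 1)) = P.map (v t) := fun t => by
    rw [← map_eval_processLaw h.aemeasurable t, ← h.map_shift,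
      Measure.map_map (measurable_pi_apply t) measurable_shiftSeq,
      ← map_eval_processLaw h.aemeasurable (t + 1)]
    rfl
  induction t with
  | zero => rfl
  | succ n ih => exact (hstep n).trans ih
  | pred n ih =>
    rw [← ih, ← hstep]
    congr 2
    ring

theorem IsStationarySeq.comp (h : IsStationarySeq P v) {f : E → F} (hf : Measurable f) :
    IsStationarySeq P fun t ω => f (v t ω) := by
  have hg : Measurable fun (y : ℤ → E) t => f (y t) :=
    measurable_pi_lambda _ fun t => hf.comp (measurable_pi_apply t)
  have hlaw : processLaw P (fun t ω => f (v t ω)) = (processLaw P v).map fun y t => f (y t) :=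
    (AEMeasurable.map_map_of_aemeasurable hg.aemeasurable
      (aemeasurable_pi_lambda _ h.aemeasurable)).symm
  refine ⟨fun t => hf.comp_aemeasurable (h.aemeasurable t), ?_⟩
  rw [hlaw, Measure.map_map measurable_shiftSeq hg]
  conv_rhs => rw [← h.map_shift, Measure.map_map hg measurable_shiftSeq]
  rfl

theorem IsStationaryErgodicSeq.isStationarySeq (h : IsStationaryErgodicSeq P v) :
    IsStationarySeq P v :=
  ⟨h.aemeasurable, h.ergodic.toMeasurePreserving.map_eq⟩

/-- Factors of stationary ergodic sequences are stationary and ergodic. -/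
theorem isStationaryErgodicSeq_factor {ξ : Ω → ℤ → E} (hξ : AEMeasurable ξ P)
    (hμ : Ergodic shiftSeq (P.map ξ)) {G : (ℤ → E) → ℤ → F} (hG : ∀ t, Measurable fun x => G x t)
    (hshift : ∀ x t, G (shiftSeq x) t = G x (t + 1)) :
    IsStationaryErgodicSeq P fun t ω => G (ξ ω) t := by
  have hGm : Measurable G := measurable_pi_lambda _ hG
  refine ⟨fun t => (hG t).comp_aemeasurable hξ, ?_⟩
  have hlaw : processLaw P (fun t ω => G (ξ ω) t) = (P.map ξ).map G :=
    (AEMeasurable.map_map_of_aemeasurable hGm.aemeasurable hξ).symm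
  rw [hlaw]
  exact (hGm.measurePreserving _).ergodic_of_ergodic_semiconj hμ measurable_shiftSeq
    fun x => funext fun t => hshift x t

/-- A stationary solution of a contracting stochastic recurrence equation agrees with any solution
of subexponential growth. -/
theorem ae_eq_of_isStationarySeq {E : Type*} [MetricSpace E] [MeasurableSpace E]
    [OpensMeasurableSpace E] [IsProbabilityMeasure P] {φ : Ω → ℤ → E → E} {h h' : ℤ → Ω → E}
    {o : E} {ε : ℝ} (hε : 0 < ε) (hstat : IsStationarySeq P h')
    (hc : ∀ᵐ ω ∂P, ContractsExp (φ ω) ε)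
    (hsub : ∀ᵐ ω ∂P, Subexponential fun t => dist (h t ω) o)
    (hsol : ∀ᵐ ω ∂P, ∀ t, h (t + 1) ω = φ ω t (h t ω))
    (hsol' : ∀ᵐ ω ∂P, ∀ t, h' (t + 1) ω = φ ω t (h' t ω)) (t : ℤ) : h' t =ᵐ[P] h t := by
  have hdist : Measurable fun z : E => dist z o := (continuous_id.dist continuous_const).measurable
  have hy := hstat.comp hdist
  -- Nothing is known about the growth of `h'` into the past, but its distance to `o` has the same
  -- law at all times. Convergence along one subsequence is enough, since the quantity to be bounded
  -- does not depend on `n`.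
  obtain ⟨ns, hns, hlim⟩ := exists_subseq_exp_mul_tendsto_zero (P := P)
    (y := fun n ω => dist (h' (t - n) ω) o) (fun n => hy.aemeasurable _)
    (fun n => (hy.map_eq _).trans (hy.map_eq _).symm) (half_pos hε)
  filter_upwards [hc, hsub, hsol, hsol', hlim] with ω hc hsub hsol hsol' hlim
  set δ := ε / 8 with hδdef
  have hδ : 0 < δ := by positivity
  obtain ⟨C, hC, hCφ⟩ := hc δ hδ
  obtain ⟨C', hC', hCh⟩ := hsub δ hδ
  have hbound : ∀ n : ℕ, dist (h' t ω) (h t ω) ≤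
      C * Real.exp (δ * |(t : ℝ)|) * (Real.exp (-(ε / 2) * n) * dist (h' (t - n) ω) o) +
      C * Real.exp (δ * |(t : ℝ)|) * (C' * Real.exp (δ * |(t : ℝ)|)) *
        Real.exp (-(ε / 2) * n) := by
    intro n
    have e1 := forwardIterate_eq_of_solves (φ ω) (h := fun t => h t ω) hsol (t - n) n
    have e2 := forwardIterate_eq_of_solves (φ ω) (h := fun t => h' t ω) hsol' (t - n) n
    simp only [sub_add_cancel] at e1 e2
    have habs := abs_sub_natCast_le t n
    have h1 := hCφ (t - n) n (h' (t - n) ω) (h (t - n) ω)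
    rw [e1, e2] at h1
    have h2 : dist (h' (t - n) ω) (h (t - n) ω) ≤
        dist (h' (t - n) ω) o + C' * Real.exp (δ * (|(t : ℝ)| + n)) := by
      refine (dist_triangle_right _ _ o).trans ?_
      gcongr
      exact (hCh (t - n)).trans (by gcongr)
    have hn : (0 : ℝ) ≤ n := Nat.cast_nonneg n
    calc dist (h' t ω) (h t ω)
        ≤ C * Real.exp (-ε * n + δ * (|(t : ℝ)| + n)) *
          (dist (h' (t - n) ω) o + C' * Real.exp (δ * (|(t : ℝ)| + n))) := by
          refine h1.trans (mul_le_mul ?_ h2 dist_nonneg (by positivity))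
          gcongr
      _ = C * Real.exp (δ * |(t : ℝ)|) * (Real.exp (-(ε - δ) * n) * dist (h' (t - n) ω) o) +
          C * Real.exp (δ * |(t : ℝ)|) * (C' * Real.exp (δ * |(t : ℝ)|)) *
            Real.exp (-(ε - 2 * δ) * n) := by
          have a1 : Real.exp (-ε * n + δ * (|(t : ℝ)| + n)) =
              Real.exp (δ * |(t : ℝ)|) * Real.exp (-(ε - δ) * n) := by
            rw [← Real.exp_add]
            ring_nf
          have a2 : Real.exp (δ * (|(t : ℝ)| + n)) =
              Real.exp (δ * |(t : ℝ)|) * Real.exp (δ * n) := by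
            rw [← Real.exp_add]
            ring_nf
          have a3 : Real.exp (-(ε - 2 * δ) * n) = Real.exp (-(ε - δ) * n) * Real.exp (δ * n) := by
            rw [← Real.exp_add]
            ring_nf
          rw [a1, a2, a3]
          ring
      _ ≤ _ := by
          have a1 : Real.exp (-(ε - δ) * n) ≤ Real.exp (-(ε / 2) * n) :=
            Real.exp_le_exp.2 (by nlinarith)
          have a2 : Real.exp (-(ε - 2 * δ) * n) ≤ Real.exp (-(ε / 2) * n) :=
            Real.exp_le_exp.2 (by nlinarith)
          gcongr
  have hexp : Tendsto (fun n : ℕ => Real.exp (-(ε / 2) * n)) atTop (𝓝 0) :=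
    Real.tendsto_exp_atBot.comp (tendsto_natCast_atTop_atTop.const_mul_atTop_of_neg (by linarith))
  have hzero := ((hlim.const_mul (C * Real.exp (δ * |(t : ℝ)|))).add
    ((hexp.comp hns.tendsto_atTop).const_mul
      (C * Real.exp (δ * |(t : ℝ)|) * (C' * Real.exp (δ * |(t : ℝ)|)))))
  rw [mul_zero, mul_zero, add_zero] at hzero
  exact dist_le_zero.1 (ge_of_tendsto' hzero fun k => hbound (ns k))

end StationarySequences

theorem pastField_mono {Ω : Type*} (Z : ℤ → Ω → ℝ) {s t : ℤ} (h : s ≤ t) :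
    pastField Z s ≤ pastField Z t :=
  iSup_mono fun _ => iSup_mono' fun hk => ⟨hk.trans h, le_rfl⟩

theorem measurable_pastField {Ω : Type*} (Z : ℤ → Ω → ℝ) (t : ℤ) :
    Measurable[pastField Z t] (Z t) :=
  measurable_iff_comap_le.2 (le_iSup₂_of_le t le_rfl le_rfl)

theorem pastField_le {Ω : Type*} [mΩ : MeasurableSpace Ω] {Z : ℤ → Ω → ℝ}
    (hZ : ∀ t, Measurable (Z t)) (t : ℤ) : pastField Z t ≤ mΩ :=
  iSup₂_le fun k _ => (hZ k).comap_le

/-- The constant `C` may depend on `ω` while `γ` may not: `γ = exp (η / 2)` spends half of the rate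
and the other half removes `C`. -/
theorem expFastAS_of_ae_le_exp {Ω : Type*} [MeasurableSpace Ω] {P : Measure Ω}
    {u : ℕ → Ω → ℝ≥0∞} {η : ℝ} (hη : 0 < η)
    (h : ∀ᵐ ω ∂P, ∃ C : ℝ, 0 ≤ C ∧ ∀ n : ℕ, u n ω ≤ ENNReal.ofReal (C * Real.exp (-η * n))) :
    ExpFastAS P u := by
  refine ⟨Real.toNNReal (Real.exp (η / 2)), ?_, ?_⟩
  · rw [Real.one_lt_toNNReal]
    exact Real.one_lt_exp_iff.2 (half_pos hη)
  · filter_upwards [h] with ω ⟨C, hC, hu⟩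
    have hlim : Tendsto (fun n : ℕ => ENNReal.ofReal (C * Real.exp (-(η / 2) * n))) atTop (𝓝 0) := by
      have h1 : Tendsto (fun n : ℕ => Real.exp (-(η / 2) * n)) atTop (𝓝 0) :=
        Real.tendsto_exp_atBot.comp
          (tendsto_natCast_atTop_atTop.const_mul_atTop_of_neg (by linarith))
      simpa using ENNReal.tendsto_ofReal (h1.const_mul C)
    refine tendsto_of_tendsto_of_tendsto_of_le_of_le tendsto_const_nhds hlim
      (fun n => zero_le) fun n => ?_
    have e : ((Real.toNNReal (Real.exp (η / 2)) : ℝ≥0) : ℝ≥0∞) ^ n =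
        ENNReal.ofReal (Real.exp (η / 2 * n)) := by
      change ENNReal.ofReal (Real.exp (η / 2)) ^ n = _
      rw [← ENNReal.ofReal_pow (Real.exp_pos _).le, ← Real.exp_nat_mul, mul_comm]
    simp only
    rw [e]
    refine (mul_le_mul' le_rfl (hu n)).trans (le_of_eq ?_)
    rw [← ENNReal.ofReal_mul (Real.exp_pos _).le, mul_left_comm, ← Real.exp_add]
    congr 3
    ring

theorem finiteLogPlusMoment_map {Ω α : Type*} [MeasurableSpace Ω] [MeasurableSpace α]
    {P : Measure Ω} {ξ : Ω → α} (hξ : Measurable ξ) {Y : α → ℝ≥0∞} (hY : Measurable Y)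
    {Y' : Ω → ℝ≥0∞} (h : ∀ᵐ ω ∂P, Y' ω = Y (ξ ω)) (hm : FiniteLogPlusMoment P Y') :
    FiniteLogPlusMoment (P.map ξ) Y := by
  rw [FiniteLogPlusMoment, lintegral_map (f := fun a => logPlus (Y a)) (measurable_logPlus.comp hY) hξ]
  rwa [FiniteLogPlusMoment, lintegral_congr_ae (h.mono fun ω hω => congrArg logPlus hω)] at hm

theorem negativeLogMean_map {Ω α : Type*} [MeasurableSpace Ω] [MeasurableSpace α]
    {P : Measure Ω} {ξ : Ω → α} (hξ : Measurable ξ) {Y : α → ℝ≥0∞} (hY : Measurable Y)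
    {Y' : Ω → ℝ≥0∞} (h : ∀ᵐ ω ∂P, Y' ω = Y (ξ ω)) (hm : NegativeLogMean P Y') :
    NegativeLogMean (P.map ξ) Y := by
  rw [NegativeLogMean, lintegral_map (f := fun a => logPlus (Y a)) (measurable_logPlus.comp hY) hξ,
    lintegral_map (f := fun a => logMinus (Y a)) (measurable_logMinus.comp hY) hξ]
  rwa [NegativeLogMean, lintegral_congr_ae (h.mono fun ω hω => congrArg logPlus hω),
    lintegral_congr_ae (h.mono fun ω hω => congrArg logMinus hω)] at hm

/-- Subexponential growth of a stationary functional of an ergodic path with finite logarithmic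
moment. -/
theorem ae_subexponential_of_shift {E : Type*} [MeasurableSpace E] {μ : Measure (ℤ → E)}
    [IsProbabilityMeasure μ] (hμ : Ergodic shiftSeq μ) {v : ℤ → (ℤ → E) → ℝ≥0∞}
    (hv : ∀ t, Measurable (v t)) (hshift : ∀ t x, v 0 (shiftBy t x) = v t x)
    (h : FiniteLogPlusMoment μ (v 0)) :
    ∀ᵐ x ∂μ, (∀ t, v t x ≠ ⊤) ∧ Subexponential fun t => (v t x).toReal := by
  refine ae_subexponential_of_finiteLogPlusMoment (fun t => (hv t).aemeasurable) (fun t => ?_) h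
  rw [← map_comp_shiftBy hμ.toMeasurePreserving (hv 0).aemeasurable t]
  simp_rw [hshift]

/-! ### Transfer between the probability space and the path space -/

namespace VolatilityFamily

variable {d p q : ℕ} {M : VolatilityFamily d p q} {K : TopologicalSpace.Compacts (Vec d)}

section Path

variable {Ω : Type*} [MeasurableSpace Ω] {P : Measure Ω} {Z X σ : ℤ → Ω → ℝ}

/-- The observations `σ_t Z_t` as an exactly adapted path. -/
def obsPath (Z σ : ℤ → Ω → ℝ) (ω : Ω) (t : ℤ) : ℝ := σ t ω * Z t ω

theorem IsSolution.measurable_obsPath {θ₀ : Vec d} (h : M.IsSolution P Z θ₀ X σ) {s t : ℤ}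
    (hst : s ≤ t) : Measurable[pastField Z t] fun ω => obsPath Z σ ω s :=
  ((h.measurable s).mono (pastField_mono Z (by omega)) le_rfl).mul
    ((measurable_pastField Z s).mono (pastField_mono Z hst) le_rfl)

theorem IsSolution.ae_eq_obsPath {θ₀ : Vec d} (h : M.IsSolution P Z θ₀ X σ) :
    ∀ᵐ ω ∂P, (fun t => X t ω) = obsPath Z σ ω := by
  filter_upwards [ae_all_iff.2 h.obs] with ω hω
  exact funext hω

theorem ergodic_obsPath {θ₀ : Vec d} (h : M.IsSolution P Z θ₀ X σ)
    (he : IsStationaryErgodicSeq P fun t ω => (X t ω, σ t ω)) :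
    Ergodic shiftSeq (P.map (obsPath Z σ)) := by
  have := isStationaryErgodicSeq_factor (ξ := fun ω t => (X t ω, σ t ω))
    (aemeasurable_pi_lambda _ he.aemeasurable) he.ergodic (G := fun x t => (x t).1)
    (fun t => measurable_fst.comp (measurable_pi_apply t)) (fun x t => rfl)
  have hlaw : P.map (obsPath Z σ) = processLaw P X :=
    Measure.map_congr (h.ae_eq_obsPath.mono fun ω hω => hω.symm)
  rw [hlaw]
  exact this.ergodic

end Path

theorem randomPhi_eq (hM : M.IsRegularOn K) {Ω : Type*} {X : ℤ → Ω → ℝ} {ξ : Ω → ℤ → ℝ} {ω : Ω}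
    (h : (fun t => X t ω) = ξ ω) : hM.randomPhi X ω = hM.pathPhi (ξ ω) := by
  rw [← h]
  rfl

section Stationary

variable (hM : M.IsRegularOn K) {Ω : Type*} [MeasurableSpace Ω] {P : Measure Ω}
  [IsProbabilityMeasure P] {X : ℤ → Ω → ℝ} {ξ : Ω → ℤ → ℝ}

theorem measurable_forwardIterate_path (o : NonnegFun K q) (i : ℤ) (n : ℕ) :
    Measurable fun x : ℤ → ℝ => forwardIterate (hM.pathPhi x) i n o :=
  hM.measurable_forwardIterate_pathPhi (Y := fun t (x : ℤ → ℝ) => x t) measurable_const i n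
    fun k _ => measurable_pi_apply k

theorem measurable_limitSol_path (o : NonnegFun K q) (t : ℤ) :
    Measurable fun x : ℤ → ℝ => hM.limitSol o x t :=
  hM.measurable_limitSol (Y := fun t (x : ℤ → ℝ) => x t) o fun k _ => measurable_pi_apply k

theorem pathPhi_eq_forwardIterate (x : ℤ → ℝ) (t : ℤ) :
    hM.pathPhi x t = forwardIterate (hM.pathPhi x) t 1 :=
  funext fun s => by simp [forwardIterate_succ]

/-- The average contraction conditions depend on the law of the observation path only. They are
moved to path space, where the shift is ergodic, and the almost sure conclusions are pulled back
along `ξ`. -/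
theorem ae_contracts_and_subexponential {ς : orthant q} (hξ : Measurable ξ)
    (hμ : Ergodic shiftSeq (P.map ξ)) (hX : ∀ᵐ ω ∂P, (fun t => X t ω) = ξ ω)
    (hΦ : hM.IsContractiveOnAverage P X ς) :
    ∃ ε > 0, ∀ᵐ ω ∂P, ContractsExp (hM.pathPhi (ξ ω)) ε ∧
      Subexponential fun t => dist (hM.pathPhi (ξ ω) t (constFun K ς)) (constFun K ς) := by
  have : IsProbabilityMeasure (P.map ξ) := Measure.isProbabilityMeasure_map hξ.aemeasurable
  obtain ⟨r, hr, hcontr⟩ := hΦ.contr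
  have hmlip := hM.measurable_lipConst_forwardIterate
  have hlip : FiniteLogPlusMoment (P.map ξ) fun x => lipConst (hM.pathPhi x 0) := by
    refine finiteLogPlusMoment_map hξ ?_ ?_ hΦ.lip
    · simp_rw [pathPhi_eq_forwardIterate]
      exact hmlip 0 1
    · filter_upwards [hX] with ω hω
      rw [randomPhi_eq hM hω]
  have hneg : NegativeLogMean (P.map ξ) fun x => lipConst (pastIterate (hM.pathPhi x) 0 r) := by
    refine negativeLogMean_map hξ ?_ ?_ hcontr
    · simp_rw [pastIterate_eq_forwardIterate]
      exact hmlip _ r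
    · filter_upwards [hX] with ω hω
      rw [randomPhi_eq hM hω]
  obtain ⟨ε, hε, hc⟩ := ae_contractsExp hμ (Φ := hM.pathPhi)
    (fun k x t => hM.pathPhi_shiftBy k x t) hmlip hlip hr hneg
  refine ⟨ε, hε, ?_⟩
  set o := constFun K ς
  have hvm : ∀ t, Measurable fun x : ℤ → ℝ => ‖(hM.pathPhi x t o).1‖ₑ := fun t => by
    have := measurable_forwardIterate_path hM o t 1
    simp_rw [← pathPhi_eq_forwardIterate] at this
    exact (continuous_subtype_val.enorm.measurable).comp this
  have hinit : FiniteLogPlusMoment (P.map ξ) fun x => ‖(hM.pathPhi x 0 o).1‖ₑ := by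
    refine finiteLogPlusMoment_map hξ (hvm 0) ?_ hΦ.init
    filter_upwards [hX] with ω hω
    rw [randomPhi_eq hM hω]
  have hsub := ae_subexponential_of_shift hμ (v := fun t x => ‖(hM.pathPhi x t o).1‖ₑ) hvm
    (fun t x => by rw [hM.pathPhi_shiftBy, zero_add]) hinit
  filter_upwards [ae_of_ae_map hξ.aemeasurable hc, ae_of_ae_map hξ.aemeasurable hsub]
    with ω h1 h2
  refine ⟨h1, (h2.2.add (Subexponential.const ‖o.1‖)).mono fun t => ?_⟩
  rw [toReal_enorm]
  exact (dist_eq_norm (hM.pathPhi (ξ ω) t o).1 o.1).trans_le (norm_sub_le _ _)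

/-- The supremum runs over an uncountable set, but it is a lower semicontinuous function of the
gradient, viewed as a random element of a space of continuous functions. -/
theorem measurable_supNorm_dpsi (o : NonnegFun K q) (t : ℤ) (j : Fin q) (k : Fin d ⊕ Fin q) :
    Measurable fun x : ℤ → ℝ => supNorm K fun θ : K =>
      M.dpsi K (fun i => x (t - (i : ℕ))) j k θ ((hM.limitSol o x t).1 θ) := by
  have hG : Measurable fun x : ℤ → ℝ =>
      hM.grad (fun i => x (t - (i : ℕ))) (hM.limitSol o x t) :=
    hM.measurable_grad_limitSol (Y := fun t (x : ℤ → ℝ) => x t) o fun k _ => measurable_pi_apply k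
  have hlsc : LowerSemicontinuous fun G : C(K, Vec d × Vec q →L[ℝ] Vec q) =>
      supNorm K fun θ : K => G θ (direction k) j := by
    refine lowerSemicontinuous_iSup fun θ => Continuous.lowerSemicontinuous ?_
    have h1 : Continuous fun G : C(K, Vec d × Vec q →L[ℝ] Vec q) => G θ := by fun_prop
    have h2 : Continuous fun G : C(K, Vec d × Vec q →L[ℝ] Vec q) => G θ (direction k) :=
      h1.clm_apply continuous_const
    exact ((EuclideanSpace.proj j : Vec q →L[ℝ] ℝ).continuous.comp h2).enorm
  have := hlsc.measurable.comp hG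
  simp only [Function.comp_def, grad_direction] at this
  exact this

theorem abs_dpsi_le_supNorm {x : Fin p → ℝ} {s : NonnegFun K q} {j : Fin q} {k : Fin d ⊕ Fin q}
    (h : (supNorm K fun θ : K => M.dpsi K x j k θ (s.1 θ)) ≠ ⊤) (θ : K) :
    |M.dpsi K x j k θ (s.1 θ)| ≤
      (supNorm K fun θ : K => M.dpsi K x j k θ (s.1 θ)).toReal := by
  have h1 : ‖M.dpsi K x j k θ (s.1 θ)‖ₑ ≤ supNorm K fun θ : K => M.dpsi K x j k θ (s.1 θ) :=
    le_iSup (fun θ : K => ‖M.dpsi K x j k θ (s.1 θ)‖ₑ) θ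
  have := ENNReal.toReal_mono h h1
  rwa [toReal_enorm] at this

/-- The sup norms of the parameter derivatives along `limitSol` are shift-equivariant functionals of
the path, so their logarithmic moment at time `0` controls all times. -/
theorem ae_subexponential_pathStep_zero (hξ : Measurable ξ)
    (hμ : Ergodic shiftSeq (P.map ξ)) (hX : ∀ᵐ ω ∂P, (fun t => X t ω) = ξ ω) {o : NonnegFun K q}
    {h : ℤ → Ω → NonnegFun K q} (hh : ∀ᵐ ω ∂P, ∀ t, h t ω = hM.limitSol o (ξ ω) t)
    (hD : M.DerivCondition K P X h) :
    ∀ᵐ ω ∂P, Subexponential fun t => ‖hM.pathStep (ξ ω) (hM.limitSol o (ξ ω)) t 0‖ := by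
  have : IsProbabilityMeasure (P.map ξ) := Measure.isProbabilityMeasure_map hξ.aemeasurable
  set v : Fin q → Fin d → ℤ → (ℤ → ℝ) → ℝ≥0∞ := fun j k t x => supNorm K fun θ : K =>
    M.dpsi K (fun i => x (t - (i : ℕ))) j (Sum.inl k) θ ((hM.limitSol o x t).1 θ) with hv
  have hsub : ∀ j k, ∀ᵐ x ∂(P.map ξ), (∀ t, v j k t x ≠ ⊤) ∧
      Subexponential fun t => (v j k t x).toReal := by
    intro j k
    refine ae_subexponential_of_shift hμ (fun t => measurable_supNorm_dpsi hM o t j (Sum.inl k))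
      (fun t x => ?_) ?_
    · simp only [hv, hM.limitSol_shiftBy, zero_add, shiftBy]
      congr 1
      funext θ
      congr 1
      funext i
      congr 1
      ring
    · refine finiteLogPlusMoment_map hξ (measurable_supNorm_dpsi hM o 0 j (Sum.inl k)) ?_
        (hD.moment j (Sum.inl k))
      filter_upwards [hX, hh] with ω h1 h2
      rw [h2 0, ← h1]
      rfl
  have hall := ae_of_ae_map hξ.aemeasurable (ae_all_iff.2 fun j => ae_all_iff.2 fun k => hsub j k)
  filter_upwards [hall] with ω hω
  refine (Subexponential.sum Finset.univ fun j _ =>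
    Subexponential.sum Finset.univ fun k _ => (hω j k).2).mono fun t => ?_
  exact norm_derivStep_zero_le hM _ _ (fun j k => ENNReal.toReal_nonneg)
    fun j k θ => abs_dpsi_le_supNorm ((hω j k).1 t) θ

/-- The Hölder coefficient may be negative; the logarithmic moment concerns its positive part, which
is also what `ENNReal.ofReal` retains. -/
theorem ae_subexponential_holder {C : ℤ → Ω → ℝ}
    (hC : IsStationarySeq P C) (hm : FiniteLogPlusMoment P fun ω => ENNReal.ofReal (C 0 ω)) :
    ∀ᵐ ω ∂P, Subexponential fun t => max (C t ω) 0 := by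
  have hs := hC.comp ENNReal.measurable_ofReal
  have := ae_subexponential_of_finiteLogPlusMoment hs.aemeasurable hs.map_eq hm
  filter_upwards [this] with ω hω
  exact hω.2

end Stationary

theorem isStationaryErgodicSeq_limitSol (hM : M.IsRegularOn K) {Ω : Type*}
    [MeasurableSpace Ω] {P : Measure Ω} {ξ : Ω → ℤ → ℝ} (hξ : Measurable ξ)
    (hμ : Ergodic shiftSeq (P.map ξ)) (o : NonnegFun K q) :
    IsStationaryErgodicSeq P fun t ω => hM.limitSol o (ξ ω) t :=
  isStationaryErgodicSeq_factor hξ.aemeasurable hμ (measurable_limitSol_path hM o)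
    fun x t => hM.limitSol_shiftBy o 1 x t

/-- Post-composition with `derivEquiv`. -/
noncomputable def toDerivFun (e : C(K, Vec d →L[ℝ] Vec q)) : C(K, DerivVec d q) :=
  ContinuousMap.comp ⟨derivEquiv d q, (derivEquiv d q).continuous⟩ e

/-- Post-composition with the inverse of `derivEquiv`. -/
noncomputable def ofDerivFun (w : C(K, DerivVec d q)) : C(K, Vec d →L[ℝ] Vec q) :=
  ContinuousMap.comp ⟨(derivEquiv d q).symm, (derivEquiv d q).symm.continuous⟩ w

theorem toDerivFun_apply (e : C(K, Vec d →L[ℝ] Vec q)) (θ : K) :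
    toDerivFun e θ = derivEquiv d q (e θ) := rfl

theorem derivEquiv_ofDerivFun (w : C(K, DerivVec d q)) (θ : K) :
    derivEquiv d q (ofDerivFun w θ) = w θ := (derivEquiv d q).apply_symm_apply _

theorem measurable_toDerivFun :
    Measurable (toDerivFun : C(K, Vec d →L[ℝ] Vec q) → C(K, DerivVec d q)) :=
  (ContinuousMap.continuous_postcomp _).measurable

theorem measurable_ofDerivFun :
    Measurable (ofDerivFun : C(K, DerivVec d q) → C(K, Vec d →L[ℝ] Vec q)) :=
  (ContinuousMap.continuous_postcomp _).measurable

theorem HasDerivInterior.firstDeriv_eq (hM : M.IsRegularOn K) {s : C(K, Vec q)}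
    {e : C(K, Vec d →L[ℝ] Vec q)} (h : HasDerivInterior K s e) (θ : K) :
    firstDeriv K s θ = derivEquiv d q (e θ) := by
  rw [← h.derivOn_eq hM θ]
  rfl

theorem hHat_eq_forwardIterate (hM : M.IsRegularOn K) {Ω : Type*} (X : ℤ → Ω → ℝ) (ς : orthant q)
    (n : ℕ) (ω : Ω) :
    hM.hHat X ς n ω = forwardIterate (hM.pathPhi fun t => X t ω) 0 n (constFun K ς) := by
  induction n with
  | zero => rfl
  | succ n ih =>
    rw [forwardIterate_succ, ← ih, zero_add]
    rfl

theorem hasDerivInterior_orbit (hM : M.IsRegularOn K) (x : ℤ → ℝ) (ς : orthant q) (n : ℕ) :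
    HasDerivInterior K (forwardIterate (hM.pathPhi x) 0 n (constFun K ς)).1
      (forwardIterate (hM.pathStep x (hM.orbitFrom (constFun K ς) x 0)) 0 n 0) := by
  have h0 : HasDerivInterior K (hM.orbitFrom (constFun K ς) x 0 0).1 0 :=
    hasDerivInterior_const _
  have := h0.forwardIterate hM x _ 0 (orbitFrom_succ hM 0) n
  rwa [orbitFrom_add] at this

theorem supNorm_toDerivFun_sub_le (a b : C(K, Vec d →L[ℝ] Vec q)) :
    (supNorm K fun θ : K => derivEquiv d q (a θ) - toDerivFun b θ) ≤
      ENNReal.ofReal (‖(derivEquiv d q : (Vec d →L[ℝ] Vec q) →L[ℝ] DerivVec d q)‖ * dist a b) := by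
  refine iSup_le fun θ => ?_
  change ‖derivEquiv d q (a θ) - toDerivFun b θ‖ₑ ≤ _
  rw [toDerivFun_apply, ← map_sub, ← ofReal_norm]
  refine ENNReal.ofReal_le_ofReal (((derivEquiv d q :
    (Vec d →L[ℝ] Vec q) →L[ℝ] DerivVec d q).le_opNorm (a θ - b θ)).trans ?_)
  rw [← dist_eq_norm]
  gcongr
  exact ContinuousMap.dist_apply_le_dist θ

section SolutionPath

variable (hM : M.IsRegularOn K) {Ω : Type*} [MeasurableSpace Ω] {P : Measure Ω}
  {X Z σ : ℤ → Ω → ℝ} {ξ : Ω → ℤ → ℝ} {o : NonnegFun K q} {ε : ℝ}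

theorem limitSol_solves_and_subexponential {x : ℤ → ℝ} (hε : 0 < ε)
    (hc : ContractsExp (hM.pathPhi x) ε)
    (ho : Subexponential fun t => dist (hM.pathPhi x t o) o) :
    (∀ t, hM.limitSol o x (t + 1) = hM.pathPhi x t (hM.limitSol o x t)) ∧
      Subexponential fun t => dist (hM.limitSol o x t) o :=
  ⟨hc.limit_solves (limitSol_tendsto hM hc hε ho),
    hc.subexponential_limit hε ho (limitSol_tendsto hM hc hε ho)⟩

theorem limitDeriv_solves_and_subexponential {x : ℤ → ℝ} (hε : 0 < ε)
    (hc : ContractsExp (hM.pathPhi x) ε)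
    (ho : Subexponential fun t => dist (hM.pathPhi x t o) o)
    (hd : Subexponential fun t => ‖hM.pathStep x (hM.limitSol o x) t 0‖) :
    (∀ t, hM.limitDeriv o x (t + 1) =
        hM.pathStep x (hM.limitSol o x) t (hM.limitDeriv o x t)) ∧
      Subexponential fun t => dist (hM.limitDeriv o x t) 0 := by
  have hh := (limitSol_solves_and_subexponential hM hε hc ho).1
  have hlim := limitDeriv_tendsto hM hc hε hh hd
  have hcs := contractsExp_pathStep hM hc hh
  exact ⟨hcs.limit_solves hlim,
    hcs.subexponential_limit hε (hd.mono fun _ => (dist_zero_derivFun _).le) hlim⟩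

theorem isStationaryErgodicSeq_limitDeriv (hξ : Measurable ξ)
    (hμ : Ergodic shiftSeq (P.map ξ)) (o : NonnegFun K q) :
    IsStationaryErgodicSeq P fun t ω => toDerivFun (hM.limitDeriv o (ξ ω) t) :=
  isStationaryErgodicSeq_factor (G := fun x t => toDerivFun (hM.limitDeriv o x t))
    hξ.aemeasurable hμ
    (fun _ => measurable_toDerivFun.comp (hM.measurable_limitDeriv
      (Y := fun t (x : ℤ → ℝ) => x t) o fun k _ => measurable_pi_apply k))
    fun x t => congrArg toDerivFun (hM.limitDeriv_shiftBy o 1 x t)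

theorem measurable_toDerivFun_limitDeriv {θ₀ : Vec d} (h : M.IsSolution P Z θ₀ X σ)
    (o : NonnegFun K q) (t : ℤ) :
    Measurable[pastField Z (t - 1)] fun ω => toDerivFun (hM.limitDeriv o (obsPath Z σ ω) t) :=
  measurable_toDerivFun.comp (@IsRegularOn.measurable_limitDeriv d p q M K Ω (pastField Z (t - 1))
    (fun t ω => obsPath Z σ ω t) hM o t fun k hk => h.measurable_obsPath (by omega))

/-- Rewrites the coordinate recursion along `h` as the operator recursion along `limitSol` and,
since time is countable, places all times inside one almost sure event. -/
theorem solvesDerivSRE_iff {h : ℤ → Ω → NonnegFun K q} (hX : ∀ᵐ ω ∂P, (fun t => X t ω) = ξ ω)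
    (hh : ∀ᵐ ω ∂P, ∀ t, h t ω = hM.limitSol o (ξ ω) t) (D : ℤ → Ω → C(K, DerivVec d q)) :
    M.SolvesDerivSRE K P X h D ↔ ∀ᵐ ω ∂P, ∀ t, ofDerivFun (D (t + 1) ω) =
      hM.pathStep (ξ ω) (hM.limitSol o (ξ ω)) t (ofDerivFun (D t ω)) := by
  have key : ∀ ω t, (fun t => X t ω) = ξ ω → (∀ t, h t ω = hM.limitSol o (ξ ω) t) →
      ((∀ (θ : K) (j : Fin q) (k : Fin d), D (t + 1) ω θ (j, k) =
        M.dpsi K (lagVec p X t ω) j (Sum.inl k) θ ((h t ω).1 θ) +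
          ∑ i : Fin q, M.dpsi K (lagVec p X t ω) j (Sum.inr i) θ ((h t ω).1 θ) *
            D t ω θ (i, k)) ↔
      ofDerivFun (D (t + 1) ω) =
        hM.pathStep (ξ ω) (hM.limitSol o (ξ ω)) t (ofDerivFun (D t ω))) := by
    intro ω t h1 h2
    have hstep : ∀ (θ : K) (j : Fin q) (k : Fin d),
        derivEquiv d q (hM.pathStep (ξ ω) (hM.limitSol o (ξ ω)) t (ofDerivFun (D t ω)) θ) (j, k) =
        M.dpsi K (lagVec p X t ω) j (Sum.inl k) θ ((h t ω).1 θ) +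
          ∑ i : Fin q, M.dpsi K (lagVec p X t ω) j (Sum.inr i) θ ((h t ω).1 θ) *
            D t ω θ (i, k) := fun θ j k => by
      rw [IsRegularOn.pathStep, derivEquiv_derivStep, derivEquiv_ofDerivFun, h2 t, ← h1]
      rfl
    simp only [← hstep]
    constructor
    · intro H
      refine ContinuousMap.ext fun θ => (derivEquiv d q).injective ?_
      rw [derivEquiv_ofDerivFun]
      ext ⟨j, k⟩
      exact H θ j k
    · intro H θ j k
      rw [← H, derivEquiv_ofDerivFun]
  rw [SolvesDerivSRE, ← ae_all_iff]
  constructor <;> intro H <;> filter_upwards [H, hX, hh] with ω h0 h1 h2 t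
  · exact (key ω t h1 h2).1 (h0 t)
  · exact (key ω t h1 h2).2 (h0 t)

theorem ofDerivFun_toDerivFun (e : C(K, Vec d →L[ℝ] Vec q)) : ofDerivFun (toDerivFun e) = e :=
  ContinuousMap.ext fun _ => (derivEquiv d q).symm_apply_apply _

theorem toDerivFun_ofDerivFun (w : C(K, DerivVec d q)) : toDerivFun (ofDerivFun w) = w :=
  ContinuousMap.ext fun _ => (derivEquiv d q).apply_symm_apply _

end SolutionPath

end VolatilityFamily

/-! ### Assembly of the proposition -/

open VolatilityFamily in
theorem proposition6p1 {d p q : ℕ} (M : VolatilityFamily d p q)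
    {Ω : Type*} [MeasurableSpace Ω] (P : Measure Ω) [IsProbabilityMeasure P]
    (Z X σ : ℤ → Ω → ℝ) (hZ : IsNoise P Z)
    (θ₀ : Vec d) (hθ₀ : θ₀ ∈ M.Θ) (hXσ : M.IsUniqueStationaryErgodicSolution P Z θ₀ X σ)
    (K : TopologicalSpace.Compacts (Vec d)) (hM : M.IsRegularOn K)
    (ς : orthant q) (hΦ : hM.IsContractiveOnAverage P X ς) :
    (∃ h : ℤ → Ω → NonnegFun K q, hM.IsStationarySolution P X h) ∧
    ∀ h : ℤ → Ω → NonnegFun K q, hM.IsStationarySolution P X h → M.DerivCondition K P X h →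
      (∀ t ω, IsC1 K (hM.hHat X ς t ω).1) ∧
      ∃ D : ℤ → Ω → C(K, DerivVec d q),
        IsStationaryErgodicSeq P D ∧
        M.SolvesDerivSRE K P X h D ∧
        (∀ D' : ℤ → Ω → C(K, DerivVec d q), IsStationarySeq P D' →
          M.SolvesDerivSRE K P X h D' → ∀ t, D' t =ᵐ[P] D t) ∧
        (∀ t, Measurable[pastField Z (t - 1)] (D t)) ∧
        (∀ t, ∀ᵐ ω ∂P, IsC1 K (h t ω).1 ∧ ∀ θ, firstDeriv K (h t ω).1 θ = D t ω θ) ∧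
        ExpFastAS P fun t ω =>
          supNorm K fun θ => firstDeriv K (hM.hHat X ς t ω).1 θ - D (t : ℤ) ω θ := by
  -- `X t` equals `σ t * Z t` only almost surely and need not be adapted. Working with the product
  -- makes every functional of the past exactly measurable for `pastField`.
  set ξ : Ω → ℤ → ℝ := obsPath Z σ with hξdef
  set o : NonnegFun K q := constFun K ς with hodef
  have hξ : Measurable ξ := measurable_pi_lambda _ fun t =>
    (hXσ.isSolution.measurable_obsPath le_rfl).mono (pastField_le hZ.measurable t) le_rfl
  have hμ : Ergodic shiftSeq (P.map ξ) := ergodic_obsPath hXσ.isSolution hXσ.stationaryErgodic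
  have hX : ∀ᵐ ω ∂P, (fun t => X t ω) = ξ ω := hXσ.isSolution.ae_eq_obsPath
  obtain ⟨ε, hε, hgood⟩ := ae_contracts_and_subexponential hM hξ hμ hX hΦ
  have hsol : ∀ᵐ ω ∂P, (∀ t, hM.limitSol o (ξ ω) (t + 1) =
      hM.pathPhi (ξ ω) t (hM.limitSol o (ξ ω) t)) ∧
      Subexponential fun t => dist (hM.limitSol o (ξ ω) t) o := by
    filter_upwards [hgood] with ω hω
    exact limitSol_solves_and_subexponential hM hε hω.1 hω.2
  refine ⟨⟨fun t ω => hM.limitSol o (ξ ω) t,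
    (isStationaryErgodicSeq_limitSol hM hξ hμ o).isStationarySeq, fun t => ?_⟩, ?_⟩
  · filter_upwards [hsol, hX] with ω h1 h2
    rw [randomPhi_eq hM h2]
    exact h1.1 t
  intro h hh hD
  -- Any stationary solution coincides with the backward limit, so the derivative conditions assumed
  -- along `h` hold along `limitSol`.
  have hlim : ∀ᵐ ω ∂P, ∀ t, h t ω = hM.limitSol o (ξ ω) t := by
    refine ae_all_iff.2 (ae_eq_of_isStationarySeq (φ := fun ω => hM.pathPhi (ξ ω))
      (h := fun t ω => hM.limitSol o (ξ ω) t) hε hh.stationary (hgood.mono fun ω hω => hω.1)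
      (hsol.mono fun ω hω => hω.2) (hsol.mono fun ω hω => hω.1) ?_)
    filter_upwards [ae_all_iff.2 hh.sre, hX] with ω h1 h2
    rwa [randomPhi_eq hM h2] at h1
  have hzero := ae_subexponential_pathStep_zero hM hξ hμ hX hlim hD
  have hderiv : ∀ᵐ ω ∂P, (∀ t, hM.limitDeriv o (ξ ω) (t + 1) =
      hM.pathStep (ξ ω) (hM.limitSol o (ξ ω)) t (hM.limitDeriv o (ξ ω) t)) ∧
      Subexponential fun t => dist (hM.limitDeriv o (ξ ω) t) 0 := by
    filter_upwards [hgood, hzero] with ω h1 h2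
    exact limitDeriv_solves_and_subexponential hM hε h1.1 h1.2 h2
  obtain ⟨c, κ, hcstat, hcm, hκ0, hκ1, hH⟩ := hD.holder
  -- One estimate, uniform in the starting time, serves both remaining claims: `i = t - n` for the
  -- derivative of `h t` and `i = 0` for the convergence of the derivatives of `hHat`.
  have horbit : ∀ᵐ ω ∂P, ∃ C > 0, ∀ (i : ℤ) (n : ℕ),
      dist (forwardIterate (hM.pathStep (ξ ω) (hM.orbitFrom o (ξ ω) i)) i n 0)
        (hM.limitDeriv o (ξ ω) (i + n)) ≤
        C * Real.exp (-(κ * ε / 4) * n + κ * ε / 8 * |(i : ℝ)|) := by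
    filter_upwards [hgood, hsol, hderiv, ae_subexponential_holder hcstat hcm, ae_all_iff.2 hH, hX]
      with ω h1 h2 h3 h4 h5 h6
    refine exists_dist_deriv_orbit_le hM h1.1 hε h2.1 h2.2 h3.1
      (h3.2.mono fun t => (dist_zero_derivFun _).ge) (fun t => le_max_right _ _) h4 hκ0 hκ1
      fun t j k u hu u' hu' θ hθ => ?_
    rw [← h6]
    refine (h5 t j k u hu u' hu' θ hθ).trans ?_
    gcongr
    exact le_max_left _ _
  refine ⟨fun t ω => ?_, fun t ω => toDerivFun (hM.limitDeriv o (ξ ω) t),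
    isStationaryErgodicSeq_limitDeriv hM hξ hμ o, ?_, fun D' hD' hsol' t => ?_,
    measurable_toDerivFun_limitDeriv hM hXσ.isSolution o, fun t => ?_, ?_⟩
  · rw [hHat_eq_forwardIterate]
    exact (hasDerivInterior_orbit hM _ ς t).isC1
  · rw [solvesDerivSRE_iff hM hX hlim]
    filter_upwards [hderiv] with ω hω t
    simp only [ofDerivFun_toDerivFun]
    exact hω.1 t
  -- Uniqueness is the general comparison with a solution of subexponential growth, applied to the
  -- derivative recursion with reference point `0`.
  · rw [solvesDerivSRE_iff hM hX hlim] at hsol'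
    have huniq := ae_eq_of_isStationarySeq
      (φ := fun ω => hM.pathStep (ξ ω) (hM.limitSol o (ξ ω)))
      (h := fun t ω => hM.limitDeriv o (ξ ω) t) hε (hD'.comp measurable_ofDerivFun)
      (by
        filter_upwards [hgood, hsol] with ω h1 h2
        exact contractsExp_pathStep hM h1.1 h2.1)
      (hderiv.mono fun ω hω => hω.2) (hderiv.mono fun ω hω => hω.1) hsol' t
    filter_upwards [huniq] with ω hω
    rw [← hω, toDerivFun_ofDerivFun]
  · filter_upwards [hgood, hlim, horbit] with ω h1 h2 ⟨C, hC, hb⟩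
    have hd := hasDerivInterior_limit hM (ς := ς) (h := fun t => hM.limitSol o (ξ ω) t) hε
      (limitSol_tendsto hM h1.1 hε h1.2) hκ0 hb hC.le t
    rw [h2 t]
    exact ⟨hd.isC1, fun θ => hd.firstDeriv_eq hM θ⟩
  -- The rate `κ * ε / 4` is deterministic; only `C` varies with `ω`. Passing to coordinates costs
  -- the operator norm of `derivEquiv`.
  · refine expFastAS_of_ae_le_exp (η := κ * ε / 4) (by positivity) ?_
    filter_upwards [horbit, hX] with ω ⟨C, hC, hb⟩ h2
    refine ⟨‖(derivEquiv d q : (Vec d →L[ℝ] Vec q) →L[ℝ] DerivVec d q)‖ * C, by positivity,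
      fun n => ?_⟩
    have hd := hasDerivInterior_orbit hM (ξ ω) ς n
    have e1 : ∀ θ, firstDeriv K (hM.hHat X ς n ω).1 θ = derivEquiv d q (forwardIterate
        (hM.pathStep (ξ ω) (hM.orbitFrom o (ξ ω) 0)) 0 n 0 θ) := fun θ => by
      rw [hHat_eq_forwardIterate, h2]
      exact hd.firstDeriv_eq hM θ
    simp only [e1]
    refine (supNorm_toDerivFun_sub_le _ _).trans (ENNReal.ofReal_le_ofReal ?_)
    rw [mul_assoc]
    gcongr
    have := hb 0 n
    simpa using this
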